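/- Let $G=(V,E)$ be a simple graph with $n$ vertices, $m\ge 1$ edges and maximum degree $\Delta$. A partial $(\Delta+1)$-edge coloring is a map $\chi:E\to\{1,\dots,\Delta+1\}\cup\{\bot\}$ such that no two distinct edges that share a vertex have the same color $\neq\bot$; edges with value $\bot$ are uncolored, and $\mathrm{miss}_\chi(x)$ is the set of colors that no edge incident on $x$ has. A u-fan is a tuple $f=(u,v,w,\alpha,\beta)$ of distinct vertices $u,v,w$ and distinct colors $\alpha,\beta$ such that $(u,v)$ and $(u,w)$ are uncolored edges, $\alpha\in\mathrm{miss}_\chi(u)$ and $\beta\in\mathrm{miss}_\chi(v)\cap\mathrm{miss}_\chi(w)$; it assigns $c_f(u)=\alpha$ and $c_f(v)=c_f(w)=\beta$. A collection $\mathcal U$ of u-fans is separable if its members are pairwise edge-disjoint and, for each vertex $x$, the colors $c_f(x)$ of the different $f\in\mathcal U$ that contain $x$ are distinct. There are a randomized algorithm (a single word RAM program), constants $\varepsilon>0$ and $K$, and for every $c\in\mathbb N$ a constant $C_c$, such that the following holds for every such $G$, every partial $(\Delta+1)$-edge coloring $\chi$ of $G$, every separable collection $\mathcal U$ of $\lambda$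 u-fans, and every word size of at least $K\lceil\log_2(n+1)\rceil$ bits. Given $G$ (as a list of its edges in any order, together with $n$, $m$ and $\Delta$), $\chi$ (as the list of the colors of these edges) and $\mathcal U$ (as a list of its members in any order), 1. whenever the algorithm halts, it has modified $\chi$ to a partial $(\Delta+1)$-edge coloring $\chi'$ of $G$ in which every edge colored by $\chi$ is still colored (possibly differently), and in which at least $\varepsilon\lambda$ of the (previously uncolored) edges of the u-fans in $\mathcal U$ are colored; 2. for every $c\in\mathbb N$, the algorithm halts within $C_c\, m\log n$ steps (that is, within $t$ steps for every integer $t\ge C_c\,m\log n$) with probability at least $1-n^{-c}$. Here the word RAM has registers and word-indexed arrays that are initially zero except for the input. In one step it executes one statement of the fixed program: an assignment or an array access with arithmetic on words, a test, or drawing a uniformly random integer below a given word. -/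

import Mathlib

/-! ### Partial edge colorings, u-fans and separable collections -/

/-- A (proper) partial edge coloring of `G` with colors `Fin k`.  The value `none` is the symbol `⊥`
(uncolored).  Pairs that are not edges of `G` carry the dummy value `none`, so that such colorings
are the same thing as functions on the edge set of `G`. -/
structure PartialEdgeColoring {V : Type*} (G : SimpleGraph V) (k : ℕ) where
  color : Sym2 V → Option (Fin k)
  mem_edgeSet_of_color : ∀ e c, color e = some c → e ∈ G.edgeSet
  proper : ∀ e f c x, x ∈ e → x ∈ f → color e = some c → color f = some c → e = f

/-- The palette of `u`: the colors that no edge incident on `u` has. -/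
def PartialEdgeColoring.miss {V : Type*} {G : SimpleGraph V} {k : ℕ}
    (χ : PartialEdgeColoring G k) (u : V) : Set (Fin k) :=
  {c | ∀ e, u ∈ e → χ.color e ≠ some c}

/-- `χ'` arises from `χ` by extending it to the edges in `F`: in `χ'` all edges of `F` are colored,
and no edge that `χ` colors has become uncolored.  (Colors of colored edges may change.) -/
def PartialEdgeColoring.ExtendsTo {V : Type*} {G : SimpleGraph V} {k : ℕ}
    (χ χ' : PartialEdgeColoring G k) (F : Finset (Sym2 V)) : Prop :=
  (∀ e ∈ F, χ'.color e ≠ none) ∧ ∀ e, χ.color e ≠ none → χ'.color e ≠ none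

/-- The data `(u, v, w, α, β)` of a u-fan: its center `u`, its leaves `v` and `w`, the color `α`
assigned to the center and the color `β` assigned to the leaves. -/
structure UFan (V : Type*) (k : ℕ) where
  u : V
  v : V
  w : V
  α : Fin k
  β : Fin k
  deriving DecidableEq

/-- The tuple `f` is a u-fan with respect to the partial coloring `χ` of `G`. -/
structure UFan.IsUFan {V : Type*} {G : SimpleGraph V} {k : ℕ}
    (f : UFan V k) (χ : PartialEdgeColoring G k) : Prop where
  u_ne_v : f.u ≠ f.v
  u_ne_w : f.u ≠ f.w
  v_ne_w : f.v ≠ f.w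
  colors_ne : f.α ≠ f.β
  edge_uv : s(f.u, f.v) ∈ G.edgeSet
  edge_uw : s(f.u, f.w) ∈ G.edgeSet
  uncolored_uv : χ.color s(f.u, f.v) = none
  uncolored_uw : χ.color s(f.u, f.w) = none
  miss_u : f.α ∈ χ.miss f.u
  miss_v : f.β ∈ χ.miss f.v
  miss_w : f.β ∈ χ.miss f.w

/-- The two edges of a u-fan. -/
def UFan.edges {V : Type*} [DecidableEq V] {k : ℕ} (f : UFan V k) : Finset (Sym2 V) :=
  {s(f.u, f.v), s(f.u, f.w)}

/-- The three vertices of a u-fan. -/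
def UFan.verts {V : Type*} [DecidableEq V] {k : ℕ} (f : UFan V k) : Finset V :=
  {f.u, f.v, f.w}

/-- The color that the u-fan `f` assigns to its vertex `x`. -/
def UFan.assigned {V : Type*} [DecidableEq V] {k : ℕ} (f : UFan V k) (x : V) : Fin k :=
  if x = f.u then f.α else f.β

/-- `U` is a separable collection of u-fans with respect to `χ`: its members are u-fans, they are
pairwise edge-disjoint, and the colors assigned to a vertex by different members are distinct. -/
structure IsSeparableCollection {V : Type*} [DecidableEq V] {G : SimpleGraph V} {k : ℕ}
    (χ : PartialEdgeColoring G k) (U : Finset (UFan V k)) : Prop where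
  isUFan : ∀ f ∈ U, f.IsUFan χ
  edge_disjoint : ∀ f ∈ U, ∀ g ∈ U, f ≠ g → Disjoint f.edges g.edges
  colors_distinct : ∀ x, ∀ f ∈ U, ∀ g ∈ U, f ≠ g → x ∈ f.verts → x ∈ g.verts →
    f.assigned x ≠ g.assigned x

/-! ### A randomized word RAM

The machine has registers and arrays (of both, a program uses only finitely many); the cells of an
array are addressed by words and can be accessed in one step.  Words have `w` bits, and all
arithmetic is carried out modulo `2 ^ w` (subtraction is truncated at `0`, and division by `0`
gives `0`). -/

/-- Expressions of the programming language. -/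
inductive RAM.Expr where
  | const (k : ℕ)
  | reg (x : ℕ)
  | read (a : ℕ) (i : RAM.Expr)
  | add (e f : RAM.Expr)
  | sub (e f : RAM.Expr)
  | mul (e f : RAM.Expr)
  | div (e f : RAM.Expr)
  | lt (e f : RAM.Expr)
  | eq (e f : RAM.Expr)

/-- Programs. -/
inductive RAM.Prog where
  | skip
  /-- assign to register `x` the value of `e` -/
  | assign (x : ℕ) (e : RAM.Expr)
  /-- store the value of `e` in cell `i` of array `a` -/
  | write (a : ℕ) (i e : RAM.Expr)
  /-- assign to register `x` a uniformly random number that is smaller than the value of `e` -/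
  | rand (x : ℕ) (e : RAM.Expr)
  | seq (p q : RAM.Prog)
  /-- a test succeeds if its value is not `0` -/
  | ite (e : RAM.Expr) (p q : RAM.Prog)
  | loop (e : RAM.Expr) (p : RAM.Prog)

/-- A memory state: the contents of the registers and the contents of the arrays. -/
structure RAM.State where
  reg : ℕ → ℕ
  mem : ℕ → ℕ → ℕ

/-- The value of an expression, with words of `w` bits. -/
def RAM.Expr.eval (w : ℕ) (s : RAM.State) : RAM.Expr → ℕ
  | .const k => k % 2 ^ w
  | .reg x => s.reg x
  | .read a i => s.mem a (i.eval w s)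
  | .add e f => (e.eval w s + f.eval w s) % 2 ^ w
  | .sub e f => e.eval w s - f.eval w s
  | .mul e f => (e.eval w s * f.eval w s) % 2 ^ w
  | .div e f => e.eval w s / f.eval w s
  | .lt e f => if e.eval w s < f.eval w s then 1 % 2 ^ w else 0
  | .eq e f => if e.eval w s = f.eval w s then 1 % 2 ^ w else 0

def RAM.State.setReg (s : RAM.State) (x v : ℕ) : RAM.State :=
  { s with reg := Function.update s.reg x v }

def RAM.State.setMem (s : RAM.State) (a i v : ℕ) : RAM.State :=
  { s with mem := Function.update s.mem a (Function.update (s.mem a) i v) }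

/-- The uniform distribution on `{0, …, N - 1}` (on `{0}` if `N = 0`). -/
noncomputable def RAM.uniformBelow (N : ℕ) : PMF ℕ :=
  PMF.uniformOfFinset (Finset.range (max 1 N)) ⟨0, by simp⟩

/-- A configuration: the list of the programs that are still to be executed, one after the other,
and the memory state.  The machine has halted when the list is empty. -/
abbrev RAM.Config : Type := List RAM.Prog × RAM.State

/-- One step of the machine.  A program text is fixed once and for all, so that a step evaluates
expressions of bounded size, that is, it performs `O(1)` operations on words. -/
noncomputable def RAM.step (w : ℕ) : RAM.Config → PMF RAM.Config
  | ([], s) => PMF.pure ([], s)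
  | (.skip :: k, s) => PMF.pure (k, s)
  | (.assign x e :: k, s) => PMF.pure (k, s.setReg x (e.eval w s))
  | (.write a i e :: k, s) => PMF.pure (k, s.setMem a (i.eval w s) (e.eval w s))
  | (.rand x e :: k, s) =>
      (RAM.uniformBelow (e.eval w s)).map fun r => (k, s.setReg x r)
  | (.seq p q :: k, s) => PMF.pure (p :: q :: k, s)
  | (.ite e p q :: k, s) => PMF.pure (if e.eval w s ≠ 0 then p :: k else q :: k, s)
  | (.loop e p :: k, s) => PMF.pure (if e.eval w s ≠ 0 then p :: .loop e p :: k else k, s)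

/-- The distribution of the configuration after `t` steps of the program `p`, started in the
memory state `s`, on the machine with words of `w` bits. -/
noncomputable def RAM.run (w : ℕ) (p : RAM.Prog) (s : RAM.State) : ℕ → PMF RAM.Config
  | 0 => PMF.pure ([p], s)
  | t + 1 => (RAM.run w p s t).bind (RAM.step w)

/-- The probability that the program `p`, started in `s`, has halted after at most `t` steps. -/
noncomputable def RAM.haltProb (w : ℕ) (p : RAM.Prog) (s : RAM.State) (t : ℕ) : ℝ :=
  ((RAM.run w p s t).toOuterMeasure {c | c.1 = []}).toReal

/-! ### Representation of the input and of the output -/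

/-- The list `es` enumerates the edges of `G`, each once and in one of its two orientations. -/
def IsEdgeList {n : ℕ} (G : SimpleGraph (Fin n)) (es : List (Fin n × Fin n)) : Prop :=
  (es.map fun p => s(p.1, p.2)).Nodup ∧ ∀ e, e ∈ es.map (fun p => s(p.1, p.2)) ↔ e ∈ G.edgeSet

/-- The list `fs` enumerates the collection `U`, each member once. -/
def IsFanList {n k : ℕ} (U : Finset (UFan (Fin n) k)) (fs : List (UFan (Fin n) k)) : Prop :=
  fs.Nodup ∧ ∀ f, f ∈ fs ↔ f ∈ U

/-- Colors are represented by `1, …, k`, and `⊥` is represented by `0`. -/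
def colorCode {k : ℕ} : Option (Fin k) → ℕ
  | none => 0
  | some c => c.val + 1

/-- The memory state that represents the input.  Registers `0, …, 3` hold the numbers of vertices
and of edges, the maximum degree `Δ` and the number of u-fans.  Arrays `0`, `1`, `2` hold the
endpoints and the color of each edge, in the order of `es`; arrays `3, …, 7` hold the center, the
two leaves and the two colors of each u-fan, in the order of `fs`.  Everything else is `0`. -/
def inputState {n k : ℕ} {G : SimpleGraph (Fin n)} (Δ : ℕ) (χ : PartialEdgeColoring G k)
    (es : List (Fin n × Fin n)) (fs : List (UFan (Fin n) k)) : RAM.State where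
  reg x := [n, es.length, Δ, fs.length].getD x 0
  mem a i := ([es.map fun p => p.1.val,
    es.map fun p => p.2.val,
    es.map fun p => colorCode (χ.color s(p.1, p.2)),
    fs.map fun f => f.u.val,
    fs.map fun f => f.v.val,
    fs.map fun f => f.w.val,
    fs.map fun f => f.α.val + 1,
    fs.map fun f => f.β.val + 1].getD a []).getD i 0

/-- In the memory state `s`, array `2` holds the coloring `χ`: its `i`-th cell is the color of the
`i`-th edge in `es`. -/
def Represents {n k : ℕ} {G : SimpleGraph (Fin n)} (s : RAM.State) (es : List (Fin n × Fin n))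
    (χ : PartialEdgeColoring G k) : Prop :=
  ∀ i : Fin es.length, s.mem 2 i = colorCode (χ.color s((es.get i).1, (es.get i).2))

/-! Write `k = Δ + 1`, and let `λ` be the number of u-fans. A round fixes a random color `α` and its
cyclic successor `β`. In its first part, u-fans drawn at random from `U` are converted: three
alternating paths are flipped so that the center misses `α` and both leaves miss `β`. In its second
part, edges of converted u-fans are colored, one after the other: the `α`/`β`-path from the center
is flipped, after which the center misses `β`, and since this path ends in at most one of the two
leaves, the edge to the other leaf can get the color `β` (`exists_completed`).

Conversions are cheap on average. Paths with the same two colors that reach a vertex at positions of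
equal parity have the same start (`IsWalk.meet`). Hence the paths that exchange a missing color for
`γ`, summed over all pairs of a vertex and a color that it misses, have total length at most `k *
colorDeg γ + ∑ c, colorDeg c` (`sum_pathLen_le`). By separability, different u-fans own different
pairs. For random `γ` the sum is `O(m)`, so a random u-fan costs `O(m / λ)` in expectation.
Conversions also do little harm. A flip changes the missing colors of the two ends of the path only,
hence damages at most four members of `U` (`deadCount_flip_le`), and few members have a path that
ends in one of the vertices already converted in the round (`card_hits_le`). In the second part, all
vertices on the `α`/`β`-paths that were used form a closed set `M`, and u-fans that touch `M` are
skipped. So the paths of a round visit a vertex `O(1)` times, and since only path ends miss `α` or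
`β`, each colored edge makes at most four further u-fans useless (`card_touches_le`). A quarter of
the ready u-fans yields an edge.

An attempt consists of `R` rounds of `S` draws, with `R * S` about `λ / 1500`; it stops working when
the total length of the flipped paths exceeds `B = 15000 m`, so that it always takes `O(m)` steps.
Its success is measured by `potential`, which rewards colored edges and charges for path lengths.
The potential does not decrease in expectation (`Setup.drift`), starts at `1 / 64`, never exceeds
`1` at the end, and is at most `0` at the end of an attempt that has colored fewer than `λ / 48000`
edges. Hence an attempt succeeds with probability at least `1 / 64`. Unsuccessful attempts are
undone and repeated; after `64 c log n` of them the failure probability is at most `n ^ (-c)`.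

The halting probability and the correctness of the output are carried together through the execution
by `Ensures`. Probabilistic steps use backward induction: `gain q x` is the success probability that
potential `x` guarantees if `q` is available from a fresh start. -/

section

/-! ### Execution semantics: halting probability, safety, deterministic runs. -/

namespace RAM

/-! ### Running the machine from an arbitrary configuration -/

/-- The distribution of the configuration after `t` steps, started in the configuration `c`. -/
noncomputable def runFrom (w : ℕ) : ℕ → Config → PMF Config
  | 0, c => PMF.pure c
  | t + 1, c => (step w c).bind (runFrom w t)

theorem runFrom_succ' (w t : ℕ) (c : Config) :
    runFrom w (t + 1) c = (runFrom w t c).bind (step w) := by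
  induction t generalizing c with
  | zero => simp [runFrom]
  | succ t ih =>
    calc runFrom w (t + 2) c = (step w c).bind fun c' => (runFrom w t c').bind (step w) := by
          rw [runFrom, ← funext ih]
      _ = (runFrom w (t + 1) c).bind (step w) := (PMF.bind_bind _ _ _).symm

theorem run_eq_runFrom (w : ℕ) (p : Prog) (s : State) (t : ℕ) :
    run w p s t = runFrom w t ([p], s) := by
  induction t with
  | zero => rfl
  | succ t ih => rw [run, ih, runFrom_succ']

/-- The probability of having halted after `t` steps. -/
noncomputable def haltFrom (w t : ℕ) (c : Config) : ENNReal :=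
  (runFrom w t c).toOuterMeasure {c | c.1 = []}

theorem haltFrom_succ (w t : ℕ) (c : Config) :
    haltFrom w (t + 1) c = ∑' c', step w c c' * haltFrom w t c' := by
  rw [haltFrom, runFrom, PMF.toOuterMeasure_bind_apply]; rfl

theorem haltFrom_nil (w t : ℕ) (s : State) : haltFrom w t ([], s) = 1 := by
  have : runFrom w t ([], s) = PMF.pure ([], s) := by
    induction t with
    | zero => rfl
    | succ t ih => rw [runFrom, step, PMF.pure_bind, ih]
  rw [haltFrom, this, PMF.toOuterMeasure_pure_apply]; simp

theorem haltFrom_le_succ (w t : ℕ) (c : Config) : haltFrom w t c ≤ haltFrom w (t + 1) c := by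
  induction t generalizing c with
  | zero =>
    obtain ⟨l, s⟩ := c
    cases l with
    | nil => simp [haltFrom_nil]
    | cons p k => simp [haltFrom, runFrom, PMF.toOuterMeasure_pure_apply]
  | succ t ih =>
    rw [haltFrom_succ, haltFrom_succ w (t + 1)]
    exact ENNReal.tsum_le_tsum fun c' => mul_le_mul_right (ih c') _

theorem haltFrom_mono (w : ℕ) (c : Config) : Monotone fun t => haltFrom w t c :=
  monotone_nat_of_le_succ fun t => haltFrom_le_succ w t c

theorem haltFrom_of_step {w : ℕ} {c c' : Config} (h : step w c = PMF.pure c') (t : ℕ) :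
    haltFrom w (t + 1) c = haltFrom w t c' := by
  rw [haltFrom, runFrom, h, PMF.pure_bind]; rfl

theorem uniformBelow_apply {N : ℕ} (h : 0 < N) (r : ℕ) :
    uniformBelow N r = if r < N then (N : ENNReal)⁻¹ else 0 := by
  have h0 : (Finset.range (max 1 N)).Nonempty := ⟨0, by simp⟩
  refine (PMF.uniformOfFinset_apply h0 r).trans ?_
  rw [max_eq_right h]; simp

theorem haltFrom_rand (w t x : ℕ) (e : Expr) (k : List Prog) (s : State) (h : 0 < e.eval w s) :
    haltFrom w (t + 1) (.rand x e :: k, s) =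
      ∑ r ∈ Finset.range (e.eval w s), (e.eval w s : ENNReal)⁻¹ *
        haltFrom w t (k, s.setReg x r) := by
  rw [haltFrom, runFrom, step, PMF.bind_map, PMF.toOuterMeasure_bind_apply]
  rw [tsum_eq_sum (s := Finset.range (e.eval w s))]
  · refine Finset.sum_congr rfl fun r hr => ?_
    rw [uniformBelow_apply h, if_pos (Finset.mem_range.1 hr)]; rfl
  · intro r hr
    rw [uniformBelow_apply h, if_neg (by simpa using hr), zero_mul]

/-- Every halting configuration that is reached after `n` steps satisfies `Good`. -/
def Safe (w : ℕ) (Good : State → Prop) (n : ℕ) (c : Config) : Prop :=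
  ∀ s, ([], s) ∈ (runFrom w n c).support → Good s

theorem Safe.of_succ {w n : ℕ} {Good : State → Prop} {c : Config} (h : Safe w Good (n + 1) c) :
    Safe w Good n c := by
  intro s hs
  refine h s ?_
  rw [runFrom_succ', PMF.mem_support_bind_iff]
  exact ⟨_, hs, by simp [step]⟩

/-- From `c`, the machine halts within `t` steps with probability at least `x`, and all halting
configurations after at most `n` steps satisfy `Good`. -/
structure Ensures (w : ℕ) (Good : State → Prop) (t n : ℕ) (c : Config) (x : ℝ) : Prop where
  halts : ENNReal.ofReal x ≤ haltFrom w t c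
  safe : Safe w Good n c

namespace Ensures

variable {w t n : ℕ} {Good : State → Prop} {c c' : Config} {x : ℝ}

theorem mono {t' : ℕ} {x' : ℝ} (h : Ensures w Good t n c x) (ht : t ≤ t') (hx : x' ≤ x) :
    Ensures w Good t' n c x' :=
  ⟨(ENNReal.ofReal_le_ofReal hx).trans (h.halts.trans (haltFrom_mono w c ht)), h.safe⟩

theorem nil {s : State} (hs : Good s) : Ensures w Good t n ([], s) 1 := by
  refine ⟨by simp [haltFrom_nil], ?_⟩
  have : runFrom w n ([], s) = PMF.pure ([], s) := by
    induction n with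
    | zero => rfl
    | succ t ih => rw [runFrom, step, PMF.pure_bind, ih]
  intro s' hs'
  rw [this, PMF.mem_support_pure_iff] at hs'
  cases hs'; exact hs

/-- The safety index grows with the step. As the program need not halt, correctness of its output is
proved by induction on this index, for which a gain of one per pass of the main loop suffices. -/
theorem of_step_succ (hc : step w c = PMF.pure c') (h : Ensures w Good t n c' x) :
    Ensures w Good (t + 1) (n + 1) c x := by
  refine ⟨by rw [haltFrom_of_step hc]; exact h.halts, ?_⟩
  intro s hs
  rw [runFrom, hc, PMF.pure_bind] at hs
  exact h.safe s hs

theorem of_succ (h : Ensures w Good t (n + 1) c x) : Ensures w Good t n c x :=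
  ⟨h.halts, h.safe.of_succ⟩

theorem of_step (hc : step w c = PMF.pure c') (h : Ensures w Good t n c' x) :
    Ensures w Good (t + 1) n c x := (of_step_succ hc h).of_succ

/-- The halting probability is the mean over the draws, so it is enough that the claimed bounds
average to at least `x`. Nonnegativity of the bounds is needed because `ENNReal.ofReal` truncates.
-/
theorem rand {r : ℕ} {e : Expr} {k : List Prog} {s : State} {N : ℕ} (hN : e.eval w s = N)
    (hpos : 0 < N) {X : ℕ → ℝ} (hX : ∀ i < N, 0 ≤ X i) (hx : N * x ≤ ∑ i ∈ Finset.range N, X i)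
    (h : ∀ i < N, Ensures w Good t n (k, s.setReg r i) (X i)) :
    Ensures w Good (t + 1) n (.rand r e :: k, s) x := by
  refine ⟨?_, ?_⟩
  · rw [haltFrom_rand _ _ _ _ _ _ (by omega), hN, ← Finset.mul_sum]
    have h1 : ENNReal.ofReal (N * x) ≤
        ∑ i ∈ Finset.range N, haltFrom w t (k, s.setReg r i) := by
      refine (ENNReal.ofReal_le_ofReal hx).trans ?_
      rw [ENNReal.ofReal_sum_of_nonneg fun i hi => hX i (Finset.mem_range.1 hi)]
      exact Finset.sum_le_sum fun i hi => (h i (Finset.mem_range.1 hi)).halts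
    rw [ENNReal.ofReal_mul (by positivity), ENNReal.ofReal_natCast] at h1
    calc ENNReal.ofReal x = (N : ENNReal)⁻¹ * (N * ENNReal.ofReal x) := by
          rw [← mul_assoc, ENNReal.inv_mul_cancel (by simpa using hpos.ne') (by simp), one_mul]
      _ ≤ _ := mul_le_mul_right h1 _
  · refine Safe.of_succ ?_
    intro s' hs'
    rw [runFrom, step, PMF.bind_map, PMF.mem_support_bind_iff] at hs'
    obtain ⟨i, hi, hi'⟩ := hs'
    rw [PMF.mem_support_iff, hN, uniformBelow_apply hpos] at hi
    exact (h i (by by_contra hc; simp [hc] at hi)).safe s' hi'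

end Ensures

/-! ### Deterministic executions -/

/-- The program `p` contains no random choices on its way from `s` to `s'`, and takes `τ` steps. -/
inductive Exec (w : ℕ) : Prog → State → State → ℕ → Prop
  | skip (s) : Exec w .skip s s 1
  | assign (x e s) : Exec w (.assign x e) s (s.setReg x (e.eval w s)) 1
  | write (a i e s) : Exec w (.write a i e) s (s.setMem a (i.eval w s) (e.eval w s)) 1
  | seq {p q s s' s'' τ τ'} : Exec w p s s' τ → Exec w q s' s'' τ' →
      Exec w (.seq p q) s s'' (τ + τ' + 1)
  | ite_true {e p q s s' τ} : e.eval w s ≠ 0 → Exec w p s s' τ → Exec w (.ite e p q) s s' (τ + 1)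
  | ite_false {e p q s s' τ} : e.eval w s = 0 → Exec w q s s' τ → Exec w (.ite e p q) s s' (τ + 1)
  | loop_true {e p s s' s'' τ τ'} : e.eval w s ≠ 0 → Exec w p s s' τ →
      Exec w (.loop e p) s' s'' τ' → Exec w (.loop e p) s s'' (τ + τ' + 1)
  | loop_false {e p s} : e.eval w s = 0 → Exec w (.loop e p) s s 1

/-- Stated for an arbitrary continuation `k`, so that deterministic fragments can be prefixed to
probabilistic ones. -/
theorem Exec.ensures {w : ℕ} {p : Prog} {s s' : State} {τ : ℕ} (h : Exec w p s s' τ)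
    {Good : State → Prop} {t n : ℕ} {k : List Prog} {x : ℝ}
    (hk : Ensures w Good t n (k, s') x) : Ensures w Good (t + τ) n (p :: k, s) x := by
  induction h generalizing t k with
  | skip s => exact .of_step rfl hk
  | assign => exact .of_step rfl hk
  | write => exact .of_step rfl hk
  | seq _ _ ih ih' =>
    have := Ensures.of_step (c := (.seq _ _ :: k, _)) rfl (ih (ih' hk))
    exact this.mono (by omega) le_rfl
  | ite_true he _ ih => exact .of_step (by simp [step, he]) (ih hk)
  | ite_false he _ ih => exact .of_step (by simp [step, he]) (ih hk)
  | loop_true he _ _ ih ih' =>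
    exact (Ensures.of_step (by simp only [step, if_pos he]) (ih (ih' hk))).mono (by omega) le_rfl
  | loop_false he => exact .of_step (by simp [step, he]) hk

/-- `ExecLe w p s s' T`: the program `p` leads from `s` to `s'` within at most `T` steps. -/
def ExecLe (w : ℕ) (p : Prog) (s s' : State) (T : ℕ) : Prop := ∃ τ ≤ T, Exec w p s s' τ

namespace ExecLe

variable {w : ℕ} {p q : Prog} {s s' s'' : State} {T T' : ℕ} {e : Expr}

theorem mono (h : ExecLe w p s s' T) (hT : T ≤ T') : ExecLe w p s s' T' :=
  let ⟨τ, h1, h2⟩ := h; ⟨τ, h1.trans hT, h2⟩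

theorem seq (h : ExecLe w p s s' T) (h' : ExecLe w q s' s'' T') :
    ExecLe w (.seq p q) s s'' (T + T' + 1) :=
  let ⟨_, h1, h2⟩ := h; let ⟨_, h3, h4⟩ := h'; ⟨_, by omega, h2.seq h4⟩

theorem ite_true (he : e.eval w s ≠ 0) (h : ExecLe w p s s' T) :
    ExecLe w (.ite e p q) s s' (T + 1) :=
  let ⟨_, h1, h2⟩ := h; ⟨_, by omega, .ite_true he h2⟩

theorem ite_false (he : e.eval w s = 0) (h : ExecLe w q s s' T) :
    ExecLe w (.ite e p q) s s' (T + 1) :=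
  let ⟨_, h1, h2⟩ := h; ⟨_, by omega, .ite_false he h2⟩

theorem loop_true (he : e.eval w s ≠ 0) (h : ExecLe w p s s' T)
    (h' : ExecLe w (.loop e p) s' s'' T') : ExecLe w (.loop e p) s s'' (T + T' + 1) :=
  let ⟨_, h1, h2⟩ := h; let ⟨_, h3, h4⟩ := h'; ⟨_, by omega, .loop_true he h2 h4⟩

theorem loop_false (he : e.eval w s = 0) : ExecLe w (.loop e p) s s 1 := ⟨1, le_rfl, .loop_false he⟩

theorem ensures (h : ExecLe w p s s' T) {Good : State → Prop} {t n : ℕ} {k : List Prog} {x : ℝ}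
    (hk : Ensures w Good t n (k, s') x) : Ensures w Good (t + T) n (p :: k, s) x :=
  let ⟨_, h1, h2⟩ := h; (h2.ensures hk).mono (by omega) le_rfl

/-- A loop that runs for exactly `N` rounds, with the state before round `i` satisfying `I i`. -/
theorem loop_count (N : ℕ) (I : ℕ → State → Prop)
    (hI : ∀ i < N, ∀ s, I i s → e.eval w s ≠ 0 ∧ ∃ s', I (i + 1) s' ∧ ExecLe w p s s' T)
    (hN : ∀ s, I N s → e.eval w s = 0) (h0 : I 0 s) :
    ∃ s', I N s' ∧ ExecLe w (.loop e p) s s' (N * (T + 1) + 1) := by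
  have : ∀ d i s, i + d = N → I i s →
      ∃ s', I N s' ∧ ExecLe w (.loop e p) s s' (d * (T + 1) + 1) := by
    intro d
    induction d with
    | zero =>
      intro i s hi h
      have hi : i = N := by omega
      subst hi
      exact ⟨s, h, (loop_false (hN s h)).mono (by omega)⟩
    | succ d ih =>
      intro i s hi h
      obtain ⟨h1, s', h2, h3⟩ := hI i (by omega) s h
      obtain ⟨s'', h4, h5⟩ := ih (i + 1) s' (by omega) h2
      exact ⟨s'', h4, (loop_true h1 h3 h5).mono (by ring_nf; omega)⟩
  exact this N 0 s (by omega) h0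

end ExecLe

/-! ### Straight-line programs -/

/-- Programs without loops, tests and random choices. -/
def Prog.Straight : Prog → Prop
  | .skip | .assign _ _ | .write _ _ _ => True
  | .seq p q => p.Straight ∧ q.Straight
  | _ => False

/-- The effect of a straight-line program. -/
def Prog.sem (w : ℕ) : Prog → State → State
  | .assign x e, s => s.setReg x (e.eval w s)
  | .write a i e, s => s.setMem a (i.eval w s) (e.eval w s)
  | .seq p q, s => q.sem w (p.sem w s)
  | _, s => s

/-- The running time of a straight-line program. -/
def Prog.len : Prog → ℕ
  | .seq p q => p.len + q.len + 1
  | _ => 1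

theorem ExecLe.straight (w : ℕ) {p : Prog} (hp : p.Straight) (s : State) :
    ExecLe w p s (p.sem w s) p.len := by
  induction p generalizing s with
  | skip => exact ⟨1, le_rfl, .skip s⟩
  | assign x e => exact ⟨1, le_rfl, .assign x e s⟩
  | write a i e => exact ⟨1, le_rfl, .write a i e s⟩
  | seq p q ihp ihq => exact (ihp hp.1 s).seq (ihq hp.2 _)
  | rand => exact hp.elim
  | ite => exact hp.elim
  | loop => exact hp.elim

/-- The sequential composition of a list of programs. -/
def Prog.block : List Prog → Prog
  | [] => .skip
  | [p] => p
  | p :: q :: l => .seq p (Prog.block (q :: l))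

/-- Execute `p` if all the tests in the list succeed. -/
def Prog.guards : List Expr → Prog → Prog
  | [], p => p
  | e :: l, p => .ite e (Prog.guards l p) .skip

theorem ExecLe.guards_true {w : ℕ} {l : List Expr} {p : Prog} {s s' : State} {T : ℕ}
    (hl : ∀ e ∈ l, e.eval w s ≠ 0) (h : ExecLe w p s s' T) :
    ExecLe w (Prog.guards l p) s s' (T + l.length) := by
  induction l with
  | nil => exact h
  | cons e l ih =>
    rw [List.forall_mem_cons] at hl
    exact ExecLe.ite_true hl.1 (ih hl.2)

theorem ExecLe.guards_false {w : ℕ} {l : List Expr} {p : Prog} {s : State}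
    (hl : ∃ e ∈ l, e.eval w s = 0) :
    ExecLe w (Prog.guards l p) s s (l.length + 1) := by
  induction l with
  | nil => simp at hl
  | cons e l ih =>
    by_cases he : e.eval w s = 0
    · exact (ExecLe.ite_false he ⟨1, le_rfl, .skip s⟩).mono (by simp)
    · refine ExecLe.ite_true he (ih ?_)
      obtain ⟨e', h1, h2⟩ := hl
      rcases List.mem_cons.1 h1 with rfl | h1
      · exact absurd h2 he
      · exact ⟨e', h1, h2⟩

/-! ### Simplification lemmas for memory states -/

theorem State.reg_setReg (s : State) (x v y : ℕ) :
    (s.setReg x v).reg y = if y = x then v else s.reg y := by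
  simp [State.setReg, Function.update_apply]

theorem State.mem_setReg (s : State) (x v : ℕ) : (s.setReg x v).mem = s.mem := rfl

theorem State.reg_setMem (s : State) (a i v : ℕ) : (s.setMem a i v).reg = s.reg := rfl

theorem State.mem_setMem (s : State) (a i v b : ℕ) :
    (s.setMem a i v).mem b = if b = a then Function.update (s.mem a) i v else s.mem b := by
  simp [State.setMem, Function.update_apply]

end RAM

end

/-! ### Alternating paths, exchange of two colors, coloring one edge. -/

section

namespace PartialEdgeColoring

/-! ### Alternating paths -/

variable {V : Type*} {G : SimpleGraph V} {k : ℕ} (χ : PartialEdgeColoring G k)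

theorem ne_of_color {χ : PartialEdgeColoring G k} {x y : V} {c : Fin k}
    (h : χ.color s(x, y) = some c) : x ≠ y := by
  rintro rfl
  exact G.loopless.irrefl x (χ.mem_edgeSet_of_color _ _ h)

theorem color_right_unique {χ : PartialEdgeColoring G k} {x y z : V} {c : Fin k}
    (h : χ.color s(x, y) = some c) (h' : χ.color s(x, z) = some c) : y = z := by
  have := χ.proper _ _ c x (Sym2.mem_mk_left _ _) (Sym2.mem_mk_left _ _) h h'
  rcases Sym2.eq_iff.1 this with h1 | h1
  · exact h1.2
  · exact h1.2.trans h1.1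

theorem not_mem_miss {χ : PartialEdgeColoring G k} {x : V} {c : Fin k} :
    c ∉ χ.miss x ↔ ∃ y, χ.color s(x, y) = some c := by
  constructor
  · intro h
    simp only [miss, Set.mem_ofPred_eq, not_forall, not_not] at h
    obtain ⟨e, he, hc⟩ := h
    obtain ⟨y, rfl⟩ := Sym2.mem_iff_exists.1 he
    exact ⟨y, hc⟩
  · rintro ⟨y, hy⟩ h
    exact h _ (Sym2.mem_mk_left _ _) hy

theorem not_mem_miss_left {χ : PartialEdgeColoring G k} {x y : V} {c : Fin k}
    (h : χ.color s(x, y) = some c) : c ∉ χ.miss x := not_mem_miss.2 ⟨y, h⟩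

theorem not_mem_miss_right {χ : PartialEdgeColoring G k} {x y : V} {c : Fin k}
    (h : χ.color s(x, y) = some c) : c ∉ χ.miss y := not_mem_miss.2 ⟨x, by rwa [Sym2.eq_swap]⟩

/-- The color of the `i`-th edge of an alternating path that starts with the color `b`. -/
def altColor (a b : Fin k) (i : ℕ) : Fin k := if i % 2 = 0 then b else a

theorem altColor_congr (a b : Fin k) {i j : ℕ} (h : i % 2 = j % 2) :
    altColor a b i = altColor a b j := by simp [altColor, h]

theorem altColor_mem (a b : Fin k) (i : ℕ) : altColor a b i = a ∨ altColor a b i = b := by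
  unfold altColor; split <;> simp

theorem swap_altColor (a b : Fin k) (i : ℕ) :
    Equiv.swap a b (altColor a b i) = altColor a b (i + 1) := by
  unfold altColor
  rcases Nat.mod_two_eq_zero_or_one i with h | h
  · rw [if_pos h, if_neg (by omega), Equiv.swap_apply_right]
  · rw [if_neg (by omega), if_pos (by omega), Equiv.swap_apply_left]

theorem altColor_swap (a b : Fin k) (i : ℕ) : altColor b a i = altColor a b (i + 1) := by
  unfold altColor
  rcases Nat.mod_two_eq_zero_or_one i with h | h
  · rw [if_pos h, if_neg (by omega)]
  · rw [if_neg (by omega), if_pos (by omega)]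

/-- A walk from `x` along edges that have alternately the colors `b` and `a`. -/
structure IsWalk (a b : Fin k) (x : V) (p : ℕ → V) (ℓ : ℕ) : Prop where
  zero : p 0 = x
  joins : ∀ i < ℓ, χ.color s(p i, p (i + 1)) = some (altColor a b i)
  -- Demanded for nonempty walks only. A vertex that already misses `b` has a path of length 0
  -- whether or not it misses `a`; this occurs when the path from one leaf of a u-fan has already
  -- changed the other leaf.
  start : 0 < ℓ → a ∈ χ.miss x

/-- A maximal alternating path from `x`. -/
structure IsPath (a b : Fin k) (x : V) (p : ℕ → V) (ℓ : ℕ) : Prop extends IsWalk χ a b x p ℓ where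
  terminal : altColor a b ℓ ∈ χ.miss (p ℓ)

variable {χ} {a b : Fin k} {x x' : V} {p p' : ℕ → V} {ℓ ℓ' : ℕ}

/-- Two walks that meet in the same direction have the same start. -/
theorem IsWalk.meet (h : χ.IsWalk a b x p ℓ) (h' : χ.IsWalk a b x' p' ℓ') (hx : a ∈ χ.miss x)
    (hx' : a ∈ χ.miss x') {i j : ℕ} (hi : i ≤ ℓ) (hj : j ≤ ℓ') (hij : i % 2 = j % 2)
    (hp : p i = p' j) : x = x' ∧ i = j := by
  induction i generalizing j with
  | zero =>
    cases j with
    | zero => exact ⟨by rw [← h.zero, hp, h'.zero], rfl⟩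
    | succ j =>
      -- Here `j + 1` is even, so the edge that enters `p' (j + 1) = x` has the color `a`, which `x`
      -- misses.
      have h1 := not_mem_miss_right (h'.joins j (by omega))
      rw [← hp, h.zero] at h1
      exact absurd (by rw [altColor, if_neg (by omega)]; exact hx) h1
  | succ i ih =>
    cases j with
    | zero =>
      have h1 := not_mem_miss_right (h.joins i (by omega))
      rw [hp, h'.zero] at h1
      exact absurd (by rw [altColor, if_neg (by omega)]; exact hx') h1
    | succ j =>
      have h1 := h.joins i (by omega)
      have h2 := h'.joins j (by omega)
      rw [Sym2.eq_swap, hp, altColor_congr a b (show i % 2 = j % 2 by omega)] at h1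
      rw [Sym2.eq_swap] at h2
      obtain ⟨h3, h4⟩ := ih (by omega) (by omega) (by omega) (color_right_unique h1 h2)
      exact ⟨h3, by omega⟩

/-- For equal parity this is `IsWalk.meet` for the walk and itself. For opposite parity, the edge
that leaves the earlier position and the edge that enters the later one have the same color and a
common end, hence coincide; moving both positions inwards finally gives two consecutive positions at
the same vertex, that is, a loop. -/
theorem IsWalk.inj (h : χ.IsWalk a b x p ℓ) {i j : ℕ} (hi : i ≤ ℓ) (hj : j ≤ ℓ)
    (hp : p i = p j) : i = j := by
  rcases Nat.eq_zero_or_pos ℓ with h0 | h0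
  · omega
  have hx := h.start h0
  by_cases hij : i % 2 = j % 2
  · exact (h.meet h hx hx hi hj hij hp).2
  · exfalso
    wlog hlt : i < j generalizing i j
    · exact this hj hi hp.symm (by omega) (by omega)
    obtain ⟨d, hd⟩ : ∃ d, j = i + 1 + 2 * d := ⟨(j - i - 1) / 2, by omega⟩
    induction d generalizing i j with
    | zero =>
      have := h.joins i (by omega)
      rw [show i + 1 = j by omega] at this
      exact ne_of_color this hp
    | succ d ih =>
      have h1 := h.joins i (by omega)
      have h2 := h.joins (j - 1) (by omega)
      rw [show j - 1 + 1 = j by omega, Sym2.eq_swap, ← hp,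
        altColor_congr a b (show (j - 1) % 2 = i % 2 by omega)] at h2
      exact ih (by omega) (by omega) (color_right_unique h1 h2) (by omega) (by omega) (by omega)

/-- A walk that never gets stuck would be an injection of `ℕ` into the vertices, by `IsWalk.inj`. -/
theorem exists_isPath [Finite V] (h : a ∈ χ.miss x ∨ b ∈ χ.miss x) :
    ∃ p ℓ, χ.IsPath a b x p ℓ := by
  classical
  by_cases hb : b ∈ χ.miss x
  · exact ⟨fun _ => x, 0, ⟨rfl, by simp, by simp⟩, hb⟩
  replace h := h.resolve_right hb
  let nxt (c : Fin k) (y : V) : V :=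
    if h : ∃ z, χ.color s(y, z) = some c then h.choose else y
  have hnxt : ∀ c y, c ∉ χ.miss y → χ.color s(y, nxt c y) = some c := by
    intro c y hc
    have := not_mem_miss.1 hc
    simp only [nxt, dif_pos this]
    exact this.choose_spec
  let p : ℕ → V := fun i => Nat.rec x (fun i y => nxt (altColor a b i) y) i
  have hp : ∀ i, p (i + 1) = nxt (altColor a b i) (p i) := fun i => rfl
  have hex : ∃ i, altColor a b i ∈ χ.miss (p i) := by
    by_contra hcon
    push Not at hcon
    have hw : ∀ ℓ, χ.IsWalk a b x p ℓ := fun ℓ =>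
      ⟨rfl, fun i _ => by rw [hp]; exact hnxt _ _ (hcon i), fun _ => h⟩
    have hinj : Function.Injective p := fun i j hij =>
      (hw (max i j)).inj (le_max_left _ _) (le_max_right _ _) hij
    exact not_injective_infinite_finite p hinj
  refine ⟨p, Nat.find hex, ⟨rfl, fun i hi => ?_, fun _ => h⟩, Nat.find_spec hex⟩
  rw [hp]
  exact hnxt _ _ (Nat.find_min hex hi)

/-- An alternately colored edge at a vertex of a walk, other than the edge that leaves the vertex,
is the previous edge of the walk. -/
theorem IsWalk.eq_prev (h : χ.IsWalk a b x p ℓ) {i : ℕ} (hi : i ≤ ℓ) (hx : a ∈ χ.miss x) {y : V}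
    (hy : χ.color s(p i, y) = some (altColor a b (i + 1))) : 0 < i ∧ y = p (i - 1) := by
  rcases Nat.eq_zero_or_pos i with rfl | h0
  · rw [h.zero] at hy
    exact absurd (by simpa [altColor] using hx) (not_mem_miss_left hy)
  · refine ⟨h0, ?_⟩
    have h1 := h.joins (i - 1) (by omega)
    rw [Sym2.eq_swap, show i - 1 + 1 = i by omega,
      altColor_congr a b (show (i - 1) % 2 = (i + 1) % 2 by omega)] at h1
    exact color_right_unique hy h1

/-- No edge with one of the two colors leaves `M`. -/
def Closed (χ : PartialEdgeColoring G k) (a b : Fin k) (M : Set V) : Prop :=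
  ∀ x y c, (c = a ∨ c = b) → χ.color s(x, y) = some c → x ∈ M → y ∈ M

theorem Closed.symm {M : Set V} (h : χ.Closed a b M) : χ.Closed b a M :=
  fun x y c hc => h x y c hc.symm

theorem Closed.union {M M' : Set V} (h : χ.Closed a b M) (h' : χ.Closed a b M') :
    χ.Closed a b (M ∪ M') := by
  rintro x y c hc hxy (hx | hx)
  · exact Or.inl (h x y c hc hxy hx)
  · exact Or.inr (h' x y c hc hxy hx)

/-- The first `N` vertices of a sequence. -/
def prefixSet (p : ℕ → V) (N : ℕ) : Set V := {z | ∃ i < N, p i = z}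

/-- An edge with one of the two colors at a vertex of the path is the next or the previous edge of
the path; at the last vertex the former, and at the start the latter, is excluded by a missing
color. -/
theorem IsPath.closed (h : χ.IsPath a b x p ℓ) (hx : a ∈ χ.miss x) :
    χ.Closed a b (prefixSet p (ℓ + 1)) := by
  rintro _ y c hc hy ⟨i, hi, rfl⟩
  have : c = altColor a b i ∨ c = altColor a b (i + 1) := by
    unfold altColor
    rcases Nat.mod_two_eq_zero_or_one i with h | h
    · rw [if_pos h, if_neg (by omega)]; exact hc.symm
    · rw [if_neg (by omega), if_pos (by omega)]; exact hc
  rcases this with rfl | rfl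
  · rcases Nat.lt_or_ge i ℓ with h1 | h1
    · exact ⟨i + 1, by omega, color_right_unique (h.joins i h1) hy⟩
    · have : i = ℓ := by omega
      subst this
      exact absurd h.terminal (not_mem_miss_left hy)
  · obtain ⟨h1, h2⟩ := h.toIsWalk.eq_prev (by omega) hx hy
    exact ⟨i - 1, by omega, h2.symm⟩

/-- Only the ends of a maximal alternating path can miss one of the two colors. -/
theorem IsPath.end_of_mem_miss (h : χ.IsPath a b x p ℓ) {i : ℕ} (hi : i ≤ ℓ)
    (hm : a ∈ χ.miss (p i) ∨ b ∈ χ.miss (p i)) : i = 0 ∨ i = ℓ := by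
  by_contra hcon
  push Not at hcon
  have h1 := not_mem_miss_left (h.joins i (by omega))
  have h2 := not_mem_miss_right (h.joins (i - 1) (by omega))
  rw [show i - 1 + 1 = i by omega] at h2
  unfold altColor at h1 h2
  rcases Nat.mod_two_eq_zero_or_one i with h | h
  · rw [if_pos h] at h1
    rw [if_neg (by omega)] at h2
    tauto
  · rw [if_neg (by omega)] at h1
    rw [if_pos (by omega)] at h2
    tauto

/-! ### Exchanging two colors -/

open Classical in
/-- The colors after exchanging `a` and `b` on the edges that meet `M`. -/
noncomputable def flipColor (χ : PartialEdgeColoring G k) (a b : Fin k) (M : Set V) (e : Sym2 V) :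
    Option (Fin k) :=
  if ∃ x ∈ M, x ∈ e then (χ.color e).map (Equiv.swap a b) else χ.color e

theorem flipColor_of_mem {M : Set V} {e : Sym2 V} {x : V} (hx : x ∈ M) (he : x ∈ e) :
    χ.flipColor a b M e = (χ.color e).map (Equiv.swap a b) := if_pos ⟨x, hx, he⟩

theorem flipColor_eq_none {M : Set V} {e : Sym2 V} :
    χ.flipColor a b M e = none ↔ χ.color e = none := by
  unfold flipColor; split <;> simp

/-- An edge between a closed set and its complement has neither of the two colors, so the exchange
does not affect it. -/
theorem flipColor_of_notMem {M : Set V} (hM : χ.Closed a b M) {e : Sym2 V} {x : V} (hx : x ∉ M)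
    (he : x ∈ e) : χ.flipColor a b M e = χ.color e := by
  unfold flipColor
  split
  · rename_i h
    obtain ⟨y, hy, hye⟩ := h
    have hxy : y ≠ x := by rintro rfl; exact hx hy
    have he' : e = s(y, x) := (Sym2.mem_and_mem_iff hxy).1 ⟨hye, he⟩
    cases hc : χ.color e with
    | none => rfl
    | some c =>
      rw [he'] at hc
      have h1 : c ≠ a := fun h => hx (hM y x c (Or.inl h) hc hy)
      have h2 : c ≠ b := fun h => hx (hM y x c (Or.inr h) hc hy)
      simp [Equiv.swap_apply_of_ne_of_ne h1 h2]
  · rfl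

/-- Exchange the colors `a` and `b` on the edges that meet `M`. -/
noncomputable def flip (χ : PartialEdgeColoring G k) (a b : Fin k) (M : Set V)
    (hM : χ.Closed a b M) : PartialEdgeColoring G k where
  color := χ.flipColor a b M
  mem_edgeSet_of_color e c h := by
    have : χ.color e ≠ none := by rw [ne_eq, ← flipColor_eq_none (M := M) (a := a) (b := b), h]; simp
    obtain ⟨c', hc'⟩ := Option.ne_none_iff_exists'.1 this
    exact χ.mem_edgeSet_of_color e c' hc'
  proper e f c x he hf h h' := by
    by_cases hx : x ∈ M
    · rw [flipColor_of_mem hx he, Option.map_eq_some_iff] at h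
      rw [flipColor_of_mem hx hf, Option.map_eq_some_iff] at h'
      obtain ⟨c1, h1, h2⟩ := h
      obtain ⟨c2, h3, h4⟩ := h'
      obtain rfl := (Equiv.swap a b).injective (h2.trans h4.symm)
      exact χ.proper e f c1 x he hf h1 h3
    · rw [flipColor_of_notMem hM hx he] at h
      rw [flipColor_of_notMem hM hx hf] at h'
      exact χ.proper e f c x he hf h h'

theorem mem_miss_flip {M : Set V} (hM : χ.Closed a b M) {z : V} (hz : z ∈ M) {c : Fin k} :
    c ∈ (χ.flip a b M hM).miss z ↔ Equiv.swap a b c ∈ χ.miss z := by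
  simp only [miss, Set.mem_ofPred_eq]
  refine forall_congr' fun e => forall_congr' fun he => ?_
  show χ.flipColor a b M e ≠ _ ↔ _
  rw [flipColor_of_mem hz he, not_iff_not, Option.map_eq_some_iff]
  constructor
  · rintro ⟨c', h, rfl⟩; simpa using h
  · intro h; exact ⟨_, h, by simp⟩

theorem miss_flip_of_notMem {M : Set V} (hM : χ.Closed a b M) {z : V} (hz : z ∉ M) :
    (χ.flip a b M hM).miss z = χ.miss z := by
  ext c
  simp only [miss, Set.mem_ofPred_eq]
  refine forall_congr' fun e => forall_congr' fun he => ?_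
  show χ.flipColor a b M e ≠ _ ↔ _
  rw [flipColor_of_notMem hM hz he]

theorem ext' {χ χ' : PartialEdgeColoring G k} (h : ∀ e, χ.color e = χ'.color e) : χ = χ' := by
  cases χ; cases χ'
  congr
  exact funext h

open Classical in
/-- The coloring after flipping a maximal alternating path, which makes `x` miss the color `b`. -/
noncomputable def IsPath.flip (h : χ.IsPath a b x p ℓ) : PartialEdgeColoring G k :=
  if h0 : 0 < ℓ then χ.flip a b (prefixSet p (ℓ + 1)) (h.closed (h.start h0)) else χ

namespace IsPath

variable (h : χ.IsPath a b x p ℓ)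

theorem color_flip (h0 : 0 < ℓ) (e : Sym2 V) :
    h.flip.color e = χ.flipColor a b (prefixSet p (ℓ + 1)) e := by
  rw [flip, dif_pos h0]; rfl

theorem flip_of_zero (h0 : ℓ = 0) : h.flip = χ := by rw [flip, dif_neg (by omega)]

theorem color_flip_eq_none {e : Sym2 V} : h.flip.color e = none ↔ χ.color e = none := by
  rcases Nat.eq_zero_or_pos ℓ with h0 | h0
  · rw [h.flip_of_zero h0]
  · rw [h.color_flip h0, flipColor_eq_none]

theorem color_flip_other {e : Sym2 V} {c : Fin k} (ha : c ≠ a) (hb : c ≠ b) :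
    h.flip.color e = some c ↔ χ.color e = some c := by
  rcases Nat.eq_zero_or_pos ℓ with h0 | h0
  · rw [h.flip_of_zero h0]
  · rw [h.color_flip h0, flipColor]
    split
    · rw [Option.map_eq_some_iff]
      constructor
      · rintro ⟨c', h1, h2⟩
        rw [Equiv.swap_apply_eq_iff, Equiv.swap_apply_of_ne_of_ne ha hb] at h2
        rwa [← h2]
      · intro h1
        exact ⟨c, h1, Equiv.swap_apply_of_ne_of_ne ha hb⟩
    · rfl

theorem mem_miss_flip_other {z : V} {c : Fin k} (ha : c ≠ a) (hb : c ≠ b) :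
    c ∈ h.flip.miss z ↔ c ∈ χ.miss z := by
  simp only [miss, Set.mem_ofPred_eq]
  exact forall_congr' fun e => forall_congr' fun he => not_congr (h.color_flip_other ha hb)

theorem color_flip_of_notMem {z : V} (hz : z ∉ prefixSet p (ℓ + 1)) {e : Sym2 V} (he : z ∈ e) :
    h.flip.color e = χ.color e := by
  rcases Nat.eq_zero_or_pos ℓ with h0 | h0
  · rw [h.flip_of_zero h0]
  · rw [h.color_flip h0, flipColor_of_notMem (h.closed (h.start h0)) hz he]

theorem miss_flip_of_notMem {z : V} (hz : z ∉ prefixSet p (ℓ + 1)) :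
    h.flip.miss z = χ.miss z := by
  rcases Nat.eq_zero_or_pos ℓ with h0 | h0
  · rw [h.flip_of_zero h0]
  · rw [flip, dif_pos h0, PartialEdgeColoring.miss_flip_of_notMem _ hz]

theorem mem_miss_flip (h0 : 0 < ℓ) {z : V} (hz : z ∈ prefixSet p (ℓ + 1)) {c : Fin k} :
    c ∈ h.flip.miss z ↔ Equiv.swap a b c ∈ χ.miss z := by
  rw [flip, dif_pos h0, PartialEdgeColoring.mem_miss_flip _ hz]

theorem start_mem (h : χ.IsPath a b x p ℓ) : x ∈ prefixSet p (ℓ + 1) := ⟨0, by omega, h.zero⟩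

theorem miss_start : b ∈ h.flip.miss x := by
  rcases Nat.eq_zero_or_pos ℓ with h0 | h0
  · rw [h.flip_of_zero h0]
    have := h.terminal
    subst h0
    rwa [h.zero] at this
  · rw [h.mem_miss_flip h0 h.start_mem, Equiv.swap_apply_right]
    exact h.start h0

/-- Inner vertices of the path have edges of both colors before and after the exchange. That only
the two ends change is the source of all bounds on the damage. -/
theorem miss_flip_of_ne {z : V} (h1 : z ≠ x) (h2 : z ≠ p ℓ) : h.flip.miss z = χ.miss z := by
  by_cases hz : z ∈ prefixSet p (ℓ + 1)
  · rcases Nat.eq_zero_or_pos ℓ with h0 | h0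
    · rw [h.flip_of_zero h0]
    obtain ⟨i, hi, rfl⟩ := hz
    have h3 : ¬ (a ∈ χ.miss (p i) ∨ b ∈ χ.miss (p i)) := by
      intro hm
      rcases h.end_of_mem_miss (by omega) hm with rfl | rfl
      · exact h1 h.zero
      · exact h2 rfl
    ext c
    rw [h.mem_miss_flip h0 ⟨i, hi, rfl⟩]
    by_cases ha : c = a
    · subst ha; rw [Equiv.swap_apply_left]; tauto
    · by_cases hb : c = b
      · subst hb; rw [Equiv.swap_apply_right]; tauto
      · rw [Equiv.swap_apply_of_ne_of_ne ha hb]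
  · exact h.miss_flip_of_notMem hz

/-- The exchange permutes the two colors, so the set of edges that have one of them stays the same.
-/
theorem closed_flip {M : Set V} (hM : χ.Closed a b M) : h.flip.Closed a b M := by
  rcases Nat.eq_zero_or_pos ℓ with h0 | h0
  · rwa [h.flip_of_zero h0]
  intro y z c hc hyz hy
  rw [h.color_flip h0, flipColor] at hyz
  split at hyz
  · obtain ⟨c', h1, h2⟩ := Option.map_eq_some_iff.1 hyz
    refine hM y z c' ?_ h1 hy
    have : c' = Equiv.swap a b c := by rw [← h2]; simp
    rcases hc with rfl | rfl <;> simp [this]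
  · exact hM y z c hc hyz hy

/-- Paths in other colors survive a flip. -/
theorem isPath_flip_other {a' b' : Fin k} {x' : V} {p' : ℕ → V} {ℓ' : ℕ}
    (h' : χ.IsPath a' b' x' p' ℓ') (h1 : a' ≠ a) (h2 : a' ≠ b) (h3 : b' ≠ a) (h4 : b' ≠ b) :
    h.flip.IsPath a' b' x' p' ℓ' := by
  have hc : ∀ i, altColor a' b' i ≠ a ∧ altColor a' b' i ≠ b := by
    intro i
    rcases altColor_mem a' b' i with h | h <;> rw [h] <;> tauto
  refine ⟨⟨h'.zero, fun i hi => ?_, fun h0 => ?_⟩, ?_⟩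
  · rw [h.color_flip_other (hc i).1 (hc i).2]; exact h'.joins i hi
  · rw [h.mem_miss_flip_other h1 h2]; exact h'.start h0
  · rw [h.mem_miss_flip_other (hc _).1 (hc _).2]; exact h'.terminal

/-- A path avoids every closed set that does not contain its start. -/
theorem disjoint_of_closed (h : χ.IsPath a b x p ℓ) {M : Set V} (hM : χ.Closed a b M) (hx : x ∉ M) {i : ℕ} (hi : i ≤ ℓ) :
    p i ∉ M := by
  induction i with
  | zero => rwa [h.zero]
  | succ i ih =>
    intro hm
    have := h.joins i (by omega)
    rw [Sym2.eq_swap] at this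
    exact ih (by omega) (hM _ _ _ (altColor_mem a b i) this hm)

/-- Paths with the same colors that start outside the flipped path survive the flip. -/
theorem isPath_flip_of_notMem {x' : V} {p' : ℕ → V} {ℓ' : ℕ} (h' : χ.IsPath a b x' p' ℓ')
    (hx' : x' ∉ prefixSet p (ℓ + 1)) : h.flip.IsPath a b x' p' ℓ' := by
  rcases Nat.eq_zero_or_pos ℓ with h0 | h0
  · rwa [h.flip_of_zero h0]
  have hd : ∀ i ≤ ℓ', p' i ∉ prefixSet p (ℓ + 1) := fun i hi =>
    h'.disjoint_of_closed (h.closed (h.start h0)) hx' hi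
  refine ⟨⟨h'.zero, fun i hi => ?_, fun h0 => ?_⟩, ?_⟩
  · rw [h.color_flip_of_notMem (hd i (by omega)) (Sym2.mem_mk_left _ _)]; exact h'.joins i hi
  · rw [h.miss_flip_of_notMem hx']; exact h'.start h0
  · rw [h.miss_flip_of_notMem (hd _ le_rfl)]; exact h'.terminal

/-- After the flip, the path can be flipped back. -/
theorem isPath_back (hx : a ∈ χ.miss x) : h.flip.IsPath b a x p ℓ := by
  rcases Nat.eq_zero_or_pos ℓ with h0 | h0
  · rw [h.flip_of_zero h0]
    subst h0
    exact ⟨⟨h.zero, by simp, by simp⟩, by rw [h.zero]; simpa [altColor] using hx⟩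
  refine ⟨⟨h.zero, fun i hi => ?_, fun _ => h.miss_start⟩, ?_⟩
  · rw [h.color_flip h0, flipColor_of_mem (M := prefixSet p (ℓ + 1)) (x := p i) ⟨i, by omega, rfl⟩ (Sym2.mem_mk_left _ _),
      h.joins i hi, Option.map_some, swap_altColor, altColor_swap,
      altColor_congr b a (show (i + 1 + 1) % 2 = i % 2 by omega)]
  · rw [h.mem_miss_flip h0 ⟨ℓ, by omega, rfl⟩, altColor_swap, swap_altColor,
      altColor_congr a b (show (ℓ + 1 + 1) % 2 = ℓ % 2 by omega)]
    exact h.terminal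

/-- Allows the program to walk along a path, in order to stamp its vertices, by flipping it twice.
-/
theorem flip_back (hx : a ∈ χ.miss x) : (h.isPath_back hx).flip = χ := by
  rcases Nat.eq_zero_or_pos ℓ with h0 | h0
  · rw [(h.isPath_back hx).flip_of_zero h0, h.flip_of_zero h0]
  refine ext' fun e => ?_
  rw [(h.isPath_back hx).color_flip h0, flipColor, h.color_flip h0, flipColor]
  split
  · rw [Option.map_map, Equiv.swap_comm b a]
    simp [Function.comp_def]
  · rfl

end IsPath

/-! ### Coloring one more edge -/

open Classical in
/-- Give the color `c` to the uncolored edge `uv`. -/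
noncomputable def addColor (χ : PartialEdgeColoring G k) (u v : V) (c : Fin k)
    (he : s(u, v) ∈ G.edgeSet) (hu : c ∈ χ.miss u) (hv : c ∈ χ.miss v) :
    PartialEdgeColoring G k where
  color e := if e = s(u, v) then some c else χ.color e
  mem_edgeSet_of_color e c' h := by
    split at h
    · rename_i h'; rwa [h']
    · exact χ.mem_edgeSet_of_color e c' h
  proper e f c' x hxe hxf h h' := by
    have key : ∀ e, x ∈ e → x ∈ s(u, v) → χ.color e ≠ some c := by
      intro e hx hx'
      rcases Sym2.mem_iff.1 hx' with rfl | rfl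
      · exact hu e hx
      · exact hv e hx
    split at h <;> split at h'
    · simp_all
    · rename_i h1 h2
      exact absurd (h'.trans h.symm) (key f hxf (h1 ▸ hxe))
    · rename_i h1 h2
      exact absurd (h.trans h'.symm) (key e hxe (h2 ▸ hxf))
    · exact χ.proper e f c' x hxe hxf h h'

section addColor

variable {u v : V} {c : Fin k} {he : s(u, v) ∈ G.edgeSet} {hu : c ∈ χ.miss u} {hv : c ∈ χ.miss v}

theorem addColor_self : (χ.addColor u v c he hu hv).color s(u, v) = some c := if_pos rfl

theorem addColor_of_ne {e : Sym2 V} (h : e ≠ s(u, v)) :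
    (χ.addColor u v c he hu hv).color e = χ.color e := if_neg h

theorem mem_miss_addColor (hn : χ.color s(u, v) = none) {z : V} {c' : Fin k} :
    c' ∈ (χ.addColor u v c he hu hv).miss z ↔ c' ∈ χ.miss z ∧ ¬ (c' = c ∧ (z = u ∨ z = v)) := by
  simp only [miss, Set.mem_ofPred_eq]
  constructor
  · refine fun h => ⟨fun e hz hc => h e hz ?_, ?_⟩
    · rw [addColor_of_ne (by rintro rfl; simp [hn] at hc), hc]
    · rintro ⟨rfl, hz⟩
      exact h s(u, v) (Sym2.mem_iff.2 hz) addColor_self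
  · rintro ⟨h1, h2⟩ e hz hc
    by_cases hee : e = s(u, v)
    · subst hee
      rw [addColor_self, Option.some_inj] at hc
      exact h2 ⟨hc.symm, Sym2.mem_iff.1 hz⟩
    · rw [addColor_of_ne hee] at hc
      exact h1 e hz hc

end addColor

end PartialEdgeColoring

end

/-! ### Counting path lengths and path ends; claims of u-fans. -/

section

namespace PartialEdgeColoring

variable {V : Type*} {G : SimpleGraph V} {k : ℕ} {χ : PartialEdgeColoring G k} {a b : Fin k} {x : V}

/-! ### Lengths and ends of alternating paths -/

section paths

variable [Finite V]

open Classical in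
/-- The vertices of the maximal alternating path from `x`. -/
noncomputable def pathSeq (χ : PartialEdgeColoring G k) (a b : Fin k) (x : V) : ℕ → V :=
  if h : a ∈ χ.miss x ∨ b ∈ χ.miss x then (exists_isPath h).choose else fun _ => x

open Classical in
/-- The length of the maximal alternating path from `x`. -/
noncomputable def pathLen (χ : PartialEdgeColoring G k) (a b : Fin k) (x : V) : ℕ :=
  if h : a ∈ χ.miss x ∨ b ∈ χ.miss x then (exists_isPath h).choose_spec.choose else 0

/-- The other end of the maximal alternating path from `x`. -/
noncomputable def pathEnd (χ : PartialEdgeColoring G k) (a b : Fin k) (x : V) : V :=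
  χ.pathSeq a b x (χ.pathLen a b x)

theorem isPath_pathSeq (h : a ∈ χ.miss x ∨ b ∈ χ.miss x) :
    χ.IsPath a b x (χ.pathSeq a b x) (χ.pathLen a b x) := by
  rw [pathSeq, pathLen, dif_pos h, dif_pos h]
  exact (exists_isPath h).choose_spec.choose_spec

end paths

section counting

variable [Fintype V]

open Classical in
/-- The number of vertices that have an edge of the color `c`. -/
noncomputable def colorDeg (χ : PartialEdgeColoring G k) (c : Fin k) : ℕ :=
  (Finset.univ.filter fun y => c ∉ χ.miss y).card

/-- Double counting: at each vertex, the colors that are not missing belong to different neighbors.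
-/
theorem sum_colorDeg_le [DecidableRel G.Adj] :
    ∑ c, χ.colorDeg c ≤ 2 * G.edgeFinset.card := by
  classical
  rw [← G.sum_degrees_eq_twice_card_edges]
  simp only [colorDeg, Finset.card_filter]
  rw [Finset.sum_comm]
  refine Finset.sum_le_sum fun y _ => ?_
  rw [← Finset.card_filter, SimpleGraph.degree]
  have hch : ∀ c, c ∉ χ.miss y → ∃ z, χ.color s(y, z) = some c := fun c hc => not_mem_miss.1 hc
  refine Finset.card_le_card_of_injOn
    (fun c => if h : c ∉ χ.miss y then (hch c h).choose else y) ?_ ?_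
  · intro c hc
    have hc : c ∉ χ.miss y := by simpa using hc
    simp only [dif_pos hc, Finset.mem_coe, SimpleGraph.mem_neighborFinset]
    exact χ.mem_edgeSet_of_color _ _ (hch c hc).choose_spec
  · intro c hc c' hc' h
    have hc : c ∉ χ.miss y := by simpa using hc
    have hc' : c' ∉ χ.miss y := by simpa using hc'
    simp only [dif_pos hc, dif_pos hc'] at h
    have h1 := (hch c hc).choose_spec
    rw [h, (hch c' hc').choose_spec] at h1
    exact (Option.some_inj.1 h1).symm

/-- The vertices of a walk, except the last one, are distinct, and each has an edge of one of the
two colors. -/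
theorem IsWalk.length_le {p : ℕ → V} {ℓ : ℕ} (h : χ.IsWalk a b x p ℓ) :
    ℓ ≤ χ.colorDeg a + χ.colorDeg b := by
  classical
  have : (Finset.range ℓ).card ≤
      ((Finset.univ.filter fun y => a ∉ χ.miss y) ∪ Finset.univ.filter fun y => b ∉ χ.miss y).card := by
    refine Finset.card_le_card_of_injOn p ?_ ?_
    · intro i hi
      have h1 := not_mem_miss_left (h.joins i (by simpa using hi))
      rcases altColor_mem a b i with h2 | h2 <;> rw [h2] at h1 <;> simp [h1]
    · intro i hi j hj hij
      exact h.inj (by have := hi; simp at this; omega) (by have := hj; simp at this; omega) hij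
  rw [Finset.card_range] at this
  exact this.trans (Finset.card_union_le _ _)

-- By `IsWalk.meet`, over all starts that miss `c`, a vertex occurs at most once at an even
-- position, where it has an edge of color `γ`, and at most once at an odd position, where it has an
-- edge of color `c`.
open Classical in
theorem sum_pathLen_le_of_color (c γ : Fin k) :
    ∑ x ∈ Finset.univ.filter (fun x => c ∈ χ.miss x), χ.pathLen c γ x ≤
      χ.colorDeg γ + χ.colorDeg c := by
  have hp : ∀ x, c ∈ χ.miss x → χ.IsPath c γ x (χ.pathSeq c γ x) (χ.pathLen c γ x) :=
    fun x hx => isPath_pathSeq (Or.inl hx)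
  have h1 : ∑ x ∈ Finset.univ.filter (fun x => c ∈ χ.miss x), χ.pathLen c γ x =
      ((Finset.univ.filter fun x => c ∈ χ.miss x).sigma
        fun x => Finset.range (χ.pathLen c γ x)).card := by simp
  rw [h1, colorDeg, colorDeg, ← Finset.card_disjSum]
  refine Finset.card_le_card_of_injOn
    (fun q => if q.2 % 2 = 0 then Sum.inl (χ.pathSeq c γ q.1 q.2)
      else Sum.inr (χ.pathSeq c γ q.1 q.2)) ?_ ?_
  · rintro ⟨x, i⟩ hq
    obtain ⟨hx, hi⟩ : c ∈ χ.miss x ∧ i < χ.pathLen c γ x := by simpa using hq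
    have h2 := not_mem_miss_left ((hp x hx).joins i hi)
    by_cases h3 : i % 2 = 0
    · simp only [h3, if_true, Finset.mem_coe, Finset.inl_mem_disjSum]
      rw [altColor, if_pos h3] at h2
      simpa using h2
    · simp only [h3, if_false, Finset.mem_coe, Finset.inr_mem_disjSum]
      rw [altColor, if_neg h3] at h2
      simpa using h2
  · rintro ⟨x, i⟩ hq ⟨y, j⟩ hq' h
    obtain ⟨hx, hi⟩ : c ∈ χ.miss x ∧ i < χ.pathLen c γ x := by simpa using hq
    obtain ⟨hy, hj⟩ : c ∈ χ.miss y ∧ j < χ.pathLen c γ y := by simpa using hq'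
    have h3 : i % 2 = j % 2 ∧ χ.pathSeq c γ x i = χ.pathSeq c γ y j := by
      by_cases h4 : i % 2 = 0 <;> by_cases h5 : j % 2 = 0 <;> simp [h4, h5] at h ⊢
      · exact h
      · exact ⟨by omega, h⟩
    obtain ⟨rfl, rfl⟩ := (hp x hx).toIsWalk.meet (hp y hy).toIsWalk hx hy hi.le hj.le h3.1 h3.2
    rfl

open Classical in
/-- The total length of the alternating paths that exchange a missing color for `γ`. -/
theorem sum_pathLen_le (γ : Fin k) :
    ∑ q ∈ (Finset.univ : Finset (V × Fin k)).filter (fun q => q.2 ∈ χ.miss q.1),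
      χ.pathLen q.2 γ q.1 ≤ k * χ.colorDeg γ + ∑ c, χ.colorDeg c := by
  calc _ = ∑ c, ∑ x ∈ Finset.univ.filter (fun x => c ∈ χ.miss x), χ.pathLen c γ x := by
        rw [Finset.sum_filter, Fintype.sum_prod_type_right]
        exact Finset.sum_congr rfl fun c _ => (Finset.sum_filter _ _).symm
    _ ≤ ∑ c, (χ.colorDeg γ + χ.colorDeg c) :=
        Finset.sum_le_sum fun c _ => sum_pathLen_le_of_color c γ
    _ = _ := by simp [Finset.sum_add_distrib]

open Classical in
/-- Few alternating paths end in a given set of vertices. -/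
theorem card_pathEnd_le (γ : Fin k) (Z : Finset V) :
    ((Finset.univ : Finset (V × Fin k)).filter
      (fun q => q.2 ∈ χ.miss q.1 ∧ χ.pathEnd q.2 γ q.1 ∈ Z)).card ≤ 2 * k * Z.card := by
  have hp : ∀ c x, c ∈ χ.miss x → χ.IsPath c γ x (χ.pathSeq c γ x) (χ.pathLen c γ x) :=
    fun c x hx => isPath_pathSeq (Or.inl hx)
  have h1 : 2 * k * Z.card =
      ((Finset.range 2) ×ˢ ((Finset.univ : Finset (Fin k)) ×ˢ Z)).card := by simp [mul_assoc]
  rw [h1]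
  -- For fixed `γ`, the end of a path, its first color and the parity of its length determine its
  -- start, by `IsWalk.meet`.
  refine Finset.card_le_card_of_injOn
    (fun q => (χ.pathLen q.2 γ q.1 % 2, q.2, χ.pathEnd q.2 γ q.1)) ?_ ?_
  · rintro ⟨x, c⟩ hq
    obtain ⟨hx, hi⟩ : c ∈ χ.miss x ∧ χ.pathEnd c γ x ∈ Z := by simpa using hq
    simp only [Finset.coe_product, Set.mem_prod, Finset.mem_coe, Finset.mem_range, hi, and_true]
    exact ⟨Nat.mod_lt _ two_pos, Finset.mem_univ _⟩
  · rintro ⟨x, c⟩ hq ⟨y, c'⟩ hq' h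
    obtain ⟨hx, hi⟩ : c ∈ χ.miss x ∧ χ.pathEnd c γ x ∈ Z := by simpa using hq
    obtain ⟨hy, hj⟩ : c' ∈ χ.miss y ∧ χ.pathEnd c' γ y ∈ Z := by simpa using hq'
    simp only [Prod.mk.injEq] at h
    obtain ⟨h2, rfl, h3⟩ := h
    obtain ⟨rfl, -⟩ := (hp c x hx).toIsWalk.meet (hp c y hy).toIsWalk hx hy le_rfl le_rfl h2 h3
    rfl

theorem colorDeg_le_add_card {χ' : PartialEdgeColoring G k} (Y : Finset V)
    (h : ∀ z, z ∉ Y → χ'.miss z = χ.miss z) (c : Fin k) :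
    χ'.colorDeg c ≤ χ.colorDeg c + Y.card := by
  classical
  refine (Finset.card_le_card ?_).trans (Finset.card_union_le _ Y)
  intro z hz
  by_cases hY : z ∈ Y
  · simp [hY]
  · rw [Finset.mem_filter, h z hY] at hz
    simp [hz.2]

end counting

end PartialEdgeColoring

/-! ### Counting u-fans -/

open PartialEdgeColoring

namespace UFan

variable {V : Type*} [DecidableEq V] {G : SimpleGraph V} {k : ℕ}

/-- The tuple with the same vertices and the colors `α` and `β`. -/
def recolor (f : UFan V k) (α β : Fin k) : UFan V k := { f with α := α, β := β }

variable {f : UFan V k} {χ χ' : PartialEdgeColoring G k}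

theorem u_mem : f.u ∈ f.verts := by simp [verts]
theorem v_mem : f.v ∈ f.verts := by simp [verts]
theorem w_mem : f.w ∈ f.verts := by simp [verts]

theorem assigned_u : f.assigned f.u = f.α := by simp [assigned]
theorem IsUFan.assigned_v (h : f.IsUFan χ) : f.assigned f.v = f.β := by
  simp [assigned, h.u_ne_v.symm]
theorem IsUFan.assigned_w (h : f.IsUFan χ) : f.assigned f.w = f.β := by
  simp [assigned, h.u_ne_w.symm]

theorem card_verts_le : f.verts.card ≤ 3 := Finset.card_le_three

theorem IsUFan.mem_miss (h : f.IsUFan χ) {z : V} (hz : z ∈ f.verts) : f.assigned z ∈ χ.miss z := by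
  simp only [verts, Finset.mem_insert, Finset.mem_singleton] at hz
  rcases hz with rfl | rfl | rfl
  · rw [assigned_u]; exact h.miss_u
  · rw [h.assigned_v]; exact h.miss_v
  · rw [h.assigned_w]; exact h.miss_w

/-- A u-fan stays one as long as its edges stay uncolored and its colors stay missing. -/
theorem IsUFan.of_miss (h : f.IsUFan χ) (hc : ∀ e ∈ f.edges, χ'.color e = none)
    (hm : ∀ z ∈ f.verts, f.assigned z ∈ χ'.miss z) : f.IsUFan χ' where
  u_ne_v := h.u_ne_v
  u_ne_w := h.u_ne_w
  v_ne_w := h.v_ne_w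
  colors_ne := h.colors_ne
  edge_uv := h.edge_uv
  edge_uw := h.edge_uw
  uncolored_uv := hc _ (by simp [edges])
  uncolored_uw := hc _ (by simp [edges])
  miss_u := by have := hm _ u_mem; rwa [assigned_u] at this
  miss_v := by have := hm _ v_mem; rwa [h.assigned_v] at this
  miss_w := by have := hm _ w_mem; rwa [h.assigned_w] at this

theorem IsUFan.color_eq_none (h : f.IsUFan χ) : ∀ e ∈ f.edges, χ.color e = none := by
  intro e he
  simp only [edges, Finset.mem_insert, Finset.mem_singleton] at he
  rcases he with rfl | rfl
  · exact h.uncolored_uv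
  · exact h.uncolored_uw

end UFan

namespace IsSeparableCollection

variable {V : Type*} [DecidableEq V] {G : SimpleGraph V} {k : ℕ} {χ₀ : PartialEdgeColoring G k}
  {U : Finset (UFan V k)}

/-- The use of separability: a pair of a vertex and a color belongs to at most one member. So sums
over members are bounded by sums over such pairs, and damage to `k` pairs is damage to at most `k`
members. -/
theorem claim_injOn (hU : IsSeparableCollection χ₀ U) (φ : UFan V k → V)
    (hφ : ∀ f ∈ U, φ f ∈ f.verts) : Set.InjOn (fun f => (φ f, f.assigned (φ f))) (U : Set _) := by
  intro f hf g hg h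
  simp only [Prod.mk.injEq] at h
  by_contra hne
  have hg' := hφ g hg
  rw [← h.1] at hg'
  exact hU.colors_distinct (φ f) f hf g hg hne (hφ f hf) hg' (by rw [h.2, h.1])

theorem sum_claim_le (hU : IsSeparableCollection χ₀ U) (φ : UFan V k → V)
    (hφ : ∀ f ∈ U, φ f ∈ f.verts) (A : Finset (UFan V k)) (hA : A ⊆ U) (P : Finset (V × Fin k))
    (hP : ∀ f ∈ A, (φ f, f.assigned (φ f)) ∈ P) (g : V × Fin k → ℕ) :
    ∑ f ∈ A, g (φ f, f.assigned (φ f)) ≤ ∑ q ∈ P, g q := by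
  rw [← Finset.sum_image (f := g) (g := fun f => (φ f, f.assigned (φ f)))
    (fun x hx y hy h => hU.claim_injOn φ hφ (hA hx) (hA hy) h)]
  refine Finset.sum_le_sum_of_subset fun q hq => ?_
  obtain ⟨f, hf, rfl⟩ := Finset.mem_image.1 hq
  exact hP f hf

theorem card_claim_le (hU : IsSeparableCollection χ₀ U) (A : Finset (UFan V k)) (hA : A ⊆ U)
    (P : Finset (V × Fin k)) (hP : ∀ f ∈ A, ∃ z ∈ f.verts, (z, f.assigned z) ∈ P) :
    A.card ≤ P.card := by
  classical
  have hφ : ∀ f ∈ U, (if h : f ∈ A then (hP f h).choose else f.u) ∈ f.verts := by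
    intro f _
    split
    · rename_i h; exact (hP f h).choose_spec.1
    · exact UFan.u_mem
  have := hU.sum_claim_le (fun f => if h : f ∈ A then (hP f h).choose else f.u) hφ A hA P
    (fun f hf => by simp only [dif_pos hf]; exact (hP f hf).choose_spec.2) (fun _ => 1)
  simpa using this

theorem card_edges (hU : IsSeparableCollection χ₀ U) [Fintype V] [DecidableRel G.Adj] :
    2 * U.card ≤ G.edgeFinset.card := by
  classical
  have h1 : (U.biUnion UFan.edges).card = ∑ f ∈ U, f.edges.card :=
    Finset.card_biUnion fun f hf g hg h => hU.edge_disjoint f hf g hg h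
  have h2 : ∀ f ∈ U, f.edges.card = 2 := by
    intro f hf
    rw [UFan.edges, Finset.card_pair]
    intro h
    rcases Sym2.eq_iff.1 h with h | h
    · exact (hU.isUFan f hf).v_ne_w h.2
    · exact (hU.isUFan f hf).u_ne_w h.1
  rw [Finset.sum_congr rfl h2, Finset.sum_const, smul_eq_mul] at h1
  rw [mul_comm, ← h1]
  refine Finset.card_le_card fun e he => ?_
  obtain ⟨f, hf, hef⟩ := Finset.mem_biUnion.1 he
  rw [SimpleGraph.mem_edgeFinset]
  simp only [UFan.edges, Finset.mem_insert, Finset.mem_singleton] at hef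
  rcases hef with rfl | rfl
  · exact (hU.isUFan f hf).edge_uv
  · exact (hU.isUFan f hf).edge_uw

/-- The two leaves are different neighbors of the center. With `Δ + 1` colors this means at least
three, which `Setup.drift` needs because each u-fan is unusable for up to two choices of `α`. -/
theorem three_le_colors (hU : IsSeparableCollection χ₀ U) [Fintype V] [DecidableRel G.Adj]
    (h : U.Nonempty) : 2 ≤ G.maxDegree := by
  obtain ⟨f, hf⟩ := h
  have hf := hU.isUFan f hf
  refine le_trans ?_ (G.degree_le_maxDegree f.u)
  rw [← Finset.card_pair hf.v_ne_w]
  refine Finset.card_le_card fun z hz => ?_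
  simp only [Finset.mem_insert, Finset.mem_singleton] at hz
  rw [SimpleGraph.mem_neighborFinset]
  rcases hz with rfl | rfl
  · exact hf.edge_uv
  · exact hf.edge_uw

end IsSeparableCollection

end

/-! ### Damage by flips, and conversion of u-fans to the colors of a round. -/

section

open PartialEdgeColoring

set_option linter.unusedSectionVars false

variable {V : Type*} [Fintype V] [DecidableEq V] {G : SimpleGraph V} {k : ℕ}
  {χ₀ χ : PartialEdgeColoring G k} {U : Finset (UFan V k)}

/-! ### Damage -/

open Classical in
/-- The number of members of `U` that are no u-fans with respect to `χ`. -/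
noncomputable def deadCount (U : Finset (UFan V k)) (χ : PartialEdgeColoring G k) : ℕ :=
  (U.filter fun f => ¬ f.IsUFan χ).card

theorem deadCount_eq_zero (hU : IsSeparableCollection χ₀ U) : deadCount U χ₀ = 0 := by
  classical
  rw [deadCount, Finset.card_eq_zero, Finset.filter_eq_empty_iff]
  exact fun f hf => not_not.2 (hU.isUFan f hf)

/-- Each newly damaged member is charged to a pair in `P` that it claims, and no pair is charged
twice. -/
theorem IsSeparableCollection.deadCount_le_add (hU : IsSeparableCollection χ₀ U)
    {χ' : PartialEdgeColoring G k} (P : Finset (V × Fin k))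
    (h : ∀ f ∈ U, f.IsUFan χ → ¬ f.IsUFan χ' → ∃ z ∈ f.verts, (z, f.assigned z) ∈ P) :
    deadCount U χ' ≤ deadCount U χ + P.card := by
  classical
  have h1 : (U.filter fun f => ¬ f.IsUFan χ') ⊆
      (U.filter fun f => ¬ f.IsUFan χ) ∪ (U.filter fun f => f.IsUFan χ ∧ ¬ f.IsUFan χ') := by
    intro f hf
    rw [Finset.mem_filter] at hf
    by_cases h : f.IsUFan χ <;> simp [h, hf]
  refine (Finset.card_le_card h1).trans ((Finset.card_union_le _ _).trans ?_)
  refine Nat.add_le_add le_rfl (hU.card_claim_le _ (Finset.filter_subset _ _) P ?_)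
  intro f hf
  rw [Finset.mem_filter] at hf
  exact h f hf.1 hf.2.1 hf.2.2

theorem UFan.exists_damaged {f : UFan V k} {χ' : PartialEdgeColoring G k} (hf : f.IsUFan χ)
    (hf' : ¬ f.IsUFan χ') (hc : ∀ e ∈ f.edges, χ'.color e = none) :
    ∃ z ∈ f.verts, f.assigned z ∈ χ.miss z ∧ f.assigned z ∉ χ'.miss z := by
  by_contra hcon
  push Not at hcon
  exact hf' (hf.of_miss hc fun z hz => hcon z hz (hf.mem_miss hz))

section flip

variable {a b : Fin k} {x : V} {p : ℕ → V} {ℓ : ℕ}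

/-- Two ends and two colors make four pairs that can stop being missing. -/
theorem PartialEdgeColoring.IsPath.deadCount_flip_le (hU : IsSeparableCollection χ₀ U)
    (h : χ.IsPath a b x p ℓ) : deadCount U h.flip ≤ deadCount U χ + 4 := by
  refine (hU.deadCount_le_add (χ := χ) (({x, p ℓ} : Finset V) ×ˢ ({a, b} : Finset (Fin k))) ?_).trans ?_
  · intro f _ h1 h2
    obtain ⟨z, hz, h3, h4⟩ := UFan.exists_damaged h1 h2
      fun e he => h.color_flip_eq_none.2 (h1.color_eq_none e he)
    refine ⟨z, hz, ?_⟩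
    simp only [Finset.mem_product, Finset.mem_insert, Finset.mem_singleton]
    constructor
    · by_contra hcon
      push Not at hcon
      rw [h.miss_flip_of_ne hcon.1 hcon.2] at h4
      exact h4 h3
    · by_contra hcon
      push Not at hcon
      rw [h.mem_miss_flip_other hcon.1 hcon.2] at h4
      exact h4 h3
  · rw [Finset.card_product]
    exact Nat.add_le_add le_rfl (Nat.mul_le_mul Finset.card_le_two Finset.card_le_two)

theorem PartialEdgeColoring.IsPath.colorDeg_flip_le (h : χ.IsPath a b x p ℓ) (c : Fin k) :
    h.flip.colorDeg c ≤ χ.colorDeg c + 2 := by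
  refine (colorDeg_le_add_card {x, p ℓ} ?_ c).trans (Nat.add_le_add le_rfl Finset.card_le_two)
  intro z hz
  simp only [Finset.mem_insert, Finset.mem_singleton, not_or] at hz
  exact h.miss_flip_of_ne hz.1 hz.2

end flip

/-! ### Giving new colors to a u-fan -/

/-- The total length of the three paths that are flipped in order to give the colors `α` and `β`
to the u-fan `f`. -/
noncomputable def convLen (χ : PartialEdgeColoring G k) (α β : Fin k) (f : UFan V k) : ℕ :=
  χ.pathLen f.α α f.u + χ.pathLen f.β β f.v + χ.pathLen f.β β f.w

/-- The ends of these three paths. -/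
noncomputable def convEnds (χ : PartialEdgeColoring G k) (α β : Fin k) (f : UFan V k) : Finset V :=
  {χ.pathEnd f.α α f.u, χ.pathEnd f.β β f.v, χ.pathEnd f.β β f.w}

-- The paths from the centers, from the first leaves and from the second leaves are three families,
-- each indexed injectively by claimed pairs; `sum_pathLen_le` is applied once with `γ = α` and
-- twice with `γ = β`.
open Classical in
theorem IsSeparableCollection.sum_convLen_le (hU : IsSeparableCollection χ₀ U) (α β : Fin k) :
    ∑ f ∈ U.filter (fun f => f.IsUFan χ), convLen χ α β f ≤
      k * χ.colorDeg α + 2 * k * χ.colorDeg β + 3 * ∑ c, χ.colorDeg c := by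
  set A := U.filter fun f => f.IsUFan χ with hA
  have hAU : A ⊆ U := Finset.filter_subset _ _
  have hAf : ∀ f ∈ A, f.IsUFan χ := fun f hf => (Finset.mem_filter.1 hf).2
  have key : ∀ (φ : UFan V k → V) (γ : Fin k), (∀ f, φ f ∈ f.verts) →
      ∑ f ∈ A, χ.pathLen (f.assigned (φ f)) γ (φ f) ≤
        k * χ.colorDeg γ + ∑ c, χ.colorDeg c := fun φ γ hφ =>
    (hU.sum_claim_le φ (fun f _ => hφ f) A hAU _
      (fun f hf => by simpa using (hAf f hf).mem_miss (hφ f))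
      (fun q => χ.pathLen q.2 γ q.1)).trans (sum_pathLen_le γ)
  have h1 := key UFan.u α fun f => UFan.u_mem
  have h2 := key UFan.v β fun f => UFan.v_mem
  have h3 := key UFan.w β fun f => UFan.w_mem
  rw [Finset.sum_congr rfl fun f hf => by rw [UFan.assigned_u]] at h1
  rw [Finset.sum_congr rfl fun f hf => by rw [(hAf f hf).assigned_v]] at h2
  rw [Finset.sum_congr rfl fun f hf => by rw [(hAf f hf).assigned_w]] at h3
  simp only [convLen, Finset.sum_add_distrib]
  linarith

/-- The u-fan `f` or one of the paths to be flipped touches `Z`. -/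
def Hits (χ : PartialEdgeColoring G k) (α β : Fin k) (Z : Finset V) (f : UFan V k) : Prop :=
  ¬ Disjoint f.verts Z ∨ ¬ Disjoint (convEnds χ α β f) Z

-- `7 = 1 + 3 * 2`: at most `k` members contain a given vertex, since they assign different colors
-- to it, and in each of the three families of paths at most `2 * k` end there.
open Classical in
theorem IsSeparableCollection.card_hits_le (hU : IsSeparableCollection χ₀ U) (α β : Fin k)
    (Z : Finset V) :
    (U.filter fun f => f.IsUFan χ ∧ Hits χ α β Z f).card ≤ 7 * k * Z.card := by
  have key : ∀ (φ : UFan V k → V) (γ : Fin k), (∀ f, φ f ∈ f.verts) →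
      (U.filter fun f => f.IsUFan χ ∧ χ.pathEnd (f.assigned (φ f)) γ (φ f) ∈ Z).card
        ≤ 2 * k * Z.card := by
    intro φ γ hφ
    refine (hU.card_claim_le _ (Finset.filter_subset _ _) _ ?_).trans (card_pathEnd_le (χ := χ) γ Z)
    intro f hf
    rw [Finset.mem_filter] at hf
    exact ⟨φ f, hφ f, by simpa using ⟨hf.2.1.mem_miss (hφ f), hf.2.2⟩⟩
  have h0 : (U.filter fun f => ¬ Disjoint f.verts Z).card ≤ k * Z.card := by
    refine (hU.card_claim_le _ (Finset.filter_subset _ _) (Z ×ˢ Finset.univ) ?_).trans ?_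
    · intro f hf
      rw [Finset.mem_filter, Finset.not_disjoint_iff] at hf
      obtain ⟨z, hz, hz'⟩ := hf.2
      exact ⟨z, hz, by simpa using hz'⟩
    · rw [Finset.card_product, Finset.card_univ, Fintype.card_fin, mul_comm]
  have h1 := key UFan.u α fun f => UFan.u_mem
  have h2 := key UFan.v β fun f => UFan.v_mem
  have h3 := key UFan.w β fun f => UFan.w_mem
  have hsub : (U.filter fun f => f.IsUFan χ ∧ Hits χ α β Z f) ⊆
      (U.filter fun f => ¬ Disjoint f.verts Z) ∪
      ((U.filter fun f => f.IsUFan χ ∧ χ.pathEnd (f.assigned f.u) α f.u ∈ Z) ∪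
      ((U.filter fun f => f.IsUFan χ ∧ χ.pathEnd (f.assigned f.v) β f.v ∈ Z) ∪
      (U.filter fun f => f.IsUFan χ ∧ χ.pathEnd (f.assigned f.w) β f.w ∈ Z))) := by
    intro f hf
    simp only [Finset.mem_filter, Finset.mem_union] at hf ⊢
    obtain ⟨hf1, hf2, hf3⟩ := hf
    rw [UFan.assigned_u, hf2.assigned_v, hf2.assigned_w]
    rcases hf3 with h | h
    · exact Or.inl ⟨hf1, h⟩
    · rw [Finset.not_disjoint_iff] at h
      obtain ⟨z, hz, hz'⟩ := h
      simp only [convEnds, Finset.mem_insert, Finset.mem_singleton] at hz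
      rcases hz with rfl | rfl | rfl <;> simp [hf1, hf2, hz']
  refine (Finset.card_le_card hsub).trans ((Finset.card_union_le _ _).trans ?_)
  have h4 := Finset.card_union_le (U.filter fun f => f.IsUFan χ ∧ χ.pathEnd (f.assigned f.u) α f.u ∈ Z)
    ((U.filter fun f => f.IsUFan χ ∧ χ.pathEnd (f.assigned f.v) β f.v ∈ Z) ∪
      (U.filter fun f => f.IsUFan χ ∧ χ.pathEnd (f.assigned f.w) β f.w ∈ Z))
  have h5 := Finset.card_union_le (U.filter fun f => f.IsUFan χ ∧ χ.pathEnd (f.assigned f.v) β f.v ∈ Z)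
    (U.filter fun f => f.IsUFan χ ∧ χ.pathEnd (f.assigned f.w) β f.w ∈ Z)
  nlinarith

/-- The coloring `χ'` arises from `χ` by flips that give the colors `α` and `β` to `f`. -/
structure Converted (U : Finset (UFan V k)) (χ : PartialEdgeColoring G k) (α β : Fin k)
    (f : UFan V k) (χ' : PartialEdgeColoring G k) : Prop where
  isUFan : (f.recolor α β).IsUFan χ'
  color_eq_none : ∀ e, χ'.color e = none ↔ χ.color e = none
  miss_eq : ∀ z, z ∉ f.verts → z ∉ convEnds χ α β f → χ'.miss z = χ.miss z
  dead_le : deadCount U χ' ≤ deadCount U χ + 12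
  colorDeg_le : ∀ c, χ'.colorDeg c ≤ χ.colorDeg c + 6

/-- The assumptions on the colors make `{f.α, α}` and `{f.β, β}` disjoint, so the flip at the center
and those at the leaves do not interfere. The paths from the two leaves have the same colors: either
the first one ends at the other leaf and settles it too, or the second one is disjoint from the
first and survives its flip. In both cases lengths and ends can be measured in the coloring before
the flips. -/
theorem UFan.IsUFan.exists_converted (hU : IsSeparableCollection χ₀ U) {f : UFan V k}
    (hf : f.IsUFan χ) {α β : Fin k} (hαβ : α ≠ β) (h1 : f.α ≠ β) (h2 : f.β ≠ α) :
    ∃ p₁ ℓ₁ p₂ ℓ₂ p₃ ℓ₃, ∃ (P₁ : χ.IsPath f.α α f.u p₁ ℓ₁) (P₂ : P₁.flip.IsPath f.β β f.v p₂ ℓ₂)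
      (P₃ : P₂.flip.IsPath f.β β f.w p₃ ℓ₃), ℓ₁ + ℓ₂ + ℓ₃ ≤ convLen χ α β f ∧
        Converted U χ α β f P₃.flip := by
  have P₁ := isPath_pathSeq (χ := χ) (a := f.α) (b := α) (x := f.u) (Or.inl hf.miss_u)
  have Qv := isPath_pathSeq (χ := χ) (a := f.β) (b := β) (x := f.v) (Or.inl hf.miss_v)
  have Qw := isPath_pathSeq (χ := χ) (a := f.β) (b := β) (x := f.w) (Or.inl hf.miss_w)
  have P₂ := P₁.isPath_flip_other Qv hf.colors_ne.symm h2 h1.symm hαβ.symm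
  have Rw := P₁.isPath_flip_other Qw hf.colors_ne.symm h2 h1.symm hαβ.symm
  have hw1 : f.β ∈ P₁.flip.miss f.w := by
    rw [P₁.mem_miss_flip_other hf.colors_ne.symm h2]; exact hf.miss_w
  obtain ⟨p₃, ℓ₃, P₃, hℓ, hend⟩ : ∃ p₃ ℓ₃, ∃ P₃ : P₂.flip.IsPath f.β β f.w p₃ ℓ₃,
      ℓ₃ ≤ χ.pathLen f.β β f.w ∧ (p₃ ℓ₃ = χ.pathEnd f.β β f.w ∨ p₃ ℓ₃ = f.w) := by
    -- If `f.w` lies on the path from `f.v`, then the flip has already made `f.w` miss `β`, and the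
    -- third path is trivial.
    by_cases hw : f.w ∈ prefixSet (χ.pathSeq f.β β f.v) (χ.pathLen f.β β f.v + 1)
    · have hb : β ∈ P₂.flip.miss f.w := by
        rcases Nat.eq_zero_or_pos (χ.pathLen f.β β f.v) with h0 | h0
        · obtain ⟨i, hi, hiw⟩ := hw
          have : i = 0 := by omega
          subst this
          rw [P₂.zero] at hiw
          exact absurd hiw hf.v_ne_w
        · rw [P₂.mem_miss_flip h0 hw, Equiv.swap_apply_right]
          exact hw1
      exact ⟨fun _ => f.w, 0, ⟨⟨rfl, by simp, by simp⟩, hb⟩, Nat.zero_le _, Or.inr rfl⟩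
    · exact ⟨_, _, P₂.isPath_flip_of_notMem Rw hw, le_rfl, Or.inl rfl⟩
  refine ⟨_, _, _, _, _, _, P₁, P₂, P₃, by simp only [convLen]; omega, ?_⟩
  have hnone : ∀ e, P₃.flip.color e = none ↔ χ.color e = none := fun e => by
    rw [P₃.color_flip_eq_none, P₂.color_flip_eq_none, P₁.color_flip_eq_none]
  constructor
  · refine ⟨hf.u_ne_v, hf.u_ne_w, hf.v_ne_w, hαβ, hf.edge_uv, hf.edge_uw,
      (hnone _).2 hf.uncolored_uv, (hnone _).2 hf.uncolored_uw, ?_, ?_, P₃.miss_start⟩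
    · show α ∈ P₃.flip.miss f.u
      rw [P₃.mem_miss_flip_other h2.symm hαβ, P₂.mem_miss_flip_other h2.symm hαβ]
      exact P₁.miss_start
    · show β ∈ P₃.flip.miss f.v
      have hv2 : β ∈ P₂.flip.miss f.v := P₂.miss_start
      by_cases hend' : f.v = p₃ ℓ₃
      · -- the path from `f.w` cannot end in `f.v`
        rcases Nat.eq_zero_or_pos ℓ₃ with h0 | h0
        · rwa [P₃.flip_of_zero h0]
        exfalso
        by_cases hw : f.w ∈ prefixSet (χ.pathSeq f.β β f.v) (χ.pathLen f.β β f.v + 1)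
        · have h3 := not_mem_miss_left (P₃.joins 0 h0)
          rw [P₃.zero] at h3
          refine h3 ?_
          rw [altColor, if_pos rfl]
          rcases Nat.eq_zero_or_pos (χ.pathLen f.β β f.v) with h00 | h00
          · obtain ⟨i, hi, hiw⟩ := hw
            have : i = 0 := by omega
            subst this
            rw [P₂.zero] at hiw
            exact absurd hiw hf.v_ne_w
          · rw [P₂.mem_miss_flip h00 hw, Equiv.swap_apply_right]
            exact hw1
        · have hvβ : f.β ∈ P₁.flip.miss f.v := by
            rw [P₁.mem_miss_flip_other hf.colors_ne.symm h2]; exact hf.miss_v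
          have hcl := P₂.closed_flip (P₂.closed hvβ)
          exact P₃.disjoint_of_closed hcl hw le_rfl (hend' ▸ P₂.start_mem)
      · rw [P₃.miss_flip_of_ne hf.v_ne_w hend']
        exact hv2
  · exact hnone
  · intro z hz hz'
    simp only [UFan.verts, convEnds, Finset.mem_insert, Finset.mem_singleton, not_or] at hz hz'
    rw [P₃.miss_flip_of_ne hz.2.2, P₂.miss_flip_of_ne hz.2.1 hz'.2.1,
      P₁.miss_flip_of_ne hz.1 hz'.1]
    rcases hend with h | h <;> rw [h]
    · exact hz'.2.2
    · exact hz.2.2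
  · have := P₁.deadCount_flip_le hU
    have := P₂.deadCount_flip_le hU
    have := P₃.deadCount_flip_le hU
    omega
  · intro c
    have := P₁.colorDeg_flip_le c
    have := P₂.colorDeg_flip_le c
    have := P₃.colorDeg_flip_le c
    omega

open Classical in
/-- The number of members of `L` that are u-fans with the colors `α` and `β`. -/
noncomputable def readyCount (χ : PartialEdgeColoring G k) (α β : Fin k) (L : Finset (UFan V k)) :
    ℕ := (L.filter fun f => (f.recolor α β).IsUFan χ).card

theorem Converted.isUFan_of_disjoint {χ' : PartialEdgeColoring G k} {α β : Fin k}
    {f g : UFan V k} (h : Converted U χ α β f χ') (hg : (g.recolor α β).IsUFan χ)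
    (h1 : Disjoint f.verts g.verts) (h2 : Disjoint (convEnds χ α β f) g.verts) :
    (g.recolor α β).IsUFan χ' := by
  refine hg.of_miss (fun e he => (h.color_eq_none e).2 (hg.color_eq_none e he)) fun z hz => ?_
  rw [h.miss_eq z (fun hz' => Finset.disjoint_left.1 h1 hz' hz)
    (fun hz' => Finset.disjoint_left.1 h2 hz' hz)]
  exact hg.mem_miss hz

/-- Pairwise vertex-disjoint tuples. -/
def VertDisjoint (L : Finset (UFan V k)) : Prop :=
  ∀ f ∈ L, ∀ g ∈ L, f ≠ g → Disjoint f.verts g.verts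

theorem VertDisjoint.card_le {L A : Finset (UFan V k)} (hL : VertDisjoint L) (hA : A ⊆ L)
    (Y : Finset V) (h : ∀ g ∈ A, ∃ z ∈ g.verts, z ∈ Y) : A.card ≤ Y.card := by
  classical
  refine Finset.card_le_card_of_injOn (fun g => if h' : g ∈ A then (h g h').choose else g.u) ?_ ?_
  · intro g hg
    have hg : g ∈ A := hg
    simp only [dif_pos hg]
    exact (h g hg).choose_spec.2
  · intro g hg g' hg' he
    have hg : g ∈ A := hg
    have hg' : g' ∈ A := hg'
    simp only [dif_pos hg, dif_pos hg'] at he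
    by_contra hne
    refine Finset.disjoint_left.1 (hL g (hA hg) g' (hA hg') hne) (h g hg).choose_spec.1 ?_
    rw [he]
    exact (h g' hg').choose_spec.1

/-- Outside of `f` only the three ends of the flipped paths change their missing colors. As the
members of `L` are vertex-disjoint, at most three of them are lost, and none if the ends avoid `L`.
-/
theorem Converted.ready_insert {χ' : PartialEdgeColoring G k} {α β : Fin k} {f : UFan V k}
    {L : Finset (UFan V k)} (h : Converted U χ α β f χ') (hL : VertDisjoint L)
    (hf : Disjoint f.verts (L.biUnion UFan.verts)) :
    readyCount χ α β L + 1 ≤ readyCount χ' α β (insert f L) + 3 ∧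
    (Disjoint (convEnds χ α β f) (L.biUnion UFan.verts) →
      readyCount χ α β L + 1 ≤ readyCount χ' α β (insert f L)) := by
  classical
  have hfL : f ∉ L := fun hfL => Finset.disjoint_left.1 hf UFan.u_mem
    (Finset.mem_biUnion.2 ⟨f, hfL, UFan.u_mem⟩)
  have hdis : ∀ g ∈ L, Disjoint f.verts g.verts := fun g hg =>
    Finset.disjoint_of_subset_right (Finset.subset_biUnion_of_mem UFan.verts hg) hf
  have hins : readyCount χ' α β (insert f L) =
      (L.filter fun g => (g.recolor α β).IsUFan χ').card + 1 := by
    rw [readyCount, Finset.filter_insert, if_pos h.isUFan, Finset.card_insert_of_notMem]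
    simp [hfL]
  constructor
  · set A := L.filter fun g => (g.recolor α β).IsUFan χ ∧ ¬ (g.recolor α β).IsUFan χ' with hA
    have hAc : A.card ≤ (convEnds χ α β f).card := by
      refine hL.card_le (Finset.filter_subset _ _) _ fun g hg => ?_
      rw [Finset.mem_filter] at hg
      by_contra hcon
      push Not at hcon
      exact hg.2.2 (h.isUFan_of_disjoint hg.2.1 (hdis g hg.1)
        (Finset.disjoint_right.2 fun z hz => hcon z hz))
    have h3 : (convEnds χ α β f).card ≤ 3 := Finset.card_le_three
    have hsub : L.filter (fun g => (g.recolor α β).IsUFan χ) ⊆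
        (L.filter fun g => (g.recolor α β).IsUFan χ') ∪ A := by
      intro g hg
      rw [Finset.mem_filter] at hg
      by_cases hg' : (g.recolor α β).IsUFan χ' <;> simp [hA, hg, hg']
    have := (Finset.card_le_card hsub).trans (Finset.card_union_le _ _)
    rw [hins, readyCount]
    omega
  · intro hd
    rw [hins, readyCount]
    refine Nat.add_le_add (Finset.card_le_card fun g hg => ?_) le_rfl
    rw [Finset.mem_filter] at hg ⊢
    exact ⟨hg.1, h.isUFan_of_disjoint hg.2 (hdis g hg.1)
      (Finset.disjoint_of_subset_right (Finset.subset_biUnion_of_mem UFan.verts hg.1) hd)⟩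

end

/-! ### Coloring one edge of a converted u-fan. -/

section

open PartialEdgeColoring

set_option linter.unusedSectionVars false

variable {V : Type*} [Fintype V] [DecidableEq V] {G : SimpleGraph V} {k : ℕ}
  {χ₀ χ : PartialEdgeColoring G k} {U : Finset (UFan V k)}

/-! ### Coloring an edge of a u-fan -/

open Classical in
/-- The number of vertices outside `M` that do not miss both `a` and `b`. -/
noncomputable def unvisited (χ : PartialEdgeColoring G k) (a b : Fin k) (M : Set V) : ℕ :=
  (Finset.univ.filter fun z => z ∉ M ∧ ¬ (a ∈ χ.miss z ∧ b ∈ χ.miss z)).card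

theorem unvisited_le (a b : Fin k) (M : Set V) :
    unvisited χ a b M ≤ χ.colorDeg a + χ.colorDeg b := by
  classical
  refine (Finset.card_le_card fun z hz => ?_).trans (Finset.card_union_le _ _)
  simp only [Finset.mem_filter, Finset.mem_union, Finset.mem_univ, true_and] at hz ⊢
  tauto

/-- The coloring `χ'` arises from `χ` by flipping the path from the center of `f`, followed by
coloring one edge of `f`; the vertices of the paths from the ends of this edge are added
to the set `M`. -/
structure Completed (U : Finset (UFan V k)) (χ : PartialEdgeColoring G k) (M : Set V) (α β : Fin k)
    (f : UFan V k) (leaf : V) (χ' : PartialEdgeColoring G k) (M' : Set V) (cost : ℕ) : Prop where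
  closed : χ'.Closed α β M'
  unvisited_add_le : unvisited χ' α β M' + cost ≤ unvisited χ α β M
  subset : M ⊆ M'
  center_mem : f.u ∈ M'
  miss_eq : ∀ z, z ∉ M' → χ'.miss z = χ.miss z
  color_eq_none : ∀ e, χ'.color e = none ↔ χ.color e = none ∧ e ≠ s(f.u, leaf)
  edge_mem : s(f.u, leaf) ∈ f.edges
  uncolored : χ.color s(f.u, leaf) = none
  dead_le : deadCount U χ' ≤ deadCount U χ + 7
  ends : ∃ Y : Finset V, Y.card ≤ 4 ∧
    ∀ z ∈ M', z ∉ M → (α ∈ χ.miss z ∨ β ∈ χ.miss z) → z ∈ Y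

theorem UFan.mem_verts_of_mem_edges {f : UFan V k} {e : Sym2 V} (he : e ∈ f.edges) {z : V}
    (hz : z ∈ e) : z ∈ f.verts := by
  simp only [edges, Finset.mem_insert, Finset.mem_singleton] at he
  simp only [verts, Finset.mem_insert, Finset.mem_singleton]
  rcases he with rfl | rfl <;> rcases Sym2.mem_iff.1 hz with h | h <;> simp [h]

/-- After the flip of the path from the center, the center misses `β`. The chosen leaf is not an end
of this path and hence, missing `β`, does not lie on it; so it still misses `β`, and the edge can be
colored. The new edge joins the path `p` from the center to the path `q` from the leaf, and
therefore both are added to `M`: the result is closed again, and nothing has changed outside of it.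
-/
theorem UFan.IsUFan.exists_completed (hU : IsSeparableCollection χ₀ U) {f : UFan V k}
    (hfU : f ∈ U) {α β : Fin k} (hf : (f.recolor α β).IsUFan χ) {M : Set V}
    (hM : χ.Closed α β M) (hfM : ∀ z ∈ f.verts, z ∉ M) :
    ∃ p ℓ, ∃ (P : χ.IsPath α β f.u p ℓ), ∃ leaf, leaf = (if p ℓ = f.v then f.w else f.v) ∧
      ∃ q ℓ', ∃ (_ : P.flip.IsPath β α leaf q ℓ') (_ : β ∈ P.flip.miss leaf)
        (he : s(f.u, leaf) ∈ G.edgeSet) (hu : β ∈ P.flip.miss f.u) (hv : β ∈ P.flip.miss leaf),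
        Completed U χ M α β f leaf (P.flip.addColor f.u leaf β he hu hv)
          (M ∪ prefixSet p (ℓ + 1) ∪ prefixSet q (ℓ' + 1)) (ℓ + ℓ') := by
  classical
  have hα : α ∈ χ.miss f.u := hf.miss_u
  have P := isPath_pathSeq (χ := χ) (a := α) (b := β) (x := f.u) (Or.inl hα)
  generalize χ.pathSeq α β f.u = p, χ.pathLen α β f.u = ℓ at P
  obtain ⟨leaf, hleaf⟩ : ∃ leaf, leaf = if p ℓ = f.v then f.w else f.v := ⟨_, rfl⟩
  have hlv : leaf = f.v ∨ leaf = f.w := by rw [hleaf]; split <;> simp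
  have hlx : leaf ≠ p ℓ := by
    rw [hleaf]; split
    · rename_i h; rw [h]; exact hf.v_ne_w.symm
    · rename_i h; exact fun h' => h h'.symm
  have hlu : leaf ≠ f.u := by
    rcases hlv with h | h <;> rw [h]
    · exact hf.u_ne_v.symm
    · exact hf.u_ne_w.symm
  have hlβ : β ∈ χ.miss leaf := by
    rcases hlv with h | h <;> rw [h]
    · exact hf.miss_v
    · exact hf.miss_w
  have hle : s(f.u, leaf) ∈ f.edges := by rcases hlv with h | h <;> rw [h] <;> simp [UFan.edges]
  have hlM : leaf ∉ M := hfM _ (UFan.mem_verts_of_mem_edges hle (Sym2.mem_mk_right _ _))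
  have huM : f.u ∉ M := hfM _ UFan.u_mem
  have hlG : s(f.u, leaf) ∈ G.edgeSet := by
    rcases hlv with h | h <;> rw [h]
    · exact hf.edge_uv
    · exact hf.edge_uw
  have hln : χ.color s(f.u, leaf) = none := hf.color_eq_none _ hle
  have hlP : leaf ∉ prefixSet p (ℓ + 1) := by
    rintro ⟨i, hi, hi'⟩
    rcases P.end_of_mem_miss (i := i) (by omega) (Or.inr (hi' ▸ hlβ)) with h | h
    · rw [h, P.zero] at hi'; exact hlu hi'.symm
    · rw [h] at hi'; exact hlx hi'.symm
  have hlβ' : β ∈ P.flip.miss leaf := by rw [P.miss_flip_of_notMem hlP]; exact hlβ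
  have Q := isPath_pathSeq (χ := P.flip) (a := β) (b := α) (x := leaf) (Or.inl hlβ')
  generalize P.flip.pathSeq β α leaf = q, P.flip.pathLen β α leaf = ℓ' at Q
  refine ⟨p, ℓ, P, leaf, hleaf, q, ℓ', Q, hlβ', hlG, P.miss_start, hlβ', ?_⟩
  have hcl1 : P.flip.Closed α β (M ∪ prefixSet p (ℓ + 1)) := P.closed_flip (hM.union (P.closed hα))
  have hcl2 : P.flip.Closed α β (M ∪ prefixSet p (ℓ + 1) ∪ prefixSet q (ℓ' + 1)) :=
    hcl1.union (Q.closed hlβ').symm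
  have hpM : ∀ i ≤ ℓ, p i ∉ M := fun i hi => P.disjoint_of_closed hM huM hi
  have hqM : ∀ i ≤ ℓ', q i ∉ M ∪ prefixSet p (ℓ + 1) := fun i hi =>
    Q.disjoint_of_closed hcl1.symm (by rintro (h | h); exacts [hlM h, hlP h]) hi
  have huM' : f.u ∈ M ∪ prefixSet p (ℓ + 1) ∪ prefixSet q (ℓ' + 1) := Or.inl (Or.inr P.start_mem)
  have hlM' : leaf ∈ M ∪ prefixSet p (ℓ + 1) ∪ prefixSet q (ℓ' + 1) := Or.inr Q.start_mem
  have hPn : P.flip.color s(f.u, leaf) = none := P.color_flip_eq_none.2 hln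
  have hnone : ∀ e, (P.flip.addColor f.u leaf β hlG P.miss_start hlβ').color e = none ↔
      χ.color e = none ∧ e ≠ s(f.u, leaf) := by
    intro e
    by_cases he : e = s(f.u, leaf)
    · subst he; simp [addColor_self]
    · rw [addColor_of_ne he, P.color_flip_eq_none]; simp [he]
  have hmiss : ∀ z, z ∉ M ∪ prefixSet p (ℓ + 1) ∪ prefixSet q (ℓ' + 1) →
      (P.flip.addColor f.u leaf β hlG P.miss_start hlβ').miss z = χ.miss z := by
    intro z hz
    have hz1 : z ∉ prefixSet p (ℓ + 1) := fun h => hz (Or.inl (Or.inr h))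
    rw [← P.miss_flip_of_notMem hz1]
    ext c
    rw [mem_miss_addColor hPn]
    have h1 : z ≠ f.u := by rintro rfl; exact hz huM'
    have h2 : z ≠ leaf := by rintro rfl; exact hz hlM'
    simp [h1, h2]
  constructor
  · intro y z c hc hyz hy
    by_cases he : s(y, z) = s(f.u, leaf)
    · rcases Sym2.eq_iff.1 he with ⟨-, rfl⟩ | ⟨-, rfl⟩
      · exact hlM'
      · exact huM'
    · rw [addColor_of_ne he] at hyz
      exact hcl2 y z c hc hyz hy
  -- The vertices of the two paths except their last ones are distinct, lie outside of `M`, have an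
  -- edge of color `α` or `β`, and now enter the closed set. They pay for the cost.
  · have hp : ((Finset.range ℓ).image p).card = ℓ := by
      rw [Finset.card_image_of_injOn, Finset.card_range]
      intro i hi j hj hij
      exact P.inj (by have := hi; simp at this; omega) (by have := hj; simp at this; omega) hij
    have hq : ((Finset.range ℓ').image q).card = ℓ' := by
      rw [Finset.card_image_of_injOn, Finset.card_range]
      intro i hi j hj hij
      exact Q.inj (by have := hi; simp at this; omega) (by have := hj; simp at this; omega) hij
    have hd1 : Disjoint ((Finset.range ℓ).image p) ((Finset.range ℓ').image q) := by
      rw [Finset.disjoint_left]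
      intro z hz hz'
      obtain ⟨i, hi, rfl⟩ := Finset.mem_image.1 hz
      obtain ⟨j, hj, hij⟩ := Finset.mem_image.1 hz'
      rw [Finset.mem_range] at hi hj
      exact hqM j (by omega) (Or.inr ⟨i, by omega, hij.symm⟩)
    set R := Finset.univ.filter fun z => z ∉ M ∪ prefixSet p (ℓ + 1) ∪ prefixSet q (ℓ' + 1) ∧
      ¬ (α ∈ (P.flip.addColor f.u leaf β hlG P.miss_start hlβ').miss z ∧
        β ∈ (P.flip.addColor f.u leaf β hlG P.miss_start hlβ').miss z) with hR
    have hd2 : Disjoint R ((Finset.range ℓ).image p ∪ (Finset.range ℓ').image q) := by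
      rw [Finset.disjoint_left]
      intro z hz hz'
      refine (Finset.mem_filter.1 hz).2.1 ?_
      rcases Finset.mem_union.1 hz' with h | h
      · obtain ⟨i, hi, rfl⟩ := Finset.mem_image.1 h
        rw [Finset.mem_range] at hi
        exact Or.inl (Or.inr ⟨i, by omega, rfl⟩)
      · obtain ⟨i, hi, rfl⟩ := Finset.mem_image.1 h
        rw [Finset.mem_range] at hi
        exact Or.inr ⟨i, by omega, rfl⟩
    have hsub : R ∪ ((Finset.range ℓ).image p ∪ (Finset.range ℓ').image q) ⊆
        Finset.univ.filter fun z => z ∉ M ∧ ¬ (α ∈ χ.miss z ∧ β ∈ χ.miss z) := by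
      intro z hz
      rw [Finset.mem_filter]
      refine ⟨Finset.mem_univ _, ?_⟩
      rcases Finset.mem_union.1 hz with h | h
      · obtain ⟨-, h1, h2⟩ := Finset.mem_filter.1 h
        rw [hmiss z h1] at h2
        exact ⟨fun h => h1 (Or.inl (Or.inl h)), h2⟩
      · rcases Finset.mem_union.1 h with h | h
        · obtain ⟨i, hi, rfl⟩ := Finset.mem_image.1 h
          rw [Finset.mem_range] at hi
          refine ⟨hpM i hi.le, ?_⟩
          have := not_mem_miss_left (P.joins i hi)
          rcases altColor_mem α β i with h | h <;> rw [h] at this <;> tauto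
        · obtain ⟨i, hi, rfl⟩ := Finset.mem_image.1 h
          rw [Finset.mem_range] at hi
          refine ⟨fun h => hqM i hi.le (Or.inl h), ?_⟩
          have := not_mem_miss_left (Q.joins i hi)
          rw [P.miss_flip_of_notMem fun h => hqM i hi.le (Or.inr h)] at this
          rcases altColor_mem β α i with h | h <;> rw [h] at this <;> tauto
    have := Finset.card_le_card hsub
    rw [Finset.card_union_of_disjoint hd2, Finset.card_union_of_disjoint hd1, hp, hq] at this
    unfold unvisited
    convert this
  · exact fun z hz => Or.inl (Or.inl hz)
  · exact huM'
  · exact hmiss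
  · exact hnone
  · exact hle
  · exact hln
  · have h1 : deadCount U (P.flip.addColor f.u leaf β hlG P.miss_start hlβ') ≤
        deadCount U P.flip + 3 := by
      -- The ends of the new edge lose the missing color `β`; the third pair is claimed by `f`
      -- itself, whose edge is no longer uncolored.
      refine (hU.deadCount_le_add {(f.u, β), (leaf, β), (f.u, f.α)} ?_).trans
        (Nat.add_le_add le_rfl Finset.card_le_three)
      intro g hg h2 h3
      by_cases hgf : g = f
      · subst hgf
        exact ⟨g.u, UFan.u_mem, by simp [UFan.assigned_u]⟩
      · obtain ⟨z, hz, h4, h5⟩ := UFan.exists_damaged h2 h3 fun e he => by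
          rw [addColor_of_ne]
          · exact h2.color_eq_none e he
          · rintro rfl
            exact Finset.disjoint_left.1 (hU.edge_disjoint g hg f hfU hgf) he hle
        rw [mem_miss_addColor hPn] at h5
        have : g.assigned z = β ∧ (z = f.u ∨ z = leaf) := by tauto
        refine ⟨z, hz, ?_⟩
        rw [this.1]
        rcases this.2 with rfl | rfl <;> simp
    have := P.deadCount_flip_le hU
    omega
  · refine ⟨{f.u, p ℓ, leaf, q ℓ'}, Finset.card_le_four, ?_⟩
    rintro z ((hz | ⟨i, hi, rfl⟩) | ⟨i, hi, rfl⟩) hzM hm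
    · exact absurd hz hzM
    · rcases P.end_of_mem_miss (i := i) (by omega) hm with h | h <;> subst h
      · simp [P.zero]
      · simp
    · rw [← P.miss_flip_of_notMem fun h => hqM i (by omega) (Or.inr h)] at hm
      rcases Q.end_of_mem_miss (i := i) (by omega) hm.symm with h | h <;> subst h
      · simp [Q.zero]
      · simp

/-- Some vertex of `f` lies in `M`. -/
def UFan.Touches (f : UFan V k) (M : Set V) : Prop := ∃ z ∈ f.verts, z ∈ M

namespace Completed

variable {M M' : Set V} {α β : Fin k} {f : UFan V k} {leaf : V} {χ' : PartialEdgeColoring G k}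
  {cost : ℕ}

/-- Missing colors change only inside `M'`, and the newly colored edge has its end `f.u` in `M'`. So
a ready u-fan can only be lost by being touched. -/
theorem isUFan_or_touches (h : Completed U χ M α β f leaf χ' M' cost) {g : UFan V k}
    (hg : (g.recolor α β).IsUFan χ ∨ g.Touches M) :
    (g.recolor α β).IsUFan χ' ∨ g.Touches M' := by
  rcases hg with hg | ⟨z, hz, hz'⟩
  · by_cases ht : g.Touches M'
    · exact Or.inr ht
    · refine Or.inl (hg.of_miss (fun e he => ?_) fun z hz => ?_)
      · rw [h.color_eq_none]
        refine ⟨hg.color_eq_none e he, ?_⟩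
        rintro rfl
        exact ht ⟨f.u, UFan.mem_verts_of_mem_edges (f := g.recolor α β) he (Sym2.mem_mk_left _ _),
          h.center_mem⟩
      · rw [h.miss_eq z fun hz' => ht ⟨z, hz, hz'⟩]
        exact hg.mem_miss hz
  · exact Or.inr ⟨z, hz, h.subset hz'⟩

-- A newly touched member was ready, so its touched vertex misses `α` or `β` and is one of the at
-- most four path ends; vertex-disjoint members need different ends.
open Classical in
theorem card_touches_le (h : Completed U χ M α β f leaf χ' M' cost) {L : Finset (UFan V k)}
    (hL : VertDisjoint L) (hL' : ∀ g ∈ L, (g.recolor α β).IsUFan χ ∨ g.Touches M) :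
    (L.filter fun g => g.Touches M').card ≤ (L.filter fun g => g.Touches M).card + 4 := by
  obtain ⟨Y, hY, hYz⟩ := h.ends
  have h1 : L.filter (fun g => g.Touches M') ⊆ L.filter (fun g => g.Touches M) ∪
      L.filter fun g => g.Touches M' ∧ ¬ g.Touches M := by
    intro g hg
    rw [Finset.mem_filter] at hg
    by_cases h : g.Touches M <;> simp [h, hg]
  refine (Finset.card_le_card h1).trans ((Finset.card_union_le _ _).trans ?_)
  refine Nat.add_le_add le_rfl (le_trans (hL.card_le (Finset.filter_subset _ _) Y ?_) hY)
  intro g hg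
  rw [Finset.mem_filter] at hg
  obtain ⟨hg1, ⟨z, hz, hz'⟩, hg3⟩ := hg
  have hgf := (hL' g hg1).resolve_right hg3
  refine ⟨z, hz, hYz z hz' (fun hzM => hg3 ⟨z, hz, hzM⟩) ?_⟩
  have := hgf.mem_miss (z := z) hz
  unfold UFan.assigned at this
  split at this
  · exact Or.inl this
  · exact Or.inr this

end Completed

end

/-! ### Representation of a coloring in memory, and the program that flips a path. -/

section

open PartialEdgeColoring

/-! ### The program -/

namespace RAM

/-- The index of the cell of the table that belongs to a vertex and a color. -/
def tabIdx (x c : ℕ) : Expr := .add (.mul (.reg x) (.reg 5)) (.reg c)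

/-- The table entry: the index (plus one) of the edge of a given color at a given vertex. -/
def tabAt (x c : ℕ) : Expr := .read 10 (tabIdx x c)

/-- Exchange the table entries of the vertex in register 23 for the colors in registers 24, 25. -/
def swapTab : List Prog :=
  [.assign 28 (tabAt 23 24), .write 10 (tabIdx 23 24) (tabAt 23 25),
    .write 10 (tabIdx 23 25) (.reg 28)]

/-- Recolor the next edge of an alternating path. -/
def flipStep : Prog := .block <|
  [.assign 27 (tabAt 23 26)] ++ swapTab ++
  [.write 11 (.reg 23) (.reg 29),
    .assign 26 (.sub (.add (.reg 24) (.reg 25)) (.reg 26)),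
    .write 2 (.sub (.reg 27) (.const 1)) (.reg 26),
    .assign 23 (.sub (.add (.read 0 (.sub (.reg 27) (.const 1)))
      (.read 1 (.sub (.reg 27) (.const 1)))) (.reg 23)),
    .assign 10 (.add (.reg 10) (.const 1))]

/-- Flip the maximal alternating path from the vertex in register 23, so that this vertex, which
misses one of the colors in registers 24 and 25, misses the color in register 25.  Afterwards,
register 23 holds the other end of the path.  The vertices of the path are stamped. -/
def makeMiss : Prog := .block
  [.assign 26 (.reg 25),
    -- The loop exchanges the table entries of each vertex that it leaves, so the last vertex
    -- remains for the final `swapTab`. For a path of length 0 nothing may be exchanged.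
    .ite (tabAt 23 26) (.seq (.loop (tabAt 23 26) flipStep) (.block swapTab)) .skip,
    .write 11 (.reg 23) (.reg 29)]

end RAM

/-! ### The representation of a coloring in the memory -/

/-- The `i`-th edge of the list. -/
def edgeAt {n : ℕ} (es : List (Fin n × Fin n)) (i : Fin es.length) : Sym2 (Fin n) :=
  s((es.get i).1, (es.get i).2)

/-- All numbers that the program computes fit into a word. -/
structure WordBounds (n k m w : ℕ) : Prop where
  word : 2 ^ 32 * (n + 1) ^ 4 ≤ 2 ^ w
  colors : k ≤ n
  edges : m ≤ n * n

variable {n k : ℕ} {G : SimpleGraph (Fin n)}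

/-- The part of the memory that does not change after the initialization. -/
structure Static (χ₀ : PartialEdgeColoring G k) (es : List (Fin n × Fin n))
    (fs : List (UFan (Fin n) k)) (S R B : ℕ) (s : RAM.State) : Prop where
  reg0 : s.reg 0 = n
  reg1 : s.reg 1 = es.length
  reg3 : s.reg 3 = fs.length
  reg4 : s.reg 4 = k
  reg5 : s.reg 5 = k + 1
  reg6 : s.reg 6 = S
  reg7 : s.reg 7 = R
  reg8 : s.reg 8 = B
  src : ∀ i : Fin es.length, s.mem 0 i = (es.get i).1
  dst : ∀ i : Fin es.length, s.mem 1 i = (es.get i).2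
  fan_u : ∀ i : Fin fs.length, s.mem 3 i = (fs.get i).u
  fan_v : ∀ i : Fin fs.length, s.mem 4 i = (fs.get i).v
  fan_w : ∀ i : Fin fs.length, s.mem 5 i = (fs.get i).w
  fan_a : ∀ i : Fin fs.length, s.mem 6 i = (fs.get i).α + 1
  fan_b : ∀ i : Fin fs.length, s.mem 7 i = (fs.get i).β + 1
  orig : ∀ i : Fin es.length, s.mem 8 i = colorCode (χ₀.color (edgeAt es i))
  adj : ∀ i : Fin es.length, s.mem 9 ((es.get i).1 * n + (es.get i).2) = i + 1 ∧
    s.mem 9 ((es.get i).2 * n + (es.get i).1) = i + 1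

theorem Static.of_eq {χ₀ : PartialEdgeColoring G k} {es : List (Fin n × Fin n)}
    {fs : List (UFan (Fin n) k)} {S R B : ℕ} {s s' : RAM.State} (h : Static χ₀ es fs S R B s)
    (hr : ∀ y < 9, s'.reg y = s.reg y) (hm : ∀ a < 10, a ≠ 2 → s'.mem a = s.mem a) :
    Static χ₀ es fs S R B s' := by
  constructor
  · rw [hr _ (by norm_num), h.reg0]
  · rw [hr _ (by norm_num), h.reg1]
  · rw [hr _ (by norm_num), h.reg3]
  · rw [hr _ (by norm_num), h.reg4]
  · rw [hr _ (by norm_num), h.reg5]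
  · rw [hr _ (by norm_num), h.reg6]
  · rw [hr _ (by norm_num), h.reg7]
  · rw [hr _ (by norm_num), h.reg8]
  all_goals rw [hm _ (by norm_num) (by norm_num)]
  · exact h.src
  · exact h.dst
  · exact h.fan_u
  · exact h.fan_v
  · exact h.fan_w
  · exact h.fan_a
  · exact h.fan_b
  · exact h.orig
  · exact h.adj

/-- The table entry `v` describes the edge of color `c` at `x`. -/
def TabEntry (es : List (Fin n × Fin n)) (χ : PartialEdgeColoring G k) (x : Fin n) (c : Fin k)
    (v : ℕ) : Prop :=
  (v = 0 ∧ c ∈ χ.miss x) ∨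
    ∃ i : Fin es.length, v = i + 1 ∧ x ∈ edgeAt es i ∧ χ.color (edgeAt es i) = some c

theorem TabEntry.eq_zero_iff {es : List (Fin n × Fin n)} {χ : PartialEdgeColoring G k} {x : Fin n}
    {c : Fin k} {v : ℕ} (h : TabEntry es χ x c v) : v = 0 ↔ c ∈ χ.miss x := by
  rcases h with ⟨h1, h2⟩ | ⟨i, h1, h2, h3⟩
  · simp [h1, h2]
  · constructor
    · omega
    · intro h; exact absurd h3 (h _ h2)

/-- The memory holds the coloring `χ`. -/
structure ColRep (es : List (Fin n × Fin n)) (χ : PartialEdgeColoring G k) (s : RAM.State) :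
    Prop where
  col : ∀ i : Fin es.length, s.mem 2 i = colorCode (χ.color (edgeAt es i))
  -- The cells with color code `0` are left unspecified, so that uncolored edges may be processed
  -- like colored ones and write there.
  tab : ∀ (x : Fin n) (c : Fin k), TabEntry es χ x c (s.mem 10 (x * (k + 1) + (c + 1)))

theorem tab_index_inj {x x' : Fin n} {c c' : Fin k}
    (h : (x : ℕ) * (k + 1) + (c + 1) = x' * (k + 1) + (c' + 1)) : x = x' ∧ c = c' := by
  have h1 := congrArg (· / (k + 1)) h
  have h2 := congrArg (· % (k + 1)) h
  have hc := c.isLt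
  have hc' := c'.isLt
  simp only [mul_comm _ (k + 1), Nat.mul_add_mod,
    Nat.mul_add_div (Nat.succ_pos k)] at h1 h2
  rw [Nat.mod_eq_of_lt (by omega), Nat.mod_eq_of_lt (by omega)] at h2
  rw [Nat.div_eq_of_lt (by omega), Nat.div_eq_of_lt (by omega)] at h1
  exact ⟨Fin.ext (by omega), Fin.ext (by omega)⟩

namespace WordBounds

variable {m w : ℕ} (h : WordBounds n k m w)

theorem one_mod (h : WordBounds n k m w) : 1 % 2 ^ w = 1 := by
  have := h.word
  exact Nat.mod_eq_of_lt (by nlinarith [Nat.one_le_pow 4 (n + 1) (by omega)])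

theorem lt_of_le (h : WordBounds n k m w) {v : ℕ} (hv : v ≤ 2 ^ 30 * ((n + 1) * (n + 1))) :
    v < 2 ^ w := by
  have := h.word
  have h1 : (n + 1) ^ 4 = ((n + 1) * (n + 1)) * ((n + 1) * (n + 1)) := by ring
  rw [h1] at this
  nlinarith [Nat.mul_pos (Nat.succ_pos n) (Nat.succ_pos n)]

theorem index_lt (h : WordBounds n k m w) {x c : ℕ} (hx : x < n) (hc : c ≤ k) :
    x * (k + 1) + c < 2 ^ w := by
  refine h.lt_of_le ?_
  have := h.colors
  have h1 : x * (k + 1) ≤ n * (n + 1) := Nat.mul_le_mul hx.le (by omega)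
  nlinarith

theorem adj_index_lt (h : WordBounds n k m w) {x y : ℕ} (hx : x < n) (hy : y < n) :
    x * n + y < 2 ^ w := by
  refine h.lt_of_le ?_
  have h1 : x * n ≤ n * n := Nat.mul_le_mul hx.le le_rfl
  nlinarith

theorem small_lt (h : WordBounds n k m w) {v : ℕ} (hv : v ≤ 2 * n + 2) : v < 2 ^ w := by
  refine h.lt_of_le ?_
  nlinarith

theorem eval_tabIdx (h : WordBounds n k m w) {s : RAM.State} {a b x c : ℕ} (ha : s.reg a = x)
    (hb : s.reg b = c) (h5 : s.reg 5 = k + 1) (hx : x < n) (hc : c ≤ k) :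
    (RAM.tabIdx a b).eval w s = x * (k + 1) + c := by
  have h1 := h.index_lt hx hc
  simp only [RAM.tabIdx, RAM.Expr.eval, ha, hb, h5]
  rw [Nat.mod_eq_of_lt (show x * (k + 1) < 2 ^ w by omega), Nat.mod_eq_of_lt h1]

end WordBounds

/-! ### Flipping a path in the memory -/

namespace PartialEdgeColoring

variable {V : Type*} {G : SimpleGraph V} {χ : PartialEdgeColoring G k} {a b : Fin k} {x : V}
  {p : ℕ → V} {ℓ : ℕ}

theorem prefixSet_succ_iff {N : ℕ} {z : V} :
    z ∈ prefixSet p (N + 1) ↔ z ∈ prefixSet p N ∨ z = p N := by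
  constructor
  · rintro ⟨i, hi, rfl⟩
    rcases Nat.lt_succ_iff_lt_or_eq.1 hi with h | rfl
    · exact Or.inl ⟨i, h, rfl⟩
    · exact Or.inr rfl
  · rintro (⟨i, hi, rfl⟩ | rfl)
    · exact ⟨i, by omega, rfl⟩
    · exact ⟨N, by omega, rfl⟩

theorem IsWalk.notMem_prefixSet (h : χ.IsWalk a b x p ℓ) {i : ℕ} (hi : i ≤ ℓ) :
    p i ∉ prefixSet p i := by
  rintro ⟨j, hj, hij⟩
  have := h.inj (by omega) hi hij
  omega

/-- Only the edge that leaves `p i` is recolored when `p i` joins the prefix: the other alternately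
colored edge at `p i` is the incoming one, which meets the shorter prefix already. -/
theorem IsWalk.flipColor_succ (h : χ.IsWalk a b x p ℓ) (h0 : 0 < ℓ) {i : ℕ} (hi : i ≤ ℓ)
    {e : Sym2 V} (he : p i ∈ e → χ.color e ≠ some (altColor a b i)) :
    χ.flipColor a b (prefixSet p (i + 1)) e = χ.flipColor a b (prefixSet p i) e := by
  by_cases h1 : ∃ z ∈ prefixSet p i, z ∈ e
  · obtain ⟨z, hz, hze⟩ := h1
    rw [flipColor_of_mem (prefixSet_succ_iff.2 (Or.inl hz)) hze, flipColor_of_mem hz hze]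
  · by_cases h2 : p i ∈ e
    · rw [flipColor_of_mem (prefixSet_succ_iff.2 (Or.inr rfl)) h2]
      rw [flipColor, if_neg h1]
      cases hc : χ.color e with
      | none => rfl
      | some c =>
        have h3 : c ≠ altColor a b i := fun h3 => he h2 (h3 ▸ hc)
        have h4 : c ≠ altColor a b (i + 1) := by
          rintro rfl
          obtain ⟨y, rfl⟩ := Sym2.mem_iff_exists.1 h2
          obtain ⟨h5, rfl⟩ := h.eq_prev hi (h.start h0) hc
          exact h1 ⟨_, ⟨i - 1, by omega, rfl⟩, Sym2.mem_mk_right _ _⟩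
        have h5 : c ≠ a ∧ c ≠ b := by
          unfold altColor at h3 h4
          rcases Nat.mod_two_eq_zero_or_one i with h | h
          · rw [if_pos h] at h3; rw [if_neg (by omega)] at h4; exact ⟨h4, h3⟩
          · rw [if_neg (by omega)] at h3; rw [if_pos (by omega)] at h4; exact ⟨h3, h4⟩
        simp [Equiv.swap_apply_of_ne_of_ne h5.1 h5.2]
    · rw [flipColor, flipColor, if_neg h1, if_neg]
      rintro ⟨z, hz, hze⟩
      rcases prefixSet_succ_iff.1 hz with h3 | rfl
      · exact h1 ⟨z, h3, hze⟩
      · exact h2 hze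

theorem IsWalk.flipColor_edge (h : χ.IsWalk a b x p ℓ) {i : ℕ} (hi : i < ℓ) :
    χ.flipColor a b (prefixSet p (i + 1)) s(p i, p (i + 1)) = some (altColor a b (i + 1)) := by
  rw [flipColor_of_mem (prefixSet_succ_iff.2 (Or.inr rfl)) (Sym2.mem_mk_left _ _), h.joins i hi,
    Option.map_some, swap_altColor]

end PartialEdgeColoring

open Classical in
/-- The memory state after the first `J` steps along an alternating path, started in `s₀`. -/
structure FlipInv (es : List (Fin n × Fin n)) (χ : PartialEdgeColoring G k) (a b : Fin k)
    (p : ℕ → Fin n) (s₀ : RAM.State) (J : ℕ) (s : RAM.State) : Prop where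
  reg_eq : ∀ y, y ∉ [10, 23, 26, 27, 28] → s.reg y = s₀.reg y
  mem_eq : ∀ y, y ∉ [2, 10, 11] → s.mem y = s₀.mem y
  cur : s.reg 23 = p J
  out : s.reg 26 = altColor a b J + 1
  bud : s.reg 10 = s₀.reg 10 + J
  stamp : ∀ z : Fin n, s.mem 11 z = if z ∈ prefixSet p J then s₀.reg 29 else s₀.mem 11 z
  col : ∀ i : Fin es.length, s.mem 2 i = colorCode (χ.flipColor a b (prefixSet p J) (edgeAt es i))
  tab : ∀ (x : Fin n) (c : Fin k), s.mem 10 (x * (k + 1) + (c + 1)) =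
    s₀.mem 10 (x * (k + 1) + ((if x ∈ prefixSet p J then Equiv.swap a b c else c : Fin k) + 1))

section

variable {es : List (Fin n × Fin n)} {χ₀ χ : PartialEdgeColoring G k} {fs : List (UFan (Fin n) k)}
  {S R B w : ℕ} {a b : Fin k} {p : ℕ → Fin n} {ℓ : ℕ} {x : Fin n} {s₀ : RAM.State}

/-- When `p J` is reached, the incoming edge already has its new color, but the table entries of `p
J` are still the old ones. So the entry for the outgoing color yields the outgoing edge and not the
one just recolored. -/
theorem FlipInv.step (hw : WordBounds n k es.length w) (hes : Function.Injective (edgeAt es))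
    (h0 : Static χ₀ es fs S R B s₀) (hχ : ColRep es χ s₀) (P : χ.IsPath a b x p ℓ)
    (ha : s₀.reg 24 = a + 1) (hb : s₀.reg 25 = b + 1) (hbud : s₀.reg 10 + ℓ < 2 ^ w)
    {J : ℕ} (hJ : J < ℓ) {s : RAM.State} (hs : FlipInv es χ a b p s₀ J s) :
    (RAM.tabAt 23 26).eval w s ≠ 0 ∧ FlipInv es χ a b p s₀ (J + 1) (RAM.flipStep.sem w s) := by
  have r5 : s.reg 5 = k + 1 := by rw [hs.reg_eq 5 (by simp), h0.reg5]
  have r24 : s.reg 24 = a + 1 := by rw [hs.reg_eq 24 (by simp), ha]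
  have r25 : s.reg 25 = b + 1 := by rw [hs.reg_eq 25 (by simp), hb]
  have hnp := P.toIsWalk.notMem_prefixSet hJ.le
  have htab : ∀ c : Fin k, s.mem 10 (p J * (k + 1) + (c + 1)) =
      s₀.mem 10 (p J * (k + 1) + (c + 1)) := fun c => by rw [hs.tab, if_neg hnp]
  have hjoin := P.joins J hJ
  obtain ⟨i, hi1, hi2, hi3⟩ : ∃ i : Fin es.length,
      s.mem 10 (p J * (k + 1) + (altColor a b J + 1)) = i + 1 ∧ p J ∈ edgeAt es i ∧
        χ.color (edgeAt es i) = some (altColor a b J) := by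
    rw [htab]
    rcases hχ.tab (p J) (altColor a b J) with h | h
    · exact absurd h.2 (not_mem_miss_left hjoin)
    · exact h
  have hie : edgeAt es i = s(p J, p (J + 1)) :=
    χ.proper _ _ _ (p J) hi2 (Sym2.mem_mk_left _ _) hi3 hjoin
  have hlt : ∀ c : Fin k, (p J : ℕ) * (k + 1) + (c + 1) < 2 ^ w := fun c =>
    hw.index_lt (p J).isLt c.isLt
  have m0 : (p J : ℕ) * (k + 1) % 2 ^ w = p J * (k + 1) :=
    Nat.mod_eq_of_lt (by have := hlt a; omega)
  have m1 : ∀ c : Fin k, ((p J : ℕ) * (k + 1) + (c + 1)) % 2 ^ w = p J * (k + 1) + (c + 1) :=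
    fun c => Nat.mod_eq_of_lt (hlt c)
  have r0 : ∀ j : Fin es.length, s.mem 0 j = (es.get j).1 := by
    rw [hs.mem_eq 0 (by simp)]; exact h0.src
  have r1 : ∀ j : Fin es.length, s.mem 1 j = (es.get j).2 := by
    rw [hs.mem_eq 1 (by simp)]; exact h0.dst
  have m2 : ((es.get i).1 + (es.get i).2 : ℕ) % 2 ^ w = (es.get i).1 + (es.get i).2 :=
    Nat.mod_eq_of_lt (hw.small_lt (by omega))
  have m3 : ((a : ℕ) + 1 + (b + 1)) % 2 ^ w = a + 1 + (b + 1) :=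
    Nat.mod_eq_of_lt (hw.small_lt (by have := hw.colors; omega))
  have m4 : (s.reg 10 + 1) % 2 ^ w = s.reg 10 + 1 :=
    Nat.mod_eq_of_lt (by rw [hs.bud]; omega)
  have r27 : s.mem 10 (p J * (k + 1) + (altColor a b J + 1)) - 1 = i := by omega
  have halt : (a : ℕ) + 1 + (b + 1) - (altColor a b J + 1) = altColor a b (J + 1) + 1 := by
    unfold altColor
    rcases Nat.mod_two_eq_zero_or_one J with h | h
    · rw [if_pos h, if_neg (by omega)]; omega
    · rw [if_neg (by omega), if_pos (by omega)]; omega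
  have hother : ((es.get i).1 + (es.get i).2 - p J : ℕ) = p (J + 1) := by
    rcases Sym2.eq_iff.1 hie with h | h <;> rw [h.1, h.2] <;> omega
  have hreg : ∀ y, (RAM.flipStep.sem w s).reg y = if y = 10 then s.reg 10 + 1 else
      if y = 23 then p (J + 1) else if y = 26 then altColor a b (J + 1) + 1 else
      if y = 27 then i + 1 else if y = 28 then s.mem 10 (p J * (k + 1) + (a + 1)) else s.reg y := by
    intro y
    simp only [RAM.flipStep, RAM.swapTab, List.cons_append, List.nil_append, RAM.Prog.block,
      RAM.Prog.sem, RAM.tabAt, RAM.tabIdx, RAM.Expr.eval, RAM.State.reg_setReg,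
      RAM.State.reg_setMem, RAM.State.mem_setReg, RAM.State.mem_setMem, hs.cur, r5, r24, r25, hs.out,
      m0, m1, hw.one_mod, Nat.reduceEqDiff, if_true, if_false, hi1, Nat.add_sub_cancel, r0, r1, m2,
      m3, m4, halt, hother]
    split_ifs <;> simp_all
  have hmem : (RAM.flipStep.sem w s).mem = fun y => if y = 2 then
      Function.update (s.mem 2) i (altColor a b (J + 1) + 1) else if y = 10 then
      Function.update (Function.update (s.mem 10) (p J * (k + 1) + (a + 1))
        (s.mem 10 (p J * (k + 1) + (b + 1)))) (p J * (k + 1) + (b + 1))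
        (s.mem 10 (p J * (k + 1) + (a + 1))) else if y = 11 then
      Function.update (s.mem 11) (p J) (s₀.reg 29) else s.mem y := by
    funext y
    simp only [RAM.flipStep, RAM.swapTab, List.cons_append, List.nil_append, RAM.Prog.block,
      RAM.Prog.sem, RAM.tabAt, RAM.tabIdx, RAM.Expr.eval, RAM.State.reg_setReg,
      RAM.State.reg_setMem, RAM.State.mem_setReg, RAM.State.mem_setMem, hs.cur, r5, r24, r25, hs.out,
      m0, m1, hw.one_mod, Nat.reduceEqDiff, if_true, if_false, hi1, Nat.add_sub_cancel, r0, r1, m2,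
      m3, m4, halt, hother]
    rw [hs.reg_eq 29 (by simp)]
    split_ifs <;> simp_all
  classical
  refine ⟨?_, ?_, ?_, ?_, ?_, ?_, ?_, ?_, ?_⟩
  · simp only [RAM.tabAt, RAM.tabIdx, RAM.Expr.eval, hs.cur, r5, hs.out, m0, m1, hi1]
    omega
  · intro y hy
    simp only [List.mem_cons, List.not_mem_nil, or_false, not_or] at hy
    rw [hreg, if_neg hy.1, if_neg hy.2.1, if_neg hy.2.2.1, if_neg hy.2.2.2.1, if_neg hy.2.2.2.2,
      hs.reg_eq y (by simp [hy])]
  · intro y hy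
    simp only [List.mem_cons, List.not_mem_nil, or_false, not_or] at hy
    rw [hmem]
    simp only [if_neg hy.1, if_neg hy.2.1, if_neg hy.2.2, hs.mem_eq y (by simp [hy])]
  · rw [hreg]; rfl
  · rw [hreg]; rfl
  · rw [hreg, if_pos rfl, hs.bud]; rfl
  · intro z
    rw [hmem]
    simp only [prefixSet_succ_iff]
    rw [if_neg (by norm_num), if_neg (by norm_num), if_pos trivial, Function.update_apply]
    by_cases hz : z = p J
    · simp [hz]
    · rw [if_neg (by rwa [Fin.val_inj]), hs.stamp]
      simp [hz]
  · intro j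
    rw [hmem]
    simp only [if_true]
    by_cases hj : j = i
    · rw [hj, Function.update_self, hie, P.toIsWalk.flipColor_edge hJ]; rfl
    · rw [Function.update_of_ne (by rwa [ne_eq, Fin.val_inj]), hs.col,
        P.toIsWalk.flipColor_succ (by omega) hJ.le]
      intro h1 h2
      have h3 := χ.proper _ _ _ (p J) h1 hi2 h2 hi3
      exact hj (hes h3)
  · intro y c
    rw [hmem]
    simp only [prefixSet_succ_iff]
    rw [if_neg (by norm_num), if_pos trivial]
    by_cases hy : y = p J
    · subst hy
      simp only [or_true, if_true]
      by_cases hb' : c = b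
      · subst hb'
        rw [Function.update_self, htab, Equiv.swap_apply_right]
      · rw [Function.update_of_ne (fun h => hb' (tab_index_inj h).2)]
        by_cases ha' : c = a
        · subst ha'
          rw [Function.update_self, htab, Equiv.swap_apply_left]
        · rw [Function.update_of_ne (fun h => ha' (tab_index_inj h).2), htab,
            Equiv.swap_apply_of_ne_of_ne ha' hb']
    · rw [Function.update_of_ne (fun h => hy (tab_index_inj h).1),
        Function.update_of_ne (fun h => hy (tab_index_inj h).1), hs.tab]
      simp [hy]

theorem flipLoop_spec (hw : WordBounds n k es.length w) (hes : Function.Injective (edgeAt es))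
    (h0 : Static χ₀ es fs S R B s₀) (hχ : ColRep es χ s₀) (P : χ.IsPath a b x p ℓ)
    (ha : s₀.reg 24 = a + 1) (hb : s₀.reg 25 = b + 1) (hbud : s₀.reg 10 + ℓ < 2 ^ w)
    (hx : s₀.reg 23 = x) (hc : s₀.reg 26 = b + 1) :
    ∃ s, FlipInv es χ a b p s₀ ℓ s ∧
      RAM.ExecLe w (.loop (RAM.tabAt 23 26) RAM.flipStep) s₀ s (ℓ * 20 + 1) := by
  classical
  refine RAM.ExecLe.loop_count (T := 19) ℓ (FlipInv es χ a b p s₀) ?_ ?_ ?_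
  · intro J hJ s hs
    obtain ⟨h1, h2⟩ := hs.step hw hes h0 hχ P ha hb hbud hJ
    refine ⟨h1, _, h2, RAM.ExecLe.mono (RAM.ExecLe.straight w ?_ s) ?_⟩
    · simp [RAM.flipStep, RAM.swapTab, RAM.Prog.block, RAM.Prog.Straight]
    · simp [RAM.flipStep, RAM.swapTab, RAM.Prog.block, RAM.Prog.len]
  · intro s hs
    have r5 : s.reg 5 = k + 1 := by rw [hs.reg_eq 5 (by simp), h0.reg5]
    rw [RAM.tabAt, RAM.Expr.eval,
      hw.eval_tabIdx hs.cur hs.out r5 (p ℓ).isLt (altColor a b ℓ).isLt, hs.tab,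
      if_neg (P.toIsWalk.notMem_prefixSet le_rfl), (hχ.tab _ _).eq_zero_iff]
    exact P.terminal
  · have hno : ∀ z, z ∉ prefixSet p 0 := by rintro z ⟨i, hi, -⟩; omega
    refine ⟨fun _ _ => rfl, fun _ _ => rfl, ?_, ?_, rfl, ?_, ?_, ?_⟩
    · rw [hx, P.zero]
    · rw [hc]; rfl
    · intro z; rw [if_neg (hno z)]
    · intro i; rw [hχ.col, flipColor, if_neg]; rintro ⟨z, hz, -⟩; exact hno z hz
    · intro x c; rw [if_neg (hno x)]

/-- What the program `makeMiss` does to the memory. -/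
structure MadeMiss (es : List (Fin n × Fin n)) (χ' : PartialEdgeColoring G k)
    (p : ℕ → Fin n) (ℓ : ℕ) (s₀ s : RAM.State) : Prop where
  reg_eq : ∀ y, y ∉ [10, 23, 26, 27, 28] → s.reg y = s₀.reg y
  mem_eq : ∀ y, y ∉ [2, 10, 11] → s.mem y = s₀.mem y
  cur : s.reg 23 = p ℓ
  bud : s.reg 10 = s₀.reg 10 + ℓ
  stamp_of_mem : ∀ z : Fin n, z ∈ prefixSet p (ℓ + 1) → s.mem 11 z = s₀.reg 29
  stamp_of_notMem : ∀ z : Fin n, z ∉ prefixSet p (ℓ + 1) → s.mem 11 z = s₀.mem 11 z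
  rep : ColRep es χ' s

theorem makeMiss_spec (hw : WordBounds n k es.length w) (hes : Function.Injective (edgeAt es))
    (h0 : Static χ₀ es fs S R B s₀) (hχ : ColRep es χ s₀) (P : χ.IsPath a b x p ℓ)
    (ha : s₀.reg 24 = a + 1) (hb : s₀.reg 25 = b + 1) (hbud : s₀.reg 10 + ℓ < 2 ^ w)
    (hx : s₀.reg 23 = x) :
    ∃ s, MadeMiss es P.flip p ℓ s₀ s ∧ RAM.ExecLe w RAM.makeMiss s₀ s (ℓ * 20 + 15) := by
  classical
  set s₁ := s₀.setReg 26 (s₀.reg 25) with hs₁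
  have e1 : RAM.ExecLe w (.assign 26 (.reg 25)) s₀ s₁ 1 := ⟨1, le_rfl, .assign _ _ _⟩
  have hreg1 : ∀ y, y ≠ 26 → s₁.reg y = s₀.reg y := fun y hy => by
    rw [hs₁, RAM.State.reg_setReg, if_neg hy]
  have h26 : s₁.reg 26 = b + 1 := by rw [hs₁, RAM.State.reg_setReg, if_pos rfl, hb]
  have h01 : Static χ₀ es fs S R B s₁ := h0.of_eq (fun y hy => hreg1 y (by omega)) fun _ _ _ => rfl
  have hχ1 : ColRep es χ s₁ := ⟨hχ.col, hχ.tab⟩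
  have hx1 : s₁.reg 23 = x := by rw [hreg1 _ (by norm_num), hx]
  have htest : (RAM.tabAt 23 26).eval w s₁ = s₁.mem 10 (x * (k + 1) + (b + 1)) := by
    rw [RAM.tabAt, RAM.Expr.eval, hw.eval_tabIdx hx1 h26 h01.reg5 x.isLt b.isLt]
  rcases Nat.eq_zero_or_pos ℓ with hℓ | hℓ
  · have hbx : b ∈ χ.miss x := by
      have := P.terminal
      subst hℓ
      rwa [P.zero] at this
    have hp : ∀ z, z ∈ prefixSet p (ℓ + 1) ↔ z = x := by
      intro z
      subst hℓ
      rw [prefixSet_succ_iff, P.zero]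
      constructor
      · rintro (⟨i, hi, -⟩ | h)
        · omega
        · exact h
      · exact Or.inr
    have e2 : RAM.ExecLe w (.ite (RAM.tabAt 23 26)
        (.seq (.loop (RAM.tabAt 23 26) RAM.flipStep) (.block RAM.swapTab)) .skip) s₁ s₁ 2 :=
      RAM.ExecLe.ite_false (by rw [htest]; exact (hχ1.tab x b).eq_zero_iff.2 hbx)
        ⟨1, le_rfl, .skip _⟩
    have e3 : RAM.ExecLe w (.write 11 (.reg 23) (.reg 29)) s₁
        (s₁.setMem 11 (s₁.reg 23) (s₁.reg 29)) 1 := ⟨1, le_rfl, .write _ _ _ _⟩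
    refine ⟨_, ?_, (e1.seq (e2.seq e3)).mono (by omega)⟩
    refine ⟨?_, ?_, ?_, ?_, ?_, ?_, ?_⟩
    · intro y hy
      simp only [List.mem_cons, List.not_mem_nil, or_false, not_or] at hy
      exact hreg1 y (by tauto)
    · intro y hy
      simp only [List.mem_cons, List.not_mem_nil, or_false, not_or] at hy
      rw [RAM.State.mem_setMem, if_neg (by tauto)]; rfl
    · rw [hℓ, P.zero]; exact hx1
    · rw [hℓ]; exact hreg1 10 (by norm_num)
    · intro z hz
      rw [RAM.State.mem_setMem, if_pos rfl, hx1, (hp z).1 hz, Function.update_self,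
        hreg1 _ (by norm_num)]
    · intro z hz
      rw [RAM.State.mem_setMem, if_pos rfl, hx1, Function.update_of_ne]
      · rfl
      · rw [ne_eq, Fin.val_inj]; exact fun h => hz ((hp z).2 h)
    · rw [P.flip_of_zero hℓ]
      constructor
      · rw [RAM.State.mem_setMem, if_neg (by norm_num)]; exact hχ1.col
      · rw [RAM.State.mem_setMem, if_neg (by norm_num)]; exact hχ1.tab
  · obtain ⟨s₂, hs₂, e2⟩ := flipLoop_spec hw hes h01 hχ1 P (by rw [hreg1 _ (by norm_num), ha])
      (by rw [hreg1 _ (by norm_num), hb]) (by rw [hreg1 _ (by norm_num)]; exact hbud) hx1 h26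
    have hbx : b ∉ χ.miss x := by
      have := not_mem_miss_left (P.joins 0 hℓ)
      rwa [P.zero] at this
    have e3 : RAM.ExecLe w (.block RAM.swapTab) s₂ ((RAM.Prog.block RAM.swapTab).sem w s₂) 5 :=
      RAM.ExecLe.straight w (by simp [RAM.swapTab, RAM.Prog.block, RAM.Prog.Straight]) s₂
    set s₃ := (RAM.Prog.block RAM.swapTab).sem w s₂ with hs₃
    have e4 : RAM.ExecLe w (.write 11 (.reg 23) (.reg 29)) s₃
        (s₃.setMem 11 (s₃.reg 23) (s₃.reg 29)) 1 := ⟨1, le_rfl, .write _ _ _ _⟩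
    have e23 := RAM.ExecLe.ite_true (q := .skip) (e := RAM.tabAt 23 26)
      (by rw [htest, ne_eq, (hχ1.tab x b).eq_zero_iff]; exact hbx) (e2.seq e3)
    have r5 : s₂.reg 5 = k + 1 := by rw [hs₂.reg_eq 5 (by simp), h01.reg5]
    have r24 : s₂.reg 24 = a + 1 := by
      rw [hs₂.reg_eq 24 (by simp), hreg1 _ (by norm_num), ha]
    have r25 : s₂.reg 25 = b + 1 := by
      rw [hs₂.reg_eq 25 (by simp), hreg1 _ (by norm_num), hb]
    have hlt : ∀ c : Fin k, (p ℓ : ℕ) * (k + 1) + (c + 1) < 2 ^ w := fun c =>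
      hw.index_lt (p ℓ).isLt c.isLt
    have m0 : (p ℓ : ℕ) * (k + 1) % 2 ^ w = p ℓ * (k + 1) :=
      Nat.mod_eq_of_lt (by have := hlt a; omega)
    have m1 : ∀ c : Fin k, ((p ℓ : ℕ) * (k + 1) + (c + 1)) % 2 ^ w = p ℓ * (k + 1) + (c + 1) :=
      fun c => Nat.mod_eq_of_lt (hlt c)
    have hreg3 : ∀ y, y ≠ 28 → s₃.reg y = s₂.reg y := by
      intro y hy
      simp only [hs₃, RAM.swapTab, RAM.Prog.block, RAM.Prog.sem, RAM.State.reg_setReg,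
        RAM.State.reg_setMem, if_neg hy]
    have hmem3 : s₃.mem = fun y => if y = 10 then
        Function.update (Function.update (s₂.mem 10) (p ℓ * (k + 1) + (a + 1))
          (s₂.mem 10 (p ℓ * (k + 1) + (b + 1)))) (p ℓ * (k + 1) + (b + 1))
          (s₂.mem 10 (p ℓ * (k + 1) + (a + 1))) else s₂.mem y := by
      funext y
      simp only [hs₃, RAM.swapTab, RAM.Prog.block, RAM.Prog.sem, RAM.State.reg_setReg,
        RAM.State.reg_setMem, RAM.State.mem_setReg, RAM.State.mem_setMem, RAM.tabAt, RAM.tabIdx,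
        RAM.Expr.eval, hs₂.cur, r5, r24, r25, m0, m1, Nat.reduceEqDiff, if_true, if_false]
      split_ifs <;> simp_all
    have hnp := P.toIsWalk.notMem_prefixSet le_rfl
    have htab : ∀ c : Fin k, s₂.mem 10 (p ℓ * (k + 1) + (c + 1)) =
        s₁.mem 10 (p ℓ * (k + 1) + (c + 1)) := fun c => by rw [hs₂.tab, if_neg hnp]
    have htab3 : ∀ (y : Fin n) (c : Fin k), s₃.mem 10 (y * (k + 1) + (c + 1)) =
        s₁.mem 10 (y * (k + 1) + ((if y ∈ prefixSet p (ℓ + 1) then Equiv.swap a b c else c :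
          Fin k) + 1)) := by
      intro y c
      rw [hmem3]
      simp only [prefixSet_succ_iff]
      rw [if_pos trivial]
      by_cases hy : y = p ℓ
      · subst hy
        simp only [or_true, if_true]
        by_cases hb' : c = b
        · subst hb'
          rw [Function.update_self, htab, Equiv.swap_apply_right]
        · rw [Function.update_of_ne (fun h => hb' (tab_index_inj h).2)]
          by_cases ha' : c = a
          · subst ha'
            rw [Function.update_self, htab, Equiv.swap_apply_left]
          · rw [Function.update_of_ne (fun h => ha' (tab_index_inj h).2), htab,
              Equiv.swap_apply_of_ne_of_ne ha' hb']
      · rw [Function.update_of_ne (fun h => hy (tab_index_inj h).1),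
          Function.update_of_ne (fun h => hy (tab_index_inj h).1), hs₂.tab]
        simp [hy]
    have h29 : s₃.reg 29 = s₀.reg 29 := by
      rw [hreg3 _ (by norm_num), hs₂.reg_eq 29 (by simp), hreg1 _ (by norm_num)]
    have h23 : s₃.reg 23 = p ℓ := by rw [hreg3 _ (by norm_num), hs₂.cur]
    refine ⟨_, ?_, (e1.seq (e23.seq e4)).mono (by omega)⟩
    refine ⟨?_, ?_, ?_, ?_, ?_, ?_, ?_⟩
    · intro y hy
      have hy' := hy
      simp only [List.mem_cons, List.not_mem_nil, or_false, not_or] at hy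
      rw [RAM.State.reg_setMem, hreg3 y (by tauto), hs₂.reg_eq y hy', hreg1 y (by tauto)]
    · intro y hy
      have hy' := hy
      simp only [List.mem_cons, List.not_mem_nil, or_false, not_or] at hy
      rw [RAM.State.mem_setMem, if_neg (by tauto), hmem3]
      simp only [if_neg hy.2.1, hs₂.mem_eq y hy']
      rfl
    · exact h23
    · rw [RAM.State.reg_setMem, hreg3 _ (by norm_num), hs₂.bud, hreg1 _ (by norm_num)]
    · intro z hz
      rw [RAM.State.mem_setMem, if_pos rfl, h23, h29, Function.update_apply]
      split
      · rfl
      · rename_i hne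
        rw [Fin.val_inj] at hne
        have hz' := (prefixSet_succ_iff.1 hz).resolve_right hne
        rw [hmem3]
        simp only [Nat.reduceEqDiff, if_false]
        rw [hs₂.stamp, if_pos hz', hreg1 _ (by norm_num)]
    · intro z hz
      rw [prefixSet_succ_iff, not_or] at hz
      rw [RAM.State.mem_setMem, if_pos rfl, h23, Function.update_of_ne (by
        rw [ne_eq, Fin.val_inj]; exact hz.2), hmem3]
      simp only [Nat.reduceEqDiff, if_false]
      rw [hs₂.stamp, if_neg hz.1]
      rfl
    · constructor
      · intro i
        rw [RAM.State.mem_setMem, if_neg (by norm_num), hmem3]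
        simp only [Nat.reduceEqDiff, if_false]
        -- Adding the last vertex to the prefix recolors no edge, as this vertex misses the color
        -- with which the path would continue.
        rw [hs₂.col, P.color_flip hℓ, P.toIsWalk.flipColor_succ hℓ le_rfl]
        intro h1 h2
        exact P.terminal _ h1 h2
      · intro y c
        rw [RAM.State.mem_setMem, if_neg (by norm_num), htab3]
        by_cases hy : y ∈ prefixSet p (ℓ + 1)
        · rw [if_pos hy]
          rcases hχ1.tab y (Equiv.swap a b c) with ⟨h1, h2⟩ | ⟨i, h1, h2, h3⟩
          · exact Or.inl ⟨h1, (P.mem_miss_flip hℓ hy).2 h2⟩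
          · refine Or.inr ⟨i, h1, h2, ?_⟩
            rw [P.color_flip hℓ, flipColor_of_mem hy h2, h3]
            simp
        · rw [if_neg hy]
          rcases hχ1.tab y c with ⟨h1, h2⟩ | ⟨i, h1, h2, h3⟩
          · exact Or.inl ⟨h1, by rwa [P.miss_flip_of_notMem hy]⟩
          · exact Or.inr ⟨i, h1, h2, by rwa [P.color_flip_of_notMem hy h2]⟩

end

end

/-! ### Processing a random u-fan: the first part of a round. -/

section

open PartialEdgeColoring

namespace RAM

/-- Call `makeMiss` for the vertex in register `x` and the colors in registers `a` and `b`. -/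
def callMiss (x a b : ℕ) : Prog := .seq
  (.block [.assign 23 (.reg x), .assign 24 (.reg a), .assign 25 (.reg b)]) makeMiss

/-- The index of the cell of the adjacency table that belongs to two vertices. -/
def adjIdx (x y : ℕ) : Expr := .add (.mul (.reg x) (.reg 0)) (.reg y)

/-- The color of the edge between two vertices. -/
def colOf (x y : ℕ) : Expr := .read 2 (.sub (.read 9 (adjIdx x y)) (.const 1))

def ne (e f : Expr) : Expr := .sub (.const 1) (.eq e f)

/-- Test whether registers 18 to 22 hold a u-fan. -/
def checkFan : List Expr :=
  [.eq (tabAt 18 21) (.const 0), .eq (tabAt 19 22) (.const 0), .eq (tabAt 20 22) (.const 0),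
    .eq (colOf 18 19) (.const 0), .eq (colOf 18 20) (.const 0)]

/-- Test whether the vertices in registers 18 to 20 have no current stamp in the array `a`. -/
def checkFresh (a : ℕ) : List Expr :=
  [ne (.read a (.reg 18)) (.reg 11), ne (.read a (.reg 19)) (.reg 11),
    ne (.read a (.reg 20)) (.reg 11)]

/-- Load the vertices of the u-fan with the index in register 17. -/
def loadVerts : List Prog :=
  [.assign 18 (.read 3 (.reg 17)), .assign 19 (.read 4 (.reg 17)), .assign 20 (.read 5 (.reg 17))]

/-- Register the u-fan in registers 17 to 20 as a converted one. -/
def register : Prog := .block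
  [.write 12 (.reg 18) (.reg 11), .write 12 (.reg 19) (.reg 11), .write 12 (.reg 20) (.reg 11),
    .write 13 (.reg 15) (.reg 17), .assign 15 (.add (.reg 15) (.const 1))]

/-- Give the colors in registers 12 and 13 to the u-fan in registers 18 to 22. -/
def convert : Prog := .seq (.assign 29 (.const 0)) <| .seq (callMiss 18 21 12) <|
  .seq (callMiss 19 22 13) <| .seq (callMiss 20 22 13) register

/-- Process the u-fan with the index in register 17. -/
def sample : Prog := .seq
  (.block (loadVerts ++ [.assign 21 (.read 6 (.reg 17)), .assign 22 (.read 7 (.reg 17))]))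
  (.guards (checkFan ++ ([ne (.reg 21) (.reg 13), ne (.reg 22) (.reg 12)] ++ checkFresh 12))
    convert)

end RAM

variable {n k : ℕ} {G : SimpleGraph (Fin n)}

section

variable {es : List (Fin n × Fin n)} {χ₀ χ : PartialEdgeColoring G k} {fs : List (UFan (Fin n) k)}
  {S R B w : ℕ} {a b : Fin k} {p : ℕ → Fin n} {ℓ : ℕ} {x : Fin n} {s₀ : RAM.State}

/-- What `callMiss` does to the memory. -/
structure Called (es : List (Fin n × Fin n)) (χ' : PartialEdgeColoring G k)
    (p : ℕ → Fin n) (ℓ : ℕ) (s₀ s : RAM.State) : Prop where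
  reg_eq : ∀ y, y ∉ [10, 23, 24, 25, 26, 27, 28] → s.reg y = s₀.reg y
  mem_eq : ∀ y, y ∉ [2, 10, 11] → s.mem y = s₀.mem y
  cur : s.reg 23 = p ℓ
  bud : s.reg 10 = s₀.reg 10 + ℓ
  stamp_of_mem : ∀ z : Fin n, z ∈ prefixSet p (ℓ + 1) → s.mem 11 z = s₀.reg 29
  stamp_of_notMem : ∀ z : Fin n, z ∉ prefixSet p (ℓ + 1) → s.mem 11 z = s₀.mem 11 z
  rep : ColRep es χ' s

theorem Called.static {χ' : PartialEdgeColoring G k} {s : RAM.State} (h : Called es χ' p ℓ s₀ s)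
    (h0 : Static χ₀ es fs S R B s₀) : Static χ₀ es fs S R B s :=
  h0.of_eq (fun y hy => h.reg_eq y (by simp; omega)) fun a ha ha' => h.mem_eq a (by simp; omega)

theorem callMiss_spec (hw : WordBounds n k es.length w) (hes : Function.Injective (edgeAt es))
    (h0 : Static χ₀ es fs S R B s₀) (hχ : ColRep es χ s₀) (P : χ.IsPath a b x p ℓ) {x' a' b' : ℕ}
    (hx : s₀.reg x' = x) (ha : s₀.reg a' = a + 1) (hb : s₀.reg b' = b + 1) (ha' : a' ≠ 23)
    (hb' : b' ≠ 23 ∧ b' ≠ 24) (hbud : s₀.reg 10 + ℓ < 2 ^ w) :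
    ∃ s, Called es P.flip p ℓ s₀ s ∧ RAM.ExecLe w (RAM.callMiss x' a' b') s₀ s (ℓ * 20 + 21) := by
  set s₁ := (RAM.Prog.block [.assign 23 (.reg x'), .assign 24 (.reg a'), .assign 25 (.reg b')]).sem
    w s₀ with hs₁
  have e1 := RAM.ExecLe.straight w (p := .block [.assign 23 (.reg x'), .assign 24 (.reg a'),
    .assign 25 (.reg b')]) (by simp [RAM.Prog.block, RAM.Prog.Straight]) s₀
  rw [← hs₁] at e1
  have hreg : ∀ y, s₁.reg y = if y = 25 then (b + 1 : ℕ) else if y = 24 then (a + 1 : ℕ) else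
      if y = 23 then (x : ℕ) else s₀.reg y := by
    intro y
    simp only [hs₁, RAM.Prog.block, RAM.Prog.sem, RAM.State.reg_setReg, RAM.Expr.eval, if_neg ha',
      if_neg hb'.1, if_neg hb'.2, hx, ha, hb]
  have hmem : s₁.mem = s₀.mem := rfl
  obtain ⟨s, hs, e2⟩ := makeMiss_spec (s₀ := s₁) hw hes
    (h0.of_eq (fun y hy => by rw [hreg, if_neg, if_neg, if_neg] <;> omega) fun _ _ _ => rfl)
    ⟨hχ.col, hχ.tab⟩ P (by rw [hreg]; rfl) (by rw [hreg]; rfl) (by rw [hreg]; exact hbud)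
    (by rw [hreg]; rfl)
  refine ⟨s, ⟨?_, ?_, hs.cur, ?_, ?_, ?_, hs.rep⟩, (e1.seq e2).mono ?_⟩
  · intro y hy
    simp only [List.mem_cons, List.not_mem_nil, or_false, not_or] at hy
    rw [hs.reg_eq y (by simp [hy]), hreg, if_neg (by tauto), if_neg (by tauto), if_neg (by tauto)]
  · intro y hy; rw [hs.mem_eq y hy, hmem]
  · rw [hs.bud, hreg]; rfl
  · intro z hz; rw [hs.stamp_of_mem z hz, hreg]; rfl
  · intro z hz; rw [hs.stamp_of_notMem z hz, hmem]
  · simp [RAM.Prog.block, RAM.Prog.len]; omega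

/-- Every edge has an entry in the adjacency table. -/
theorem Static.adj_of_edge (h : Static χ₀ es fs S R B s₀) {i : Fin es.length} {u v : Fin n}
    (hi : edgeAt es i = s(u, v)) : s₀.mem 9 (u * n + v) = i + 1 := by
  obtain ⟨h1, h2⟩ := h.adj i
  rcases Sym2.eq_iff.1 hi with ⟨rfl, rfl⟩ | ⟨rfl, rfl⟩
  · exact h1
  · exact h2

/-- The registers 18 to 22 hold `f`. -/
structure Loaded (f : UFan (Fin n) k) (s : RAM.State) : Prop where
  u : s.reg 18 = f.u
  v : s.reg 19 = f.v
  w : s.reg 20 = f.w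
  a : s.reg 21 = f.α + 1
  b : s.reg 22 = f.β + 1

theorem colOf_eval (hw : WordBounds n k es.length w) (h0 : Static χ₀ es fs S R B s₀)
    (hχ : ColRep es χ s₀) {i : Fin es.length} {u v : Fin n} {x y : ℕ} (hx : s₀.reg x = u)
    (hy : s₀.reg y = v) (hi : edgeAt es i = s(u, v)) :
    (RAM.colOf x y).eval w s₀ = colorCode (χ.color s(u, v)) := by
  have h1 := hw.adj_index_lt u.isLt v.isLt
  simp only [RAM.colOf, RAM.adjIdx, RAM.Expr.eval, hx, hy, h0.reg0, hw.one_mod]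
  rw [Nat.mod_eq_of_lt (show (u : ℕ) * n < 2 ^ w by omega), Nat.mod_eq_of_lt h1,
    h0.adj_of_edge hi, Nat.add_sub_cancel, hχ.col, hi]

theorem colorCode_eq_zero {c : Option (Fin k)} : colorCode c = 0 ↔ c = none := by
  cases c <;> simp [colorCode]

theorem tabAt_eval (hw : WordBounds n k es.length w) (h0 : Static χ₀ es fs S R B s₀)
    {x : Fin n} {c : Fin k} {i j : ℕ} (hx : s₀.reg i = x) (hc : s₀.reg j = c + 1) :
    (RAM.tabAt i j).eval w s₀ = s₀.mem 10 (x * (k + 1) + (c + 1)) := by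
  rw [RAM.tabAt, RAM.Expr.eval, hw.eval_tabIdx hx hc h0.reg5 x.isLt c.isLt]

theorem eval_eq_zero_ne_zero (hw : WordBounds n k es.length w) {e : RAM.Expr} {s : RAM.State} :
    (RAM.Expr.eq e (.const 0)).eval w s ≠ 0 ↔ e.eval w s = 0 := by
  simp only [RAM.Expr.eval, Nat.zero_mod, hw.one_mod]
  split <;> simp_all

theorem eval_ne_ne_zero (hw : WordBounds n k es.length w) {e f : RAM.Expr} {s : RAM.State} :
    (RAM.ne e f).eval w s ≠ 0 ↔ e.eval w s ≠ f.eval w s := by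
  simp only [RAM.ne, RAM.Expr.eval, hw.one_mod]
  split <;> simp_all

/-- The program tests colors only. Distinctness of the vertices and the existence of the two edges,
without which the adjacency table would be read at meaningless cells, come from some coloring in
which the same vertices form a u-fan. -/
theorem checkFan_iff (hw : WordBounds n k es.length w) (hG : ∀ e ∈ G.edgeSet, ∃ i, edgeAt es i = e)
    (h0 : Static χ₀ es fs S R B s₀) (hχ : ColRep es χ s₀) {f : UFan (Fin n) k} (hf : Loaded f s₀)
    {χ₁ : PartialEdgeColoring G k} {a b : Fin k} (hf' : (f.recolor a b).IsUFan χ₁)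
    (hne : f.α ≠ f.β) :
    (∀ e ∈ RAM.checkFan, e.eval w s₀ ≠ 0) ↔ f.IsUFan χ := by
  have e1 : s(f.u, f.v) ∈ G.edgeSet := hf'.edge_uv
  have e2 : s(f.u, f.w) ∈ G.edgeSet := hf'.edge_uw
  obtain ⟨i, hi⟩ := hG _ e1
  obtain ⟨j, hj⟩ := hG _ e2
  simp only [RAM.checkFan, List.forall_mem_cons, eval_eq_zero_ne_zero hw,
    tabAt_eval hw h0 hf.u hf.a, tabAt_eval hw h0 hf.v hf.b, tabAt_eval hw h0 hf.w hf.b,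
    colOf_eval hw h0 hχ hf.u hf.v hi, colOf_eval hw h0 hχ hf.u hf.w hj,
    (hχ.tab _ _).eq_zero_iff, colorCode_eq_zero]
  constructor
  · rintro ⟨h1, h2, h3, h4, h5, -⟩
    exact ⟨hf'.u_ne_v, hf'.u_ne_w, hf'.v_ne_w, hne, e1, e2, h4, h5, h1, h2, h3⟩
  · intro h
    exact ⟨h.miss_u, h.miss_v, h.miss_w, h.uncolored_uv, h.uncolored_uw, by simp⟩

theorem checkFresh_iff (hw : WordBounds n k es.length w) {f : UFan (Fin n) k}
    (hu : s₀.reg 18 = f.u) (hv : s₀.reg 19 = f.v) (hw' : s₀.reg 20 = f.w) {a r : ℕ}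
    (hr : s₀.reg 11 = r) :
    (∀ e ∈ RAM.checkFresh a, e.eval w s₀ ≠ 0) ↔ ∀ z ∈ f.verts, s₀.mem a z ≠ r := by
  simp only [RAM.checkFresh, List.forall_mem_cons, eval_ne_ne_zero hw, RAM.Expr.eval, hu, hv, hw',
    hr, UFan.verts, Finset.forall_mem_insert, Finset.mem_singleton, forall_eq]
  simp

/-- The members of the list with the given indices. -/
def fanSet (fs : List (UFan (Fin n) k)) (l : List (Fin fs.length)) : Finset (UFan (Fin n) k) :=
  (l.map fs.get).toFinset

theorem mem_fanSet {l : List (Fin fs.length)} {f : UFan (Fin n) k} :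
    f ∈ fanSet fs l ↔ ∃ i ∈ l, fs.get i = f := by simp [fanSet]

theorem fanSet_append (l : List (Fin fs.length)) (i : Fin fs.length) :
    fanSet fs (l ++ [i]) = insert (fs.get i) (fanSet fs l) := by
  ext f; simp [fanSet, eq_comm]

/-- The memory during a round. -/
structure Core (χ₀ : PartialEdgeColoring G k) (es : List (Fin n × Fin n))
    (fs : List (UFan (Fin n) k)) (S R B : ℕ) (χ : PartialEdgeColoring G k) (r : ℕ) (α β : Fin k)
    (l : List (Fin fs.length)) (cnt bud : ℕ) (s : RAM.State) : Prop where
  static : Static χ₀ es fs S R B s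
  rep : ColRep es χ s
  cnt : s.reg 9 = cnt
  bud : s.reg 10 = bud
  round : s.reg 11 = r
  col₁ : s.reg 12 = α + 1
  col₂ : s.reg 13 = β + 1
  len : s.reg 15 = l.length
  list : ∀ i (h : i < l.length), s.mem 13 i = l[i]

/-- The memory during the first part of a round. -/
structure InRound (χ₀ : PartialEdgeColoring G k) (es : List (Fin n × Fin n))
    (fs : List (UFan (Fin n) k)) (S R B : ℕ) (χ : PartialEdgeColoring G k) (r : ℕ) (α β : Fin k)
    (l : List (Fin fs.length)) (cnt bud : ℕ) (s : RAM.State) : Prop extends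
    Core χ₀ es fs S R B χ r α β l cnt bud s where
  -- Stamps are compared with the number of the round, so they need not be cleared between rounds.
  -- Only vertices with an edge are considered, because `reset` reaches vertices through the edges
  -- and has no time for all `n` of them.
  fresh : ∀ z : Fin n, (∃ i, z ∈ edgeAt es i) → s.mem 11 z < r
  mark_le : ∀ z : Fin n, (∃ i, z ∈ edgeAt es i) → s.mem 12 z ≤ r
  mark : ∀ z : Fin n, (∃ i, z ∈ edgeAt es i) → (s.mem 12 z = r ↔ z ∈ (fanSet fs l).biUnion UFan.verts)

theorem UFan.IsUFan.incident {χ : PartialEdgeColoring G k}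
    (hG : ∀ e ∈ G.edgeSet, ∃ i, edgeAt es i = e)
    {f : UFan (Fin n) k} (hf : f.IsUFan χ) {z : Fin n} (hz : z ∈ f.verts) :
    ∃ i, z ∈ edgeAt es i := by
  obtain ⟨i, hi⟩ := hG _ hf.edge_uv
  obtain ⟨j, hj⟩ := hG _ hf.edge_uw
  simp only [UFan.verts, Finset.mem_insert, Finset.mem_singleton] at hz
  rcases hz with rfl | rfl | rfl
  · exact ⟨i, by rw [hi]; simp⟩
  · exact ⟨i, by rw [hi]; simp⟩
  · exact ⟨j, by rw [hj]; simp⟩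

variable {U : Finset (UFan (Fin n) k)} {r : ℕ} {α β : Fin k} {l : List (Fin fs.length)}
  {cnt bud : ℕ}

theorem convert_spec (hw : WordBounds n k es.length w) (hes : Function.Injective (edgeAt es))
    (hU : IsSeparableCollection χ₀ U)
    (h0 : InRound χ₀ es fs S R B χ r α β l cnt bud s₀) (hr : 0 < r) {i : Fin fs.length}
    (h17 : s₀.reg 17 = i) (hL : Loaded (fs.get i) s₀) (hf : (fs.get i).IsUFan χ) (hαβ : α ≠ β)
    (h1 : (fs.get i).α ≠ β) (h2 : (fs.get i).β ≠ α)
    (hbud : bud + convLen χ α β (fs.get i) < 2 ^ w) (hlen : l.length + 1 < 2 ^ w) :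
    ∃ s χ' bud', Converted U χ α β (fs.get i) χ' ∧ bud ≤ bud' ∧
      bud' ≤ bud + convLen χ α β (fs.get i) ∧
      InRound χ₀ es fs S R B χ' r α β (l ++ [i]) cnt bud' s ∧ s.reg 14 = s₀.reg 14 ∧
      RAM.ExecLe w RAM.convert s₀ s (20 * (bud' - bud) + 80) := by
  obtain ⟨p₁, ℓ₁, p₂, ℓ₂, p₃, ℓ₃, P₁, P₂, P₃, hℓ, hconv⟩ := hf.exists_converted hU hαβ h1 h2
  set f := fs.get i with hfdef
  -- With stamp `0`, paths flipped in a conversion do not enter the set `M` of the second part,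
  -- which has the stamp `r`.
  set s₁ := s₀.setReg 29 0 with hs₁
  have e1 : RAM.ExecLe w (.assign 29 (.const 0)) s₀ s₁ 1 := by
    refine ⟨1, le_rfl, ?_⟩
    have := RAM.Exec.assign (w := w) 29 (.const 0) s₀
    rwa [RAM.Expr.eval, Nat.zero_mod] at this
  have g1 : ∀ y, y ≠ 29 → s₁.reg y = s₀.reg y := fun y hy => by
    rw [hs₁, RAM.State.reg_setReg, if_neg hy]
  have st1 : Static χ₀ es fs S R B s₁ :=
    h0.static.of_eq (fun y hy => g1 y (by omega)) fun _ _ _ => rfl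
  have b1 : s₁.reg 10 = bud := by rw [g1 _ (by norm_num), h0.bud]
  obtain ⟨s₂, c2, e2⟩ := callMiss_spec hw hes st1 ⟨h0.rep.col, h0.rep.tab⟩ P₁
    (x' := 18) (a' := 21) (b' := 12) (by rw [g1 _ (by norm_num), hL.u])
    (by rw [g1 _ (by norm_num), hL.a]) (by rw [g1 _ (by norm_num), h0.col₁])
    (by norm_num) (by norm_num) (by rw [b1]; omega)
  have st2 := c2.static st1
  obtain ⟨s₃, c3, e3⟩ := callMiss_spec hw hes st2 c2.rep P₂
    (x' := 19) (a' := 22) (b' := 13) (by rw [c2.reg_eq _ (by simp), g1 _ (by norm_num), hL.v])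
    (by rw [c2.reg_eq _ (by simp), g1 _ (by norm_num), hL.b])
    (by rw [c2.reg_eq _ (by simp), g1 _ (by norm_num), h0.col₂])
    (by norm_num) (by norm_num) (by rw [c2.bud, b1]; omega)
  have st3 := c3.static st2
  obtain ⟨s₄, c4, e4⟩ := callMiss_spec hw hes st3 c3.rep P₃
    (x' := 20) (a' := 22) (b' := 13)
    (by rw [c3.reg_eq _ (by simp), c2.reg_eq _ (by simp), g1 _ (by norm_num), hL.w])
    (by rw [c3.reg_eq _ (by simp), c2.reg_eq _ (by simp), g1 _ (by norm_num), hL.b])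
    (by rw [c3.reg_eq _ (by simp), c2.reg_eq _ (by simp), g1 _ (by norm_num), h0.col₂])
    (by norm_num) (by norm_num) (by rw [c3.bud, c2.bud, b1]; omega)
  have st4 := c4.static st3
  have g4 : ∀ y, y ∉ [10, 23, 24, 25, 26, 27, 28, 29] → s₄.reg y = s₀.reg y := by
    intro y hy
    simp only [List.mem_cons, List.not_mem_nil, or_false, not_or] at hy
    rw [c4.reg_eq y (by simp; tauto), c3.reg_eq y (by simp; tauto), c2.reg_eq y (by simp; tauto),
      g1 y (by tauto)]
  have k4 : ∀ y, y ∉ [2, 10, 11] → s₄.mem y = s₀.mem y := by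
    intro y hy
    rw [c4.mem_eq y hy, c3.mem_eq y hy, c2.mem_eq y hy]; rfl
  have b4 : s₄.reg 10 = bud + (ℓ₁ + ℓ₂ + ℓ₃) := by rw [c4.bud, c3.bud, c2.bud, b1]; ring
  have f4 : ∀ z : Fin n, (∃ i, z ∈ edgeAt es i) → s₄.mem 11 z < r := by
    intro z hz
    have z2 : s₂.mem 11 z < r := by
      by_cases h : z ∈ prefixSet p₁ (ℓ₁ + 1)
      · rw [c2.stamp_of_mem z h, hs₁, RAM.State.reg_setReg, if_pos rfl]; exact hr
      · rw [c2.stamp_of_notMem z h]; exact h0.fresh z hz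
    have z3 : s₃.mem 11 z < r := by
      by_cases h : z ∈ prefixSet p₂ (ℓ₂ + 1)
      · rw [c3.stamp_of_mem z h, c2.reg_eq _ (by simp), hs₁, RAM.State.reg_setReg, if_pos rfl]
        exact hr
      · rw [c3.stamp_of_notMem z h]; exact z2
    by_cases h : z ∈ prefixSet p₃ (ℓ₃ + 1)
    · rw [c4.stamp_of_mem z h, c3.reg_eq _ (by simp), c2.reg_eq _ (by simp), hs₁,
        RAM.State.reg_setReg, if_pos rfl]
      exact hr
    · rw [c4.stamp_of_notMem z h]; exact z3
  set s₅ := RAM.register.sem w s₄ with hs₅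
  have e5 : RAM.ExecLe w RAM.register s₄ s₅ 9 :=
    RAM.ExecLe.straight w (by simp [RAM.register, RAM.Prog.block, RAM.Prog.Straight]) s₄
  have r18 : s₄.reg 18 = f.u := by rw [g4 _ (by simp), hL.u]
  have r19 : s₄.reg 19 = f.v := by rw [g4 _ (by simp), hL.v]
  have r20 : s₄.reg 20 = f.w := by rw [g4 _ (by simp), hL.w]
  have r11 : s₄.reg 11 = r := by rw [g4 _ (by simp), h0.round]
  have r15 : s₄.reg 15 = l.length := by rw [g4 _ (by simp), h0.len]
  have r17 : s₄.reg 17 = i := by rw [g4 _ (by simp), h17]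
  have m1 : (l.length + 1) % 2 ^ w = l.length + 1 := Nat.mod_eq_of_lt hlen
  have g5 : ∀ y, s₅.reg y = if y = 15 then l.length + 1 else s₄.reg y := by
    intro y
    simp only [hs₅, RAM.register, RAM.Prog.block, RAM.Prog.sem, RAM.State.reg_setReg,
      RAM.State.reg_setMem, RAM.Expr.eval, r15, hw.one_mod, m1]
  have k5 : s₅.mem = fun y => if y = 13 then Function.update (s₄.mem 13) l.length i else
      if y = 12 then Function.update (Function.update (Function.update (s₄.mem 12) f.u r) f.v r)
        f.w r else s₄.mem y := by
    funext y
    simp only [hs₅, RAM.register, RAM.Prog.block, RAM.Prog.sem,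
      RAM.State.reg_setMem, RAM.State.mem_setReg, RAM.State.mem_setMem, RAM.Expr.eval, r15, r17,
      r18, r19, r20, r11, Nat.reduceEqDiff, if_true, if_false]
    split_ifs <;> simp_all
  refine ⟨s₅, P₃.flip, bud + (ℓ₁ + ℓ₂ + ℓ₃), hconv, by omega, by omega, ⟨⟨?_, ?_, ?_, ?_, ?_, ?_, ?_,
    ?_, ?_⟩, ?_, ?_, ?_⟩, ?_, (e1.seq (e2.seq (e3.seq (e4.seq e5)))).mono (by omega)⟩
  · refine st4.of_eq (fun y hy => by rw [g5, if_neg (by omega)]) fun y hy _ => ?_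
    rw [k5]; simp only [if_neg (show y ≠ 13 by omega), if_neg (show y ≠ 12 by omega)]
  · refine ⟨?_, ?_⟩
    · rw [k5]; exact c4.rep.col
    · rw [k5]; exact c4.rep.tab
  · rw [g5, if_neg (by norm_num), g4 _ (by simp), h0.cnt]
  · rw [g5, if_neg (by norm_num), b4]
  · rw [g5, if_neg (by norm_num), r11]
  · rw [g5, if_neg (by norm_num), g4 _ (by simp), h0.col₁]
  · rw [g5, if_neg (by norm_num), g4 _ (by simp), h0.col₂]
  · rw [g5, if_pos rfl]; simp
  · intro j hj
    rw [k5]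
    simp only [if_true]
    by_cases hjl : j = l.length
    · subst hjl; simp
    · have hj' : j < l.length := by simp at hj; omega
      rw [Function.update_of_ne hjl, k4 _ (by simp), h0.list j hj', List.getElem_append_left hj']
  · intro z hz
    rw [k5]
    exact f4 z hz
  · intro z hz
    rw [k5]
    simp only [Nat.reduceEqDiff, if_true, if_false, Function.update_apply]
    split_ifs
    · exact le_rfl
    · exact le_rfl
    · exact le_rfl
    · rw [k4 _ (by simp)]; exact h0.mark_le z hz
  · intro z hz
    rw [k5, fanSet_append, Finset.biUnion_insert, Finset.mem_union, ← h0.mark z hz, ← hfdef]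
    simp only [Nat.reduceEqDiff, if_true, if_false, Function.update_apply, UFan.verts,
      Finset.mem_insert, Finset.mem_singleton, Fin.val_inj]
    rw [k4 12 (by simp)]
    split_ifs <;> simp_all
  · rw [g5, if_neg (by norm_num), g4 _ (by simp)]

theorem sample_spec (hw : WordBounds n k es.length w) (hes : Function.Injective (edgeAt es))
    (hG : ∀ e ∈ G.edgeSet, ∃ i, edgeAt es i = e) (hU : IsSeparableCollection χ₀ U)
    (hfs : ∀ f ∈ fs, f ∈ U)
    (h0 : InRound χ₀ es fs S R B χ r α β l cnt bud s₀) (hr : 0 < r) (i : Fin fs.length)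
    (h17 : s₀.reg 17 = i) (hαβ : α ≠ β)
    (hbud : (fs.get i).IsUFan χ → bud + convLen χ α β (fs.get i) < 2 ^ w) (hlen : l.length + 1 < 2 ^ w) :
    ∃ s χ' bud' l', bud ≤ bud' ∧ InRound χ₀ es fs S R B χ' r α β l' cnt bud' s ∧
      s.reg 14 = s₀.reg 14 ∧ RAM.ExecLe w RAM.sample s₀ s (20 * (bud' - bud) + 110) ∧
      (((fs.get i).IsUFan χ ∧ (fs.get i).α ≠ β ∧ (fs.get i).β ≠ α ∧
          Disjoint (fs.get i).verts ((fanSet fs l).biUnion UFan.verts) ∧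
          Converted U χ α β (fs.get i) χ' ∧ l' = l ++ [i] ∧
          bud' ≤ bud + convLen χ α β (fs.get i)) ∨
        (¬ ((fs.get i).IsUFan χ ∧ (fs.get i).α ≠ β ∧ (fs.get i).β ≠ α ∧
          Disjoint (fs.get i).verts ((fanSet fs l).biUnion UFan.verts)) ∧
          χ' = χ ∧ l' = l ∧ bud' = bud)) := by
  set f := fs.get i with hf
  have hf₀ : f.IsUFan χ₀ := hU.isUFan f (hfs f (List.get_mem _ _))
  set load : RAM.Prog := .block (RAM.loadVerts ++
    [.assign 21 (.read 6 (.reg 17)), .assign 22 (.read 7 (.reg 17))]) with hload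
  set s₁ := load.sem w s₀ with hs₁
  have e1 : RAM.ExecLe w load s₀ s₁ 9 :=
    RAM.ExecLe.straight w (by simp [hload, RAM.loadVerts, RAM.Prog.block, RAM.Prog.Straight]) s₀
  have g1 : ∀ y, s₁.reg y = if y = 22 then (f.β + 1 : ℕ) else if y = 21 then (f.α + 1 : ℕ) else
      if y = 20 then (f.w : ℕ) else if y = 19 then (f.v : ℕ) else if y = 18 then (f.u : ℕ) else
      s₀.reg y := by
    intro y
    simp only [hs₁, hload, RAM.loadVerts, List.cons_append, List.nil_append, RAM.Prog.block,
      RAM.Prog.sem, RAM.State.reg_setReg, RAM.State.mem_setReg, RAM.Expr.eval, h17,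
      Nat.reduceEqDiff, if_false, h0.static.fan_u, h0.static.fan_v, h0.static.fan_w,
      h0.static.fan_a, h0.static.fan_b, ← hf]
  have k1 : s₁.mem = s₀.mem := rfl
  have g1' : ∀ y, (y < 18 ∨ 22 < y) → s₁.reg y = s₀.reg y := fun y hy => by
    rw [g1, if_neg, if_neg, if_neg, if_neg, if_neg] <;> omega
  have hL : Loaded f s₁ := by
    constructor <;> rw [g1] <;> rfl
  have h1 : InRound χ₀ es fs S R B χ r α β l cnt bud s₁ := by
    refine ⟨⟨h0.static.of_eq (fun y hy => g1' y (by omega)) fun _ _ _ => rfl,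
      ⟨h0.rep.col, h0.rep.tab⟩, ?_, ?_, ?_, ?_, ?_, ?_, h0.list⟩, h0.fresh, h0.mark_le, h0.mark⟩
    · rw [g1' _ (by norm_num), h0.cnt]
    · rw [g1' _ (by norm_num), h0.bud]
    · rw [g1' _ (by norm_num), h0.round]
    · rw [g1' _ (by norm_num), h0.col₁]
    · rw [g1' _ (by norm_num), h0.col₂]
    · rw [g1' _ (by norm_num), h0.len]
  have hcheck : (∀ e ∈ RAM.checkFan ++ ([RAM.ne (.reg 21) (.reg 13), RAM.ne (.reg 22) (.reg 12)] ++
      RAM.checkFresh 12), e.eval w s₁ ≠ 0) ↔ (f.IsUFan χ ∧ f.α ≠ β ∧ f.β ≠ α ∧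
        Disjoint f.verts ((fanSet fs l).biUnion UFan.verts)) := by
    rw [List.forall_mem_append, List.forall_mem_append,
      checkFan_iff hw hG h1.static h1.rep hL (a := f.α) (b := f.β) hf₀ hf₀.colors_ne,
      checkFresh_iff hw hL.u hL.v hL.w h1.round]
    simp only [List.forall_mem_cons, eval_ne_ne_zero hw, RAM.Expr.eval, hL.a, hL.b, h1.col₁,
      h1.col₂, Finset.disjoint_left]
    have ha : ∀ c d : Fin k, (c : ℕ) + 1 ≠ d + 1 ↔ c ≠ d := fun c d => by
      rw [ne_eq, ne_eq, Nat.add_right_cancel_iff, Fin.val_inj]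
    have hb : (∀ z ∈ f.verts, s₁.mem 12 z ≠ r) ↔
        ∀ z ∈ f.verts, z ∉ (fanSet fs l).biUnion UFan.verts :=
      forall₂_congr fun z hz => not_congr (h1.mark z (hf₀.incident hG hz))
    rw [hb, ha, ha]
    simp only [List.not_mem_nil, false_imp_iff, implies_true, and_true, and_assoc]
  by_cases hc : f.IsUFan χ ∧ f.α ≠ β ∧ f.β ≠ α ∧
      Disjoint f.verts ((fanSet fs l).biUnion UFan.verts)
  · obtain ⟨s, χ', bud', hcv, hb1, hb2, hs, h14, e2⟩ := convert_spec hw hes hU h1 hr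
      (by rw [g1' _ (by norm_num), h17]) hL hc.1 hαβ hc.2.1 hc.2.2.1 (hbud hc.1) hlen
    refine ⟨s, χ', bud', _, hb1, hs, by rw [h14, g1' _ (by norm_num)],
      (e1.seq (RAM.ExecLe.guards_true (hcheck.2 hc) e2)).mono ?_, Or.inl ⟨hc.1, hc.2.1, hc.2.2.1,
        hc.2.2.2, hcv, rfl, hb2⟩⟩
    simp [RAM.checkFan, RAM.checkFresh]
    omega
  · refine ⟨s₁, χ, bud, l, le_rfl, h1, g1' _ (by norm_num),
      (e1.seq (RAM.ExecLe.guards_false ?_)).mono ?_, Or.inr ⟨hc, rfl, rfl, rfl⟩⟩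
    · rw [← hcheck] at hc
      push Not at hc
      exact hc
    · simp [RAM.checkFan, RAM.checkFresh]

end

end

/-! ### Coloring an edge in memory: one step of the second part of a round. -/

section

open PartialEdgeColoring

namespace RAM

/-- Give the color in register 13 to the edge between the vertices in registers 18 and 19. -/
def colorEdge : Prog := .block
  [.assign 27 (.read 9 (adjIdx 18 19)), .write 2 (.sub (.reg 27) (.const 1)) (.reg 13),
    .write 10 (tabIdx 18 13) (.reg 27), .write 10 (tabIdx 19 13) (.reg 27),
    .assign 9 (.add (.reg 9) (.const 1))]

/-- Color an edge of the u-fan in registers 18 to 20, which has the colors in registers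
12 and 13. -/
def complete : Prog := .seq (.assign 29 (.reg 11)) <| .seq (callMiss 18 12 13) <|
  .seq (.ite (.eq (.reg 23) (.reg 19)) (.assign 19 (.reg 20)) .skip) <|
  .seq (callMiss 19 13 12) <| .seq (callMiss 19 12 13) colorEdge

/-- Try to color an edge of the converted u-fan whose position is in register 16. -/
def finish : Prog := .seq
  (.block ([.assign 17 (.read 13 (.reg 16))] ++ loadVerts ++
    [.assign 21 (.reg 12), .assign 22 (.reg 13)]))
  (.guards (checkFan ++ checkFresh 11) complete)

end RAM

variable {n k : ℕ} {G : SimpleGraph (Fin n)} {es : List (Fin n × Fin n)}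
  {χ₀ χ : PartialEdgeColoring G k} {fs : List (UFan (Fin n) k)}
  {S R B w : ℕ} {s₀ : RAM.State} {U : Finset (UFan (Fin n) k)} {r : ℕ} {α β : Fin k}
  {l : List (Fin fs.length)} {cnt bud : ℕ} {M : Set (Fin n)}

/-- The memory during the second part of a round, with the set `M` of stamped vertices. -/
structure InFinal (χ₀ : PartialEdgeColoring G k) (es : List (Fin n × Fin n))
    (fs : List (UFan (Fin n) k)) (S R B : ℕ) (χ : PartialEdgeColoring G k) (r : ℕ) (α β : Fin k)
    (l : List (Fin fs.length)) (cnt bud : ℕ) (M : Set (Fin n)) (s : RAM.State) : Prop extends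
    Core χ₀ es fs S R B χ r α β l cnt bud s where
  stamp_le : ∀ z : Fin n, (∃ i, z ∈ edgeAt es i) → s.mem 11 z ≤ r
  stamp : ∀ z : Fin n, (∃ i, z ∈ edgeAt es i) → (s.mem 11 z = r ↔ z ∈ M)
  mark_le : ∀ z : Fin n, (∃ i, z ∈ edgeAt es i) → s.mem 12 z ≤ r

theorem colorEdge_spec (hw : WordBounds n k es.length w) (hes : Function.Injective (edgeAt es))
    (hG : ∀ e ∈ G.edgeSet, ∃ i, edgeAt es i = e)
    (h0 : Core χ₀ es fs S R B χ r α β l cnt bud s₀) {u v : Fin n} (hu : s₀.reg 18 = u)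
    (hv : s₀.reg 19 = v) (he : s(u, v) ∈ G.edgeSet) (hmu : β ∈ χ.miss u) (hmv : β ∈ χ.miss v)
    (hn : χ.color s(u, v) = none) (hcnt : cnt + 1 < 2 ^ w) :
    ∃ s, Core χ₀ es fs S R B (χ.addColor u v β he hmu hmv) r α β l (cnt + 1) bud s ∧
      (∀ y, y ≠ 9 → y ≠ 27 → s.reg y = s₀.reg y) ∧ s.mem 11 = s₀.mem 11 ∧ s.mem 12 = s₀.mem 12 ∧
      RAM.ExecLe w RAM.colorEdge s₀ s 9 := by
  obtain ⟨i, hi⟩ := hG _ he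
  have huv : u ≠ v := by rintro rfl; exact G.loopless.irrefl u he
  set s := RAM.colorEdge.sem w s₀ with hs
  have e1 : RAM.ExecLe w RAM.colorEdge s₀ s 9 :=
    RAM.ExecLe.straight w (by simp [RAM.colorEdge, RAM.Prog.block, RAM.Prog.Straight]) s₀
  have hadj := h0.static.adj_of_edge hi
  have hm0 := hw.adj_index_lt u.isLt v.isLt
  have m0 : (u : ℕ) * n % 2 ^ w = u * n := Nat.mod_eq_of_lt (by omega)
  have m1 : ((u : ℕ) * n + v) % 2 ^ w = u * n + v := Nat.mod_eq_of_lt hm0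
  have m2 : (cnt + 1) % 2 ^ w = cnt + 1 := Nat.mod_eq_of_lt hcnt
  have hlt : ∀ x : Fin n, (x : ℕ) * (k + 1) + (β + 1) < 2 ^ w := fun x =>
    hw.index_lt x.isLt β.isLt
  have m3 : ∀ x : Fin n, (x : ℕ) * (k + 1) % 2 ^ w = x * (k + 1) := fun x =>
    Nat.mod_eq_of_lt (by have := hlt x; omega)
  have m4 : ∀ x : Fin n, ((x : ℕ) * (k + 1) + (β + 1)) % 2 ^ w = x * (k + 1) + (β + 1) := fun x =>
    Nat.mod_eq_of_lt (hlt x)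
  have g : ∀ y, s.reg y = if y = 9 then cnt + 1 else if y = 27 then (i + 1 : ℕ) else
      s₀.reg y := by
    intro y
    simp only [hs, RAM.colorEdge, RAM.Prog.block, RAM.Prog.sem, RAM.State.reg_setReg,
      RAM.State.reg_setMem, RAM.Expr.eval, RAM.adjIdx, hu, hv, h0.static.reg0, hw.one_mod, m0,
      m1, h0.cnt, m2, hadj, Nat.reduceEqDiff, if_false]
  have km : s.mem = fun y => if y = 10 then Function.update (Function.update (s₀.mem 10)
      (u * (k + 1) + (β + 1)) (i + 1)) (v * (k + 1) + (β + 1)) (i + 1) else if y = 2 then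
      Function.update (s₀.mem 2) i (β + 1) else s₀.mem y := by
    funext y
    simp only [hs, RAM.colorEdge, RAM.Prog.block, RAM.Prog.sem, RAM.State.reg_setReg,
      RAM.State.reg_setMem, RAM.State.mem_setReg, RAM.State.mem_setMem, RAM.Expr.eval, RAM.adjIdx,
      RAM.tabIdx, hu, hv, h0.static.reg0, h0.static.reg5, hw.one_mod, m0, m1, m3, m4, h0.col₂, hadj,
      Nat.add_sub_cancel, Nat.reduceEqDiff, if_false, if_true]
    split_ifs <;> rfl
  refine ⟨s, ⟨?_, ⟨?_, ?_⟩, ?_, ?_, ?_, ?_, ?_, ?_, ?_⟩, ?_, ?_, ?_, e1⟩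
  · refine h0.static.of_eq (fun y hy => by rw [g, if_neg (by omega), if_neg (by omega)])
      fun y hy hy' => ?_
    rw [km]; simp only [if_neg (show y ≠ 10 by omega), if_neg hy']
  · intro j
    rw [km]
    simp only [Nat.reduceEqDiff, if_false, if_true]
    by_cases hj : j = i
    · rw [hj, Function.update_self, hi, addColor_self]; rfl
    · rw [Function.update_of_ne (by rwa [ne_eq, Fin.val_inj]), h0.rep.col,
        addColor_of_ne (fun h => hj (hes (h.trans hi.symm)))]
  · intro x c
    rw [km]
    simp only [if_true]
    by_cases hx : c = β ∧ (x = u ∨ x = v)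
    · obtain ⟨rfl, hx⟩ := hx
      refine Or.inr ⟨i, ?_, ?_, ?_⟩
      · rcases hx with rfl | rfl
        · rw [Function.update_of_ne (fun h => huv (tab_index_inj h).1), Function.update_self]
        · rw [Function.update_self]
      · rw [hi]; exact Sym2.mem_iff.2 hx
      · rw [hi, addColor_self]
    · rw [Function.update_of_ne, Function.update_of_ne]
      · rcases h0.rep.tab x c with ⟨h1, h2⟩ | ⟨j, h1, h2, h3⟩
        · exact Or.inl ⟨h1, (mem_miss_addColor hn).2 ⟨h2, hx⟩⟩
        · refine Or.inr ⟨j, h1, h2, ?_⟩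
          rw [addColor_of_ne, h3]
          intro h; rw [h, hn] at h3; simp at h3
      · intro h; exact hx ⟨(tab_index_inj h).2, Or.inl (tab_index_inj h).1⟩
      · intro h; exact hx ⟨(tab_index_inj h).2, Or.inr (tab_index_inj h).1⟩
  · rw [g, if_pos rfl]
  · rw [g, if_neg (by norm_num), if_neg (by norm_num), h0.bud]
  · rw [g, if_neg (by norm_num), if_neg (by norm_num), h0.round]
  · rw [g, if_neg (by norm_num), if_neg (by norm_num), h0.col₁]
  · rw [g, if_neg (by norm_num), if_neg (by norm_num), h0.col₂]
  · rw [g, if_neg (by norm_num), if_neg (by norm_num), h0.len]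
  · rw [km]; exact h0.list
  · intro y h1 h2; rw [g, if_neg h1, if_neg h2]
  · rw [km]; rfl
  · rw [km]; rfl

theorem complete_spec (hw : WordBounds n k es.length w) (hes : Function.Injective (edgeAt es))
    (hG : ∀ e ∈ G.edgeSet, ∃ i, edgeAt es i = e) (hU : IsSeparableCollection χ₀ U)
    (h0 : InFinal χ₀ es fs S R B χ r α β l cnt bud M s₀) {f : UFan (Fin n) k} (hfU : f ∈ U)
    (hL : Loaded (f.recolor α β) s₀) (hf : (f.recolor α β).IsUFan χ) (hM : χ.Closed α β M)
    (hfM : ∀ z ∈ f.verts, z ∉ M)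
    (hbud : bud + 2 * unvisited χ α β M < 2 ^ w) (hcnt : cnt + 1 < 2 ^ w) :
    ∃ s leaf χ' M' bud' cost, Completed U χ M α β f leaf χ' M' cost ∧ bud ≤ bud' ∧
      bud' ≤ bud + 2 * cost ∧ InFinal χ₀ es fs S R B χ' r α β l (cnt + 1) bud' M' s ∧
      s.reg 16 = s₀.reg 16 ∧ RAM.ExecLe w RAM.complete s₀ s (20 * (bud' - bud) + 82) := by
  classical
  obtain ⟨p, ℓ, P, leaf, hleaf, q, ℓ', Q, hβ, he, hu, hv, hC⟩ := hf.exists_completed hU hfU hM hfM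
  have hcost : ℓ + ℓ' ≤ unvisited χ α β M := by
    have := hC.unvisited_add_le; omega
  set s₁ := s₀.setReg 29 (s₀.reg 11) with hs₁
  have e1 : RAM.ExecLe w (.assign 29 (.reg 11)) s₀ s₁ 1 := ⟨1, le_rfl, .assign _ _ _⟩
  have g1 : ∀ y, y ≠ 29 → s₁.reg y = s₀.reg y := fun y hy => by
    rw [hs₁, RAM.State.reg_setReg, if_neg hy]
  have st1 : Static χ₀ es fs S R B s₁ :=
    h0.static.of_eq (fun y hy => g1 y (by omega)) fun _ _ _ => rfl
  have b1 : s₁.reg 10 = bud := by rw [g1 _ (by norm_num), h0.bud]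
  have r29 : s₁.reg 29 = r := by rw [hs₁, RAM.State.reg_setReg, if_pos rfl, h0.round]
  obtain ⟨s₂, c2, e2⟩ := callMiss_spec hw hes st1 ⟨h0.rep.col, h0.rep.tab⟩ P
    (x' := 18) (a' := 12) (b' := 13) (by rw [g1 _ (by norm_num), hL.u]; rfl)
    (by rw [g1 _ (by norm_num), h0.col₁]) (by rw [g1 _ (by norm_num), h0.col₂])
    (by norm_num) (by norm_num) (by rw [b1]; omega)
  have st2 := c2.static st1
  have r19 : s₂.reg 19 = f.v := by rw [c2.reg_eq _ (by simp), g1 _ (by norm_num), hL.v]; rfl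
  have r20 : s₂.reg 20 = f.w := by rw [c2.reg_eq _ (by simp), g1 _ (by norm_num), hL.w]; rfl
  obtain ⟨s₃, k3, g3, r19', e3⟩ : ∃ s₃ : RAM.State, s₃.mem = s₂.mem ∧
      (∀ y, y ≠ 19 → s₃.reg y = s₂.reg y) ∧ s₃.reg 19 = leaf ∧
      RAM.ExecLe w (.ite (.eq (.reg 23) (.reg 19)) (.assign 19 (.reg 20)) .skip) s₂ s₃ 2 := by
    by_cases hpv : p ℓ = f.v
    · refine ⟨s₂.setReg 19 (s₂.reg 20), rfl, fun y hy => ?_, ?_,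
        RAM.ExecLe.ite_true ?_ ⟨1, le_rfl, .assign _ _ _⟩⟩
      · rw [RAM.State.reg_setReg, if_neg hy]
      · rw [RAM.State.reg_setReg, if_pos rfl, r20, hleaf, if_pos hpv]
      · simp [RAM.Expr.eval, c2.cur, r19, hpv, hw.one_mod]
    · refine ⟨s₂, rfl, fun _ _ => rfl, ?_, RAM.ExecLe.ite_false ?_ ⟨1, le_rfl, .skip _⟩⟩
      · rw [r19, hleaf, if_neg hpv]
      · simp only [RAM.Expr.eval, c2.cur, r19, Fin.val_inj, if_neg hpv]
  have st3 : Static χ₀ es fs S R B s₃ :=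
    st2.of_eq (fun y hy => g3 y (by omega)) fun _ _ _ => by rw [k3]
  have rep3 : ColRep es P.flip s₃ := ⟨by rw [k3]; exact c2.rep.col, by rw [k3]; exact c2.rep.tab⟩
  have g3' : ∀ y, y ∉ [10, 19, 23, 24, 25, 26, 27, 28, 29] → s₃.reg y = s₀.reg y := by
    intro y hy
    simp only [List.mem_cons, List.not_mem_nil, or_false, not_or] at hy
    rw [g3 y (by tauto), c2.reg_eq y (by simp; tauto), g1 y (by tauto)]
  have b3 : s₃.reg 10 = bud + ℓ := by rw [g3 _ (by norm_num), c2.bud, b1]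
  have r29' : s₃.reg 29 = r := by rw [g3 _ (by norm_num), c2.reg_eq _ (by simp), r29]
  -- The path from the leaf is flipped and flipped back; only its stamps remain. Its length is
  -- therefore charged twice, hence the factor `2` in front of `cost`.
  obtain ⟨s₄, c4, e4⟩ := callMiss_spec hw hes st3 rep3 Q
    (x' := 19) (a' := 13) (b' := 12) r19'
    (by rw [g3' _ (by simp), h0.col₂]) (by rw [g3' _ (by simp), h0.col₁])
    (by norm_num) (by norm_num) (by rw [b3]; omega)
  have st4 := c4.static st3
  obtain ⟨s₅, c5, e5⟩ := callMiss_spec hw hes st4 c4.rep (Q.isPath_back hβ)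
    (x' := 19) (a' := 12) (b' := 13) (by rw [c4.reg_eq _ (by simp), r19'])
    (by rw [c4.reg_eq _ (by simp), g3' _ (by simp), h0.col₁])
    (by rw [c4.reg_eq _ (by simp), g3' _ (by simp), h0.col₂])
    (by norm_num) (by norm_num) (by rw [c4.bud, b3]; omega)
  have rep5 := c5.rep
  rw [Q.flip_back hβ] at rep5
  have g5 : ∀ y, y ∉ [10, 19, 23, 24, 25, 26, 27, 28, 29] → s₅.reg y = s₀.reg y := by
    intro y hy
    rw [← g3' y hy]
    simp only [List.mem_cons, List.not_mem_nil, or_false, not_or] at hy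
    rw [c5.reg_eq y (by simp; tauto), c4.reg_eq y (by simp; tauto)]
  have k5 : ∀ y, y ∉ [2, 10, 11] → s₅.mem y = s₀.mem y := by
    intro y hy
    rw [c5.mem_eq y hy, c4.mem_eq y hy, k3, c2.mem_eq y hy]; rfl
  have b5 : s₅.reg 10 = bud + ℓ + 2 * ℓ' := by rw [c5.bud, c4.bud, b3]; ring
  have core5 : Core χ₀ es fs S R B P.flip r α β l cnt (bud + ℓ + 2 * ℓ') s₅ := by
    refine ⟨c5.static st4, rep5, ?_, b5, ?_, ?_, ?_, ?_, ?_⟩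
    · rw [g5 _ (by simp), h0.cnt]
    · rw [g5 _ (by simp), h0.round]
    · rw [g5 _ (by simp), h0.col₁]
    · rw [g5 _ (by simp), h0.col₂]
    · rw [g5 _ (by simp), h0.len]
    · rw [k5 _ (by simp)]; exact h0.list
  obtain ⟨s₆, core6, g6, k6, k6', e6⟩ := colorEdge_spec hw hes hG core5 (u := f.u) (v := leaf)
    (by rw [g5 _ (by simp), hL.u]; rfl)
    (by rw [c5.reg_eq _ (by simp), c4.reg_eq _ (by simp), r19']) he hu hv
    (P.color_flip_eq_none.2 hC.uncolored) hcnt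
  have stamp5 : ∀ z : Fin n, s₅.mem 11 z =
      if z ∈ prefixSet q (ℓ' + 1) then r else s₃.mem 11 z := by
    intro z
    split
    · rename_i h
      rw [c5.stamp_of_mem z h, c4.reg_eq _ (by simp), r29']
    · rename_i h
      rw [c5.stamp_of_notMem z h, c4.stamp_of_notMem z h]
  have stamp3 : ∀ z : Fin n, s₃.mem 11 z =
      if z ∈ prefixSet p (ℓ + 1) then r else s₀.mem 11 z := by
    intro z
    rw [k3]
    split
    · rename_i h
      rw [c2.stamp_of_mem z h, r29]
    · rename_i h
      rw [c2.stamp_of_notMem z h]; rfl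
  refine ⟨s₆, leaf, _, _, bud + ℓ + 2 * ℓ', _, hC, by omega, by omega, ⟨core6, ?_, ?_, ?_⟩, ?_,
    (e1.seq (e2.seq (e3.seq (e4.seq (e5.seq e6))))).mono (by omega)⟩
  · intro z hz
    rw [k6, stamp5, stamp3]
    split_ifs
    · exact le_rfl
    · exact le_rfl
    · exact h0.stamp_le z hz
  · intro z hz
    rw [k6, stamp5, stamp3, Set.mem_union, Set.mem_union, ← h0.stamp z hz]
    split_ifs <;> simp_all
  · intro z hz
    rw [k6', k5 _ (by simp)]
    exact h0.mark_le z hz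
  · rw [g6 _ (by norm_num) (by norm_num), g5 _ (by simp)]

theorem finish_spec (hw : WordBounds n k es.length w) (hes : Function.Injective (edgeAt es))
    (hG : ∀ e ∈ G.edgeSet, ∃ i, edgeAt es i = e) (hU : IsSeparableCollection χ₀ U)
    (hfs : ∀ f ∈ fs, f ∈ U)
    (h0 : InFinal χ₀ es fs S R B χ r α β l cnt bud M s₀) (hM : χ.Closed α β M)
    (hαβ : α ≠ β) {i : ℕ} (hi : i < l.length) (h16 : s₀.reg 16 = i)
    (hbud : bud + 2 * unvisited χ α β M < 2 ^ w) (hcnt : cnt + 1 < 2 ^ w) :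
    ∃ s χ' M' bud' cnt', bud ≤ bud' ∧ InFinal χ₀ es fs S R B χ' r α β l cnt' bud' M' s ∧
      s.reg 16 = s₀.reg 16 ∧ RAM.ExecLe w RAM.finish s₀ s (20 * (bud' - bud) + 110) ∧
      ((∃ leaf cost, Completed U χ M α β (fs.get l[i]) leaf χ' M' cost ∧ cnt' = cnt + 1 ∧
          bud' ≤ bud + 2 * cost) ∨
        (¬ (((fs.get l[i]).recolor α β).IsUFan χ ∧ ¬ (fs.get l[i]).Touches M) ∧
          χ' = χ ∧ M' = M ∧ cnt' = cnt ∧ bud' = bud)) := by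
  set f := fs.get l[i] with hf
  have hfU : f ∈ U := hfs f (List.get_mem _ _)
  have hf₀ : f.IsUFan χ₀ := hU.isUFan f hfU
  set load : RAM.Prog := .block ([.assign 17 (.read 13 (.reg 16))] ++ RAM.loadVerts ++
    [.assign 21 (.reg 12), .assign 22 (.reg 13)]) with hload
  set s₁ := load.sem w s₀ with hs₁
  have e1 : RAM.ExecLe w load s₀ s₁ 11 :=
    RAM.ExecLe.straight w (by simp [hload, RAM.loadVerts, RAM.Prog.block, RAM.Prog.Straight]) s₀
  have g1 : ∀ y, s₁.reg y = if y = 22 then (β + 1 : ℕ) else if y = 21 then (α + 1 : ℕ) else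
      if y = 20 then (f.w : ℕ) else if y = 19 then (f.v : ℕ) else if y = 18 then (f.u : ℕ) else
      if y = 17 then (l[i] : ℕ) else s₀.reg y := by
    intro y
    simp only [hs₁, hload, RAM.loadVerts, List.cons_append, List.nil_append, RAM.Prog.block,
      RAM.Prog.sem, RAM.State.reg_setReg, RAM.State.mem_setReg, RAM.Expr.eval, h16,
      Nat.reduceEqDiff, if_false, if_true, h0.list i hi, h0.static.fan_u, h0.static.fan_v,
      h0.static.fan_w, h0.col₁, h0.col₂, ← hf]
  have k1 : s₁.mem = s₀.mem := rfl
  have g1' : ∀ y, (y < 17 ∨ 22 < y) → s₁.reg y = s₀.reg y := fun y hy => by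
    rw [g1, if_neg, if_neg, if_neg, if_neg, if_neg, if_neg] <;> omega
  have hL : Loaded (f.recolor α β) s₁ := by
    constructor <;> rw [g1] <;> rfl
  have h1 : InFinal χ₀ es fs S R B χ r α β l cnt bud M s₁ := by
    refine ⟨⟨h0.static.of_eq (fun y hy => g1' y (by omega)) fun _ _ _ => rfl,
      ⟨h0.rep.col, h0.rep.tab⟩, ?_, ?_, ?_, ?_, ?_, ?_, h0.list⟩, h0.stamp_le, h0.stamp, h0.mark_le⟩
    · rw [g1' _ (by norm_num), h0.cnt]
    · rw [g1' _ (by norm_num), h0.bud]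
    · rw [g1' _ (by norm_num), h0.round]
    · rw [g1' _ (by norm_num), h0.col₁]
    · rw [g1' _ (by norm_num), h0.col₂]
    · rw [g1' _ (by norm_num), h0.len]
  have hcheck : (∀ e ∈ RAM.checkFan ++ RAM.checkFresh 11, e.eval w s₁ ≠ 0) ↔
      ((f.recolor α β).IsUFan χ ∧ ∀ z ∈ f.verts, z ∉ M) := by
    rw [List.forall_mem_append, checkFan_iff hw hG h1.static h1.rep hL (a := f.α) (b := f.β)
      (χ₁ := χ₀) hf₀ hαβ, checkFresh_iff hw (f := f) hL.u hL.v hL.w h1.round]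
    refine and_congr_right fun _ => forall₂_congr fun z hz => not_congr (h1.stamp z ?_)
    exact hf₀.incident hG hz
  by_cases hc : (f.recolor α β).IsUFan χ ∧ ∀ z ∈ f.verts, z ∉ M
  · obtain ⟨s, leaf, χ', M', bud', cost, hC, hb1, hb2, hs, h16', e2⟩ :=
      complete_spec hw hes hG hU h1 hfU hL hc.1 hM hc.2 hbud hcnt
    refine ⟨s, χ', M', bud', cnt + 1, hb1, hs, by rw [h16', g1' _ (by norm_num)],
      (e1.seq (RAM.ExecLe.guards_true (hcheck.2 hc) e2)).mono ?_,
      Or.inl ⟨leaf, cost, hC, rfl, hb2⟩⟩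
    simp [RAM.checkFan, RAM.checkFresh]
    omega
  · refine ⟨s₁, χ, M, bud, cnt, le_rfl, h1, g1' _ (by norm_num),
      (e1.seq (RAM.ExecLe.guards_false ?_)).mono ?_, Or.inr ⟨?_, rfl, rfl, rfl, rfl⟩⟩
    · rw [← hcheck] at hc
      push Not at hc
      exact hc
    · simp [RAM.checkFan, RAM.checkFresh]
    · rintro ⟨h2, h3⟩
      exact hc ⟨h2, fun z hz hz' => h3 ⟨z, hz, hz'⟩⟩

end

/-! ### The loop of the second part of a round. -/

section

open PartialEdgeColoring

/-! ### The second part of a round -/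

namespace RAM

/-- Color edges of the converted u-fans, one after the other. -/
def finishLoop : Prog := .loop (.lt (.reg 16) (.reg 15))
  (.seq finish (.assign 16 (.add (.reg 16) (.const 1))))

end RAM

/-- The coloring `χ` colors all edges that `χ₀` colors, and `cnt` edges of members of `U`. -/
structure Progress {V : Type*} [DecidableEq V] {G : SimpleGraph V} {k : ℕ}
    (χ₀ : PartialEdgeColoring G k) (U : Finset (UFan V k)) (χ : PartialEdgeColoring G k)
    (cnt : ℕ) : Prop where
  keep : ∀ e, χ₀.color e ≠ none → χ.color e ≠ none
  colored : ∃ F : Finset (Sym2 V), F ⊆ U.biUnion UFan.edges ∧ F.card = cnt ∧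
    ∀ e ∈ F, χ.color e ≠ none

section

variable {V : Type*} [DecidableEq V] {G : SimpleGraph V} {k : ℕ}
  {χ₀ χ χ' : PartialEdgeColoring G k} {U : Finset (UFan V k)} {cnt : ℕ}

theorem Progress.zero : Progress χ₀ U χ₀ 0 := ⟨fun _ h => h, ∅, by simp, rfl, by simp⟩

theorem Progress.of_none_iff (h : Progress χ₀ U χ cnt)
    (hχ : ∀ e, χ'.color e = none ↔ χ.color e = none) : Progress χ₀ U χ' cnt := by
  obtain ⟨F, h1, h2, h3⟩ := h.colored
  exact ⟨fun e he => (hχ e).not.2 (h.keep e he), F, h1, h2, fun e he => (hχ e).not.2 (h3 e he)⟩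

theorem Progress.completed [Fintype V] (h : Progress χ₀ U χ cnt) {M M' : Set V} {α β : Fin k} {f : UFan V k}
    (hf : f ∈ U) {leaf : V} {cost : ℕ} (hC : Completed U χ M α β f leaf χ' M' cost) :
    Progress χ₀ U χ' (cnt + 1) := by
  obtain ⟨F, h1, h2, h3⟩ := h.colored
  have hn : s(f.u, leaf) ∉ F := fun h => h3 _ h hC.uncolored
  refine ⟨fun e he hc => h.keep e he ((hC.color_eq_none e).1 hc).1, insert s(f.u, leaf) F, ?_, ?_, ?_⟩
  · refine Finset.insert_subset (Finset.mem_biUnion.2 ⟨f, hf, hC.edge_mem⟩) h1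
  · rw [Finset.card_insert_of_notMem hn, h2]
  · intro e he hc
    obtain ⟨h4, h5⟩ := (hC.color_eq_none e).1 hc
    rcases Finset.mem_insert.1 he with h | h
    · exact h5 h
    · exact h3 e h h4

end

variable {n k : ℕ} {G : SimpleGraph (Fin n)} {es : List (Fin n × Fin n)}
  {χ₀ χ : PartialEdgeColoring G k} {fs : List (UFan (Fin n) k)}
  {S R B w : ℕ} {s₀ : RAM.State} {U : Finset (UFan (Fin n) k)} {r : ℕ} {α β : Fin k}
  {l : List (Fin fs.length)} {cnt bud : ℕ} {M : Set (Fin n)}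

theorem Core.setReg (h : Core χ₀ es fs S R B χ r α β l cnt bud s₀) {y v : ℕ} (hy : 13 < y)
    (hy' : y ≠ 15) : Core χ₀ es fs S R B χ r α β l cnt bud (s₀.setReg y v) := by
  have g : ∀ z, (z < 14 ∨ z = 15) → (s₀.setReg y v).reg z = s₀.reg z := fun z hz => by
    rw [RAM.State.reg_setReg, if_neg (by omega)]
  refine ⟨h.static.of_eq (fun z hz => g z (by omega)) fun _ _ _ => rfl, ⟨h.rep.col, h.rep.tab⟩,
    ?_, ?_, ?_, ?_, ?_, ?_, h.list⟩
  · rw [g _ (by norm_num), h.cnt]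
  · rw [g _ (by norm_num), h.bud]
  · rw [g _ (by norm_num), h.round]
  · rw [g _ (by norm_num), h.col₁]
  · rw [g _ (by norm_num), h.col₂]
  · rw [g _ (by norm_num), h.len]

theorem InFinal.setReg (h : InFinal χ₀ es fs S R B χ r α β l cnt bud M s₀) {y v : ℕ} (hy : 13 < y)
    (hy' : y ≠ 15) : InFinal χ₀ es fs S R B χ r α β l cnt bud M (s₀.setReg y v) :=
  ⟨h.toCore.setReg hy hy', h.stamp_le, h.stamp, h.mark_le⟩

theorem InRound.setReg (h : InRound χ₀ es fs S R B χ r α β l cnt bud s₀) {y v : ℕ} (hy : 13 < y)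
    (hy' : y ≠ 15) : InRound χ₀ es fs S R B χ r α β l cnt bud (s₀.setReg y v) :=
  ⟨h.toCore.setReg hy hy', h.fresh, h.mark_le, h.mark⟩

theorem InRound.inFinal (h : InRound χ₀ es fs S R B χ r α β l cnt bud s₀) :
    InFinal χ₀ es fs S R B χ r α β l cnt bud ∅ s₀ :=
  ⟨h.toCore, fun z hz => (h.fresh z hz).le, fun z hz => by
    simp [(h.fresh z hz).ne], h.mark_le⟩

-- Invariants: every member of `L` is still ready or touches `M`, and those already treated touch
-- `M`; the number of touched members is at most four times the number of edges colored since
-- `cnt₀`; and the length spent plus twice the number of unvisited vertices is at most `b`.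
open Classical in
theorem finishLoop_spec (hw : WordBounds n k es.length w) (hes : Function.Injective (edgeAt es))
    (hG : ∀ e ∈ G.edgeSet, ∃ i, edgeAt es i = e) (hU : IsSeparableCollection χ₀ U)
    (hfs : ∀ f ∈ fs, f ∈ U) (hαβ : α ≠ β) {L : Finset (UFan (Fin n) k)} (hL : VertDisjoint L)
    {cnt₀ b : ℕ} (hb : b < 2 ^ w) (d i : ℕ) (hi : i + d = l.length) (h16 : s₀.reg 16 = i)
    (h0 : InFinal χ₀ es fs S R B χ r α β l cnt bud M s₀) (hM : χ.Closed α β M)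
    (hP : Progress χ₀ U χ cnt) (hr : ∀ g ∈ L, (g.recolor α β).IsUFan χ ∨ g.Touches M)
    (ht : ∀ i' (h : i' < l.length), i' < i → fs.get l[i'] ∈ L → (fs.get l[i']).Touches M)
    (hcard : (L.filter fun g => g.Touches M).card + 4 * cnt₀ ≤ 4 * cnt)
    (hbud : bud + 2 * unvisited χ α β M ≤ b) (hcnt : cnt + d < 2 ^ w) (hlen : l.length < 2 ^ w) :
    ∃ s χ' M' cnt' bud', InFinal χ₀ es fs S R B χ' r α β l cnt' bud' M' s ∧
      Progress χ₀ U χ' cnt' ∧ bud ≤ bud' ∧ bud' ≤ b ∧ cnt' ≤ cnt + d ∧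
      deadCount U χ' ≤ deadCount U χ + 7 * d ∧
      (∀ i' (h : i' < l.length), fs.get l[i'] ∈ L → (fs.get l[i']).Touches M') ∧
      (L.filter fun g => g.Touches M').card + 4 * cnt₀ ≤ 4 * cnt' ∧
      RAM.ExecLe w RAM.finishLoop s₀ s (20 * (bud' - bud) + d * 114 + 1) := by
  induction d generalizing i χ cnt bud M s₀ with
  | zero =>
    refine ⟨s₀, χ, M, cnt, bud, h0, hP, le_rfl, by omega, le_rfl, le_rfl,
      fun i' h => ht i' h (by omega), hcard, (RAM.ExecLe.loop_false ?_).mono (by omega)⟩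
    simp only [RAM.Expr.eval, h16, h0.len]
    rw [if_neg (by omega)]
  | succ d ih =>
    have hi' : i < l.length := by omega
    obtain ⟨s₁, χ₁, M₁, bud₁, cnt₁, hb1, h1, h16', e1, hcase⟩ :=
      finish_spec hw hes hG hU hfs h0 hM hαβ hi' h16 (by omega) (by omega)
    have hm : (i + 1) % 2 ^ w = i + 1 := Nat.mod_eq_of_lt (by omega)
    have e2 : RAM.ExecLe w (.assign 16 (.add (.reg 16) (.const 1))) s₁ (s₁.setReg 16 (i + 1)) 1 := by
      refine ⟨1, le_rfl, ?_⟩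
      have := RAM.Exec.assign (w := w) 16 (.add (.reg 16) (.const 1)) s₁
      simpa only [RAM.Expr.eval, h16', h16, hw.one_mod, hm] using this
    have htest : (RAM.Expr.lt (.reg 16) (.reg 15)).eval w s₀ ≠ 0 := by
      simp only [RAM.Expr.eval, h16, h0.len, hw.one_mod]
      rw [if_pos hi']; norm_num
    have hfU : fs.get l[i] ∈ U := hfs _ (List.get_mem _ _)
    obtain ⟨hM₁, hP₁, hr₁, ht₁, hcard₁, hbud₁, hcnt₁, hdead₁⟩ : χ₁.Closed α β M₁ ∧
        Progress χ₀ U χ₁ cnt₁ ∧ (∀ g ∈ L, (g.recolor α β).IsUFan χ₁ ∨ g.Touches M₁) ∧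
        (∀ i' (h : i' < l.length), i' < i + 1 → fs.get l[i'] ∈ L → (fs.get l[i']).Touches M₁) ∧
        (L.filter fun g => g.Touches M₁).card + 4 * cnt₀ ≤ 4 * cnt₁ ∧
        bud₁ + 2 * unvisited χ₁ α β M₁ ≤ b ∧ cnt₁ ≤ cnt + 1 ∧
        deadCount U χ₁ ≤ deadCount U χ + 7 := by
      rcases hcase with ⟨leaf, cost, hC, rfl, hb2⟩ | ⟨hn, rfl, rfl, rfl, rfl⟩
      · refine ⟨hC.closed, hP.completed hfU hC, fun g hg => hC.isUFan_or_touches (hr g hg), ?_, ?_,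
          ?_, le_rfl, hC.dead_le⟩
        · intro i' h h' hg
          rcases Nat.lt_succ_iff_lt_or_eq.1 h' with h' | rfl
          · obtain ⟨z, hz, hz'⟩ := ht i' h h' hg
            exact ⟨z, hz, hC.subset hz'⟩
          · exact ⟨_, UFan.u_mem, hC.center_mem⟩
        · have := hC.card_touches_le hL hr
          omega
        · have := hC.unvisited_add_le
          omega
      · refine ⟨hM, hP, hr, ?_, hcard, hbud, by omega, by omega⟩
        intro i' h h' hg
        rcases Nat.lt_succ_iff_lt_or_eq.1 h' with h' | rfl
        · exact ht i' h h' hg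
        · rcases hr _ hg with h3 | h3
          · by_contra h4
            exact hn ⟨h3, h4⟩
          · exact h3
    obtain ⟨s₂, χ₂, M₂, cnt₂, bud₂, h2, hP2, hb2, hb2', hc2, hd2, ht2, hcard2, e3⟩ :=
      ih (i + 1) (by omega) (s₀ := s₁.setReg 16 (i + 1)) (by rw [RAM.State.reg_setReg, if_pos rfl])
        (h1.setReg (by norm_num) (by norm_num)) hM₁ hP₁ hr₁ ht₁ hcard₁ hbud₁ (by omega)
    exact ⟨s₂, χ₂, M₂, cnt₂, bud₂, h2, hP2, by omega, hb2', by omega, by omega, ht2, hcard2,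
      (RAM.ExecLe.loop_true htest (e1.seq e2) e3).mono (by ring_nf; omega)⟩

/-- The memory between two rounds. -/
structure Between (χ₀ : PartialEdgeColoring G k) (es : List (Fin n × Fin n))
    (fs : List (UFan (Fin n) k)) (S R B : ℕ) (χ : PartialEdgeColoring G k) (r cnt bud : ℕ)
    (s : RAM.State) : Prop where
  static : Static χ₀ es fs S R B s
  rep : ColRep es χ s
  cnt : s.reg 9 = cnt
  bud : s.reg 10 = bud
  round : s.reg 11 = r
  stamp_le : ∀ z : Fin n, (∃ i, z ∈ edgeAt es i) → s.mem 11 z ≤ r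
  mark_le : ∀ z : Fin n, (∃ i, z ∈ edgeAt es i) → s.mem 12 z ≤ r

theorem InFinal.between (h : InFinal χ₀ es fs S R B χ r α β l cnt bud M s₀) :
    Between χ₀ es fs S R B χ r cnt bud s₀ :=
  ⟨h.static, h.rep, h.cnt, h.bud, h.round, h.stamp_le, h.mark_le⟩

/-- Applied to the set `L` of initially ready u-fans: in the end all of them are touched, so at
least a quarter of their number has been colored. The unvisited vertices number at most `colorDeg α
+ colorDeg β` at the beginning, which bounds the total length. -/
theorem finishAll_spec (hw : WordBounds n k es.length w) (hes : Function.Injective (edgeAt es))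
    (hG : ∀ e ∈ G.edgeSet, ∃ i, edgeAt es i = e) (hU : IsSeparableCollection χ₀ U)
    (hfs : ∀ f ∈ fs, f ∈ U) (hαβ : α ≠ β) (hL : VertDisjoint (fanSet fs l))
    (h0 : InRound χ₀ es fs S R B χ r α β l cnt bud s₀) (hP : Progress χ₀ U χ cnt)
    (hbud : bud + 2 * (χ.colorDeg α + χ.colorDeg β) < 2 ^ w) (hcnt : cnt + l.length < 2 ^ w) :
    ∃ s χ' cnt' bud', Between χ₀ es fs S R B χ' r cnt' bud' s ∧ Progress χ₀ U χ' cnt' ∧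
      bud ≤ bud' ∧ bud' ≤ bud + 2 * (χ.colorDeg α + χ.colorDeg β) ∧ cnt' ≤ cnt + l.length ∧
      deadCount U χ' ≤ deadCount U χ + 7 * l.length ∧
      readyCount χ α β (fanSet fs l) + 4 * cnt ≤ 4 * cnt' ∧
      RAM.ExecLe w (.seq (.assign 16 (.const 0)) RAM.finishLoop) s₀ s
        (20 * (bud' - bud) + l.length * 114 + 3) := by
  classical
  set L := (fanSet fs l).filter fun g => (g.recolor α β).IsUFan χ with hLdef
  have e1 : RAM.ExecLe w (.assign 16 (.const 0)) s₀ (s₀.setReg 16 0) 1 := by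
    refine ⟨1, le_rfl, ?_⟩
    have := RAM.Exec.assign (w := w) 16 (.const 0) s₀
    simpa only [RAM.Expr.eval, Nat.zero_mod] using this
  have hun := unvisited_le (χ := χ) α β ∅
  obtain ⟨s, χ', M', cnt', bud', h2, hP2, hb2, hb2', hc2, hd2, ht2, hcard2, e3⟩ :=
    finishLoop_spec (s₀ := s₀.setReg 16 0) hw hes hG hU hfs hαβ (L := L)
      (fun f hf g hg => hL f (Finset.mem_filter.1 hf).1 g (Finset.mem_filter.1 hg).1)
      (cnt₀ := cnt) hbud l.length 0 (by omega) (by rw [RAM.State.reg_setReg, if_pos rfl])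
      (h0.inFinal.setReg (by norm_num) (by norm_num)) (fun y z c _ _ h => h.elim) hP
      (fun g hg => Or.inl (Finset.mem_filter.1 hg).2) (by omega)
      (by simp [UFan.Touches]) (by omega) (by omega) (by omega)
  refine ⟨s, χ', cnt', bud', h2.between, hP2, hb2, hb2', hc2, hd2, ?_,
    (e1.seq e3).mono (by omega)⟩
  have : L.filter (fun g => g.Touches M') = L := by
    rw [Finset.filter_eq_self]
    intro g hg
    obtain ⟨i, hi, rfl⟩ := mem_fanSet.1 (Finset.mem_filter.1 hg).1
    obtain ⟨i', h', rfl⟩ := List.mem_iff_getElem.1 hi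
    exact ht2 i' h' hg
  rw [this] at hcard2
  exact hcard2

end

/-! ### Probability bounds, parameters, and the effect of processing one u-fan. -/

section

open PartialEdgeColoring

/-! ### Probability bounds -/

/-- The probability of an eventual success, if the current attempt is successful with
probability `max 0 x` and otherwise there is a success with probability `q`. -/
noncomputable def gain (q x : ℝ) : ℝ := q + (1 - q) * max 0 x

theorem gain_nonneg {q : ℝ} (h0 : 0 ≤ q) (h1 : q ≤ 1) (x : ℝ) : 0 ≤ gain q x :=
  add_nonneg h0 (mul_nonneg (by linarith) (le_max_left _ _))

theorem gain_mono {q : ℝ} (h1 : q ≤ 1) {x y : ℝ} (h : x ≤ y) : gain q x ≤ gain q y :=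
  add_le_add le_rfl (mul_le_mul_of_nonneg_left (max_le_max le_rfl h) (by linarith))

theorem gain_of_nonpos (q : ℝ) {x : ℝ} (h : x ≤ 0) : gain q x = q := by
  rw [gain, max_eq_left h, mul_zero, add_zero]

theorem le_gain {q : ℝ} (h1 : q ≤ 1) (x : ℝ) : q ≤ gain q x :=
  le_add_of_nonneg_right (mul_nonneg (by linarith) (le_max_left _ _))

/-- Convexity of `max 0`: its mean is at least its value at the mean. So an estimate of the expected
potential suffices. -/
theorem mul_gain_le_sum {q : ℝ} (h1 : q ≤ 1) {N : ℕ} {x : ℝ} {X : Fin N → ℝ}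
    (hx : N * x ≤ ∑ i, X i) : N * gain q x ≤ ∑ i, gain q (X i) := by
  have hmax : N * max 0 x ≤ ∑ i, max 0 (X i) := by
    rcases le_total x 0 with h | h
    · rw [max_eq_left h, mul_zero]
      exact Finset.sum_nonneg fun i _ => le_max_left _ _
    · rw [max_eq_right h]
      exact hx.trans (Finset.sum_le_sum fun i _ => le_max_right _ _)
  simp only [gain, Finset.sum_add_distrib, ← Finset.mul_sum, Finset.sum_const, Finset.card_univ,
    Fintype.card_fin, nsmul_eq_mul]
  nlinarith [mul_le_mul_of_nonneg_left hmax (show 0 ≤ 1 - q by linarith)]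

namespace RAM

variable {w t n : ℕ} {Good : State → Prop} {k : List Prog} {s s' : State} {x q : ℝ}

theorem Ensures.rand_gain {r : ℕ} {e : Expr} {N : ℕ} (hN : e.eval w s = N) (hpos : 0 < N)
    (h0 : 0 ≤ q) (h1 : q ≤ 1) {X : Fin N → ℝ} (hx : N * x ≤ ∑ i, X i)
    (h : ∀ i : Fin N, Ensures w Good t n (k, s.setReg r i) (gain q (X i))) :
    Ensures w Good (t + 1) n (.rand r e :: k, s) (gain q x) := by
  refine Ensures.rand (X := fun i => if hi : i < N then gain q (X ⟨i, hi⟩) else 0) hN hpos ?_ ?_ ?_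
  · intro i hi
    simp only [dif_pos hi]
    exact gain_nonneg h0 h1 _
  · rw [Finset.sum_range]
    refine (mul_gain_le_sum h1 hx).trans (le_of_eq (Finset.sum_congr rfl fun i _ => ?_))
    rw [dif_pos i.isLt]
  · intro i hi
    simp only [dif_pos hi]
    exact h ⟨i, hi⟩

theorem Ensures.seq {p p' : Prog} (h : Ensures w Good t n (p :: p' :: k, s) x) :
    Ensures w Good (t + 1) n (.seq p p' :: k, s) x := .of_step rfl h

theorem Ensures.loop_true {e : Expr} {p : Prog} (he : e.eval w s ≠ 0)
    (h : Ensures w Good t n (p :: .loop e p :: k, s) x) :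
    Ensures w Good (t + 1) n (.loop e p :: k, s) x :=
  .of_step (by simp [step, he]) h

theorem Ensures.loop_false {e : Expr} {p : Prog} (he : e.eval w s = 0)
    (h : Ensures w Good t n (k, s) x) : Ensures w Good (t + 1) n (.loop e p :: k, s) x :=
  .of_step (by simp [step, he]) h

/-- Process random u-fans. -/
def sampleLoop : Prog := .loop (.lt (.reg 14) (.reg 6)) <| .seq (.rand 17 (.reg 3)) <|
  .seq (.ite (.lt (.reg 8) (.reg 10)) .skip sample) (.assign 14 (.add (.reg 14) (.const 1)))

end RAM

variable {n k : ℕ} {G : SimpleGraph (Fin n)} {es : List (Fin n × Fin n)}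
  {χ₀ χ : PartialEdgeColoring G k} {fs : List (UFan (Fin n) k)}
  {S R B w : ℕ} {s₀ : RAM.State} {U : Finset (UFan (Fin n) k)} {r : ℕ} {α β : Fin k}
  {l : List (Fin fs.length)} {cnt bud : ℕ}

/-- The standing assumptions on the input and on the parameters of the algorithm. -/
structure Setup (χ₀ : PartialEdgeColoring G k) (U : Finset (UFan (Fin n) k))
    (es : List (Fin n × Fin n)) (fs : List (UFan (Fin n) k)) (S R B w : ℕ) : Prop where
  word : WordBounds n k es.length w
  inj : Function.Injective (edgeAt es)
  edge : ∀ e ∈ G.edgeSet, ∃ i, edgeAt es i = e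
  sep : IsSeparableCollection χ₀ U
  fans : IsFanList U fs
  deg : ∀ χ : PartialEdgeColoring G k, ∑ c, χ.colorDeg c ≤ 2 * es.length
  three_le : 3 ≤ k
  colors_le : k ≤ 2 * es.length
  pos : 0 < fs.length
  fans_le : 2 * fs.length ≤ es.length
  -- `S` is so small that the u-fans converted in one round conflict with a small part of `U` only.
  -- If `S > 1` or `R = k`, then about `k` rounds make up `R * S`; otherwise `S = 1`. In all cases
  -- `R * S` lies between `λ / 1500` and `2 * λ / 1500 + 1`, which keeps the total damage of an
  -- attempt small.
  S_eq : S = fs.length / (1500 * k) + 1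
  R_eq : R = min k (fs.length / 1500 + 1)
  B_eq : B = 15000 * es.length

namespace Setup

variable (h : Setup χ₀ U es fs S R B w)

theorem mem_U (h : Setup χ₀ U es fs S R B w) : ∀ f ∈ fs, f ∈ U := fun f => (h.fans.2 f).1

theorem S_pos (h : Setup χ₀ U es fs S R B w) : 0 < S := by rw [h.S_eq]; exact Nat.succ_pos _

theorem R_pos (h : Setup χ₀ U es fs S R B w) : 0 < R := by
  rw [h.R_eq]; have := h.three_le; omega

theorem R_le (h : Setup χ₀ U es fs S R B w) : R ≤ k := by rw [h.R_eq]; exact min_le_left _ _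

theorem S_le (h : Setup χ₀ U es fs S R B w) : 1500 * k * (S - 1) ≤ fs.length := by
  rw [h.S_eq, Nat.add_sub_cancel]; exact Nat.mul_div_le _ _

theorem mul_le (h : Setup χ₀ U es fs S R B w) : 1500 * (R * S) ≤ 2 * fs.length + 1500 := by
  have h1 := h.S_le
  have h2 := Nat.mul_div_le fs.length 1500
  have h3 : fs.length < 1500 * (fs.length / 1500) + 1500 := by omega
  have hS := h.S_pos
  obtain ⟨S', rfl⟩ : ∃ S', S = S' + 1 := ⟨S - 1, by omega⟩
  rw [Nat.add_sub_cancel] at h1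
  have h4 : R * S' ≤ k * S' := Nat.mul_le_mul h.R_le le_rfl
  have h5 : R ≤ fs.length / 1500 + 1 := by rw [h.R_eq]; exact min_le_right _ _
  nlinarith

theorem le_mul (h : Setup χ₀ U es fs S R B w) : fs.length ≤ 1500 * (R * S) := by
  have hS := h.S_eq
  have hk := h.three_le
  rcases le_total k (fs.length / 1500 + 1) with h1 | h1
  · rw [h.R_eq, min_eq_left h1, hS]
    have h2 : fs.length < 1500 * k * (fs.length / (1500 * k)) + 1500 * k := by
      have := Nat.mod_lt fs.length (show 0 < 1500 * k by omega)
      have := Nat.div_add_mod fs.length (1500 * k)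
      omega
    nlinarith
  · rw [h.R_eq, min_eq_right h1]
    have h2 : fs.length < 1500 * (fs.length / 1500) + 1500 := by omega
    have := h.S_pos
    nlinarith

theorem mul_le_length (h : Setup χ₀ U es fs S R B w) : R * S ≤ fs.length := by
  have h1 := h.mul_le
  have h2 := h.pos
  by_cases h3 : 1500 ≤ fs.length
  · omega
  · have h4 : fs.length / 1500 = 0 := Nat.div_eq_of_lt (by omega)
    have h5 : fs.length / (1500 * k) = 0 := Nat.div_eq_of_lt (by have := h.three_le; omega)
    rw [h.S_eq, h.R_eq, h4, h5]
    have := min_le_right k (0 + 1)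
    omega

theorem length_pos (h : Setup χ₀ U es fs S R B w) : 0 < es.length := by
  have := h.pos; have := h.fans_le; omega

theorem S_le_length (h : Setup χ₀ U es fs S R B w) : S ≤ es.length := by
  have h1 := h.mul_le_length
  have h2 := h.fans_le
  have h3 : 1 * S ≤ R * S := Nat.mul_le_mul h.R_pos le_rfl
  omega

theorem lt_word (h : Setup χ₀ U es fs S R B w) {v : ℕ} (hv : v ≤ 20000 * es.length) :
    v < 2 ^ w := by
  refine h.word.lt_of_le (hv.trans ?_)
  have := h.word.edges
  nlinarith

theorem colorDeg_le (h : Setup χ₀ U es fs S R B w) (χ : PartialEdgeColoring G k) (c : Fin k) :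
    χ.colorDeg c ≤ 2 * es.length :=
  (Finset.single_le_sum (f := fun c => χ.colorDeg c) (fun _ _ => Nat.zero_le _)
    (Finset.mem_univ c)).trans (h.deg χ)

/-- Three paths of length at most `4 m`. A conversion begins only while `bud ≤ 15000 m`, so `bud`
never exceeds `15012 m`; this is what makes the running time of an attempt a worst-case bound. -/
theorem convLen_le (h : Setup χ₀ U es fs S R B w) {f : UFan (Fin n) k} (hf : f.IsUFan χ) :
    convLen χ α β f ≤ 12 * es.length := by
  have key : ∀ (a b : Fin k) (x : Fin n), a ∈ χ.miss x → χ.pathLen a b x ≤ 4 * es.length := by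
    intro a b x hx
    have h1 := (isPath_pathSeq (χ := χ) (a := a) (b := b) (x := x) (Or.inl hx)).toIsWalk.length_le
    have := h.colorDeg_le χ a
    have := h.colorDeg_le χ b
    omega
  have h1 := key f.α α f.u hf.miss_u
  have h2 := key f.β β f.v hf.miss_v
  have h3 := key f.β β f.w hf.miss_w
  rw [convLen]; omega

theorem sum_get (h : Setup χ₀ U es fs S R B w) (φ : UFan (Fin n) k → ℝ) :
    ∑ i : Fin fs.length, φ (fs.get i) = ∑ f ∈ U, φ f := by
  have h1 : fs.toFinset = U := by ext f; rw [List.mem_toFinset, h.fans.2]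
  rw [← h1, List.sum_toFinset _ h.fans.1]
  exact Fin.sum_univ_fun_getElem fs φ

end Setup

/-! ### The expected effect of processing a random u-fan -/

/-- The members of `U` that are not processed in a round with the colors `α` and `β`. -/
def badCount (U : Finset (UFan (Fin n) k)) (α β : Fin k) : ℕ :=
  (U.filter fun f => f.α = β ∨ f.β = α).card

open Classical in
/-- One minus a lower bound for the increase of the number of ready u-fans. -/
noncomputable def loss (χ : PartialEdgeColoring G k) (α β : Fin k) (Z : Finset (Fin n))
    (f : UFan (Fin n) k) : ℕ :=
  (if ¬ f.IsUFan χ then 1 else 0) + (if f.α = β ∨ f.β = α then 1 else 0) +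
    -- The weight `3` is the number of ready u-fans that `Converted.ready_insert` allows to be lost.
    3 * if f.IsUFan χ ∧ Hits χ α β Z f then 1 else 0

open Classical in
/-- A bound for the total length of the paths that are flipped. -/
noncomputable def expense (χ : PartialEdgeColoring G k) (α β : Fin k) (f : UFan (Fin n) k) : ℕ :=
  if f.IsUFan χ then convLen χ α β f else 0

theorem sum_loss_le (hU : IsSeparableCollection χ₀ U) (Z : Finset (Fin n)) :
    ∑ f ∈ U, loss χ α β Z f ≤ deadCount U χ + badCount U α β + 21 * k * Z.card := by
  classical
  have h1 : ∑ f ∈ U, loss χ α β Z f = deadCount U χ + badCount U α β +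
      3 * (U.filter fun f => f.IsUFan χ ∧ Hits χ α β Z f).card := by
    simp only [loss, Finset.sum_add_distrib, ← Finset.mul_sum, ← Finset.card_filter, deadCount,
      badCount]
  have h2 := hU.card_hits_le (χ := χ) α β Z
  have h3 : 21 * k * Z.card = 3 * (7 * k * Z.card) := by ring
  rw [h1, h3]
  refine Nat.add_le_add le_rfl (Nat.mul_le_mul le_rfl ?_)
  convert h2

theorem sum_expense_le (hU : IsSeparableCollection χ₀ U) :
    ∑ f ∈ U, expense χ α β f ≤
      k * χ.colorDeg α + 2 * k * χ.colorDeg β + 3 * ∑ c, χ.colorDeg c := by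
  classical
  simp only [expense, ← Finset.sum_filter]
  convert hU.sum_convLen_le α β

/-- The state after `j` u-fans have been processed in a round. -/
structure Sampling (χ₀ : PartialEdgeColoring G k) (U : Finset (UFan (Fin n) k))
    (es : List (Fin n × Fin n)) (fs : List (UFan (Fin n) k)) (S R B : ℕ) (r : ℕ) (α β : Fin k)
    (cnt d₀ D : ℕ) (χ : PartialEdgeColoring G k) (l : List (Fin fs.length)) (bud j : ℕ)
    (s : RAM.State) : Prop where
  mem : InRound χ₀ es fs S R B χ r α β l cnt bud s
  count : s.reg 14 = j
  progress : Progress χ₀ U χ cnt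
  disj : VertDisjoint (fanSet fs l)
  length_le : l.length ≤ j
  dead : deadCount U χ ≤ d₀ + 12 * j
  deg : χ.colorDeg α + χ.colorDeg β ≤ D + 12 * j
  bud_le : bud ≤ 15012 * es.length

theorem card_fanSet_le (l : List (Fin fs.length)) : (fanSet fs l).card ≤ l.length := by
  rw [fanSet]
  exact (List.toFinset_card_le _).trans (by simp)

theorem VertDisjoint.insert {L : Finset (UFan (Fin n) k)} (hL : VertDisjoint L)
    {f : UFan (Fin n) k} (hf : Disjoint f.verts (L.biUnion UFan.verts)) :
    VertDisjoint (insert f L) := by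
  have h : ∀ g ∈ L, Disjoint f.verts g.verts := fun g hg =>
    Finset.disjoint_of_subset_right (Finset.subset_biUnion_of_mem UFan.verts hg) hf
  intro g hg g' hg' hne
  rcases Finset.mem_insert.1 hg with h1 | h1 <;> rcases Finset.mem_insert.1 hg' with h2 | h2
  · exact absurd (h1.trans h2.symm) hne
  · exact h1 ▸ h g' h2
  · exact h2 ▸ (h g h1).symm
  · exact hL g h1 g' h2 hne

variable {d₀ D j : ℕ}

theorem Sampling.step (hS : Setup χ₀ U es fs S R B w)
    (h : Sampling χ₀ U es fs S R B r α β cnt d₀ D χ l bud j s₀) (hr : 0 < r) (hαβ : α ≠ β)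
    (hj : j < S) (hB : bud ≤ B) (i : Fin fs.length) :
    ∃ s χ' l' bud', Sampling χ₀ U es fs S R B r α β cnt d₀ D χ' l' bud' (j + 1) s ∧ bud ≤ bud' ∧
      bud' ≤ bud + expense χ α β (fs.get i) ∧
      readyCount χ α β (fanSet fs l) + 1 ≤ readyCount χ' α β (fanSet fs l') +
        loss χ α β ((fanSet fs l).biUnion UFan.verts) (fs.get i) ∧
      RAM.ExecLe w (.seq (.ite (.lt (.reg 8) (.reg 10)) .skip RAM.sample)
        (.assign 14 (.add (.reg 14) (.const 1)))) (s₀.setReg 17 i) s (20 * (bud' - bud) + 113) := by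
  classical
  have hSm := hS.S_le_length
  have hlen := h.length_le
  have hj' : (j + 1) % 2 ^ w = j + 1 := Nat.mod_eq_of_lt (hS.lt_word (by omega))
  have htest : (RAM.Expr.lt (.reg 8) (.reg 10)).eval w (s₀.setReg 17 i) = 0 := by
    simp only [RAM.Expr.eval, RAM.State.reg_setReg, Nat.reduceEqDiff, if_false, h.mem.static.reg8,
      h.mem.bud]
    rw [if_neg (by omega)]
  obtain ⟨s, χ', bud', l', hb, hs, h14, e1, hcase⟩ := sample_spec hS.word hS.inj hS.edge hS.sep
    hS.mem_U (h.mem.setReg (y := 17) (v := i) (by norm_num) (by norm_num)) hr i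
    (by rw [RAM.State.reg_setReg, if_pos rfl]) hαβ
    (fun hf => hS.lt_word (by
      have := hS.convLen_le (α := α) (β := β) hf; have := hS.B_eq; omega))
    (hS.lt_word (by omega))
  rw [RAM.State.reg_setReg, if_neg (by norm_num), h.count] at h14
  have e2 : RAM.ExecLe w (.assign 14 (.add (.reg 14) (.const 1))) s (s.setReg 14 (j + 1)) 1 := by
    refine ⟨1, le_rfl, ?_⟩
    have := RAM.Exec.assign (w := w) 14 (.add (.reg 14) (.const 1)) s
    simpa only [RAM.Expr.eval, h14, hS.word.one_mod, hj'] using this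
  have hs' := hs.setReg (y := 14) (v := j + 1) (by norm_num) (by norm_num)
  have h14' : (s.setReg 14 (j + 1)).reg 14 = j + 1 := by rw [RAM.State.reg_setReg, if_pos rfl]
  have ht := ((RAM.ExecLe.ite_false (p := .skip) htest e1).seq e2).mono
    (show _ ≤ 20 * (bud' - bud) + 113 by omega)
  rcases hcase with ⟨hf, hne1, hne2, hdis, hcv, rfl, hb2⟩ | ⟨hn, rfl, rfl, rfl⟩
  · refine ⟨_, χ', _, bud', ⟨hs', h14', h.progress.of_none_iff hcv.color_eq_none, ?_, ?_, ?_, ?_, ?_⟩,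
      hb, ?_, ?_, ht⟩
    · rw [fanSet_append]; exact h.disj.insert hdis
    · simp; omega
    · have := hcv.dead_le; have := h.dead; omega
    · have := hcv.colorDeg_le α; have := hcv.colorDeg_le β; have := h.deg; omega
    · have := hS.convLen_le (α := α) (β := β) hf; have := hS.B_eq; omega
    · rw [expense, if_pos hf]; exact hb2
    · obtain ⟨h3, h4⟩ := hcv.ready_insert h.disj hdis
      rw [fanSet_append, loss]
      by_cases hh : Disjoint (convEnds χ α β (fs.get i)) ((fanSet fs l).biUnion UFan.verts)
      · have := h4 hh; omega
      · rw [if_pos (show _ ∧ Hits χ α β _ (fs.get i) from ⟨hf, Or.inr hh⟩)]; omega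
  · refine ⟨_, χ', _, bud', ⟨hs', h14', h.progress, h.disj, by omega, ?_, ?_, h.bud_le⟩,
      hb, by omega, ?_, ht⟩
    · have := h.dead; omega
    · have := h.deg; omega
    · rw [loss]
      -- A rejected u-fan fails one of the tests, each of which is accounted for in `loss`; so the
      -- claimed increase is at most zero.
      have : (1 : ℕ) ≤ (if ¬ (fs.get i).IsUFan χ' then 1 else 0) +
          (if (fs.get i).α = β ∨ (fs.get i).β = α then 1 else 0) +
          3 * if (fs.get i).IsUFan χ' ∧ Hits χ' α β ((fanSet fs l').biUnion UFan.verts) (fs.get i)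
            then 1 else 0 := by
        by_cases h1 : (fs.get i).IsUFan χ'
        · by_cases h2 : (fs.get i).α = β ∨ (fs.get i).β = α
          · rw [if_pos h2]; omega
          · have h3 : Hits χ' α β ((fanSet fs l').biUnion UFan.verts) (fs.get i) := by
              refine Or.inl fun h3 => hn ⟨h1, ?_, ?_, h3⟩ <;> tauto
            rw [if_pos (show _ ∧ Hits χ' α β _ (fs.get i) from ⟨h1, h3⟩)]; omega
        · rw [if_pos h1]; omega
      omega

end

/-! ### Expected effect of the first part of a round. -/

section

open PartialEdgeColoring

variable {n k : ℕ} {G : SimpleGraph (Fin n)} {es : List (Fin n × Fin n)}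
  {χ₀ χ : PartialEdgeColoring G k} {fs : List (UFan (Fin n) k)}
  {S R B w : ℕ} {s₀ : RAM.State} {U : Finset (UFan (Fin n) k)} {r : ℕ} {α β : Fin k}
  {l : List (Fin fs.length)} {cnt bud d₀ D j : ℕ}

/-- At most `S - 1` u-fans were converted before, so the forbidden set has at most `3 * (S - 1)`
vertices, and `63 = 21 * 3`. -/
theorem Sampling.sum_loss_le (hU : IsSeparableCollection χ₀ U)
    (h : Sampling χ₀ U es fs S R B r α β cnt d₀ D χ l bud j s₀) (hj : j < S) :
    ∑ f ∈ U, loss χ α β ((fanSet fs l).biUnion UFan.verts) f ≤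
      d₀ + 12 * (S - 1) + badCount U α β + 63 * k * (S - 1) := by
  have h1 := _root_.sum_loss_le (χ := χ) (α := α) (β := β) hU ((fanSet fs l).biUnion UFan.verts)
  have h2 : ((fanSet fs l).biUnion UFan.verts).card ≤ 3 * (S - 1) := by
    refine (Finset.card_biUnion_le_card_mul _ _ 3 fun f _ => f.card_verts_le).trans ?_
    have := card_fanSet_le l
    have := h.length_le
    omega
  have h3 := h.dead
  have h4 : 21 * k * ((fanSet fs l).biUnion UFan.verts).card ≤ 63 * k * (S - 1) :=
    (Nat.mul_le_mul le_rfl h2).trans (le_of_eq (by ring))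
  omega

theorem Sampling.sum_expense_le (hS : Setup χ₀ U es fs S R B w)
    (h : Sampling χ₀ U es fs S R B r α β cnt d₀ D χ l bud j s₀) (hj : j < S) :
    ∑ f ∈ U, expense χ α β f ≤ 6 * es.length + 2 * k * (D + 12 * S) := by
  have h1 := _root_.sum_expense_le (χ := χ) (α := α) (β := β) hS.sep
  have h2 := hS.deg χ
  have h3 : 2 * k * (χ.colorDeg α + χ.colorDeg β) ≤ 2 * k * (D + 12 * S) :=
    Nat.mul_le_mul le_rfl (h.deg.trans (by omega))
  nlinarith [Nat.zero_le (k * χ.colorDeg α)]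

theorem readyCount_le (l : List (Fin fs.length)) : readyCount χ α β (fanSet fs l) ≤ l.length := by
  classical
  exact (Finset.card_le_card (Finset.filter_subset _ _)).trans (card_fanSet_le l)

/-- Backward induction on the number `d` of remaining draws. A ready u-fan is worth `p`, a unit of
path length costs `b`; a random draw yields at least `A` ready u-fans (`hloss`) and at most length
`C` (`hcost`) in expectation, so each remaining draw is worth `A * p - C * b` in advance. The budget
term in the time bound pays for the actual path lengths. -/
theorem sampleLoop_ensures (hS : Setup χ₀ U es fs S R B w) (hr : 0 < r) (hαβ : α ≠ β) {q : ℝ}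
    (hq0 : 0 ≤ q) (hq1 : q ≤ 1) {Good : RAM.State → Prop} {T N : ℕ} {K : List RAM.Prog}
    {a A C p b : ℝ} (hp : 0 ≤ p) (hb : 0 ≤ b) (hbB : 1 ≤ B * b)
    (hA : A ≤ 1) (hC : 0 ≤ C) (ha : a + S * p ≤ 1)
    (hloss : fs.length * A + (d₀ + 12 * (S - 1) + badCount U α β + 63 * k * (S - 1) : ℕ) ≤
      fs.length)
    (hcost : ((6 * es.length + 2 * k * (D + 12 * S) : ℕ) : ℝ) ≤ fs.length * C)
    (hK : ∀ s χ l bud, Sampling χ₀ U es fs S R B r α β cnt d₀ D χ l bud S s →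
      RAM.Ensures w Good (T + 20 * (15012 * es.length - bud)) N (K, s)
        (gain q (a + readyCount χ α β (fanSet fs l) * p - bud * b)))
    (d : ℕ) (hd : j + d = S) (h : Sampling χ₀ U es fs S R B r α β cnt d₀ D χ l bud j s₀) :
    RAM.Ensures w Good (T + 20 * (15012 * es.length - bud) + d * 116 + 1) N
      (RAM.sampleLoop :: K, s₀)
      (gain q (a + readyCount χ α β (fanSet fs l) * p - bud * b + d * (A * p - C * b))) := by
  induction d generalizing j χ l bud s₀ with
  | zero =>
    obtain rfl : j = S := by omega
    refine (RAM.Ensures.loop_false ?_ (hK _ _ _ _ h)).mono (by omega) (gain_mono hq1 (by simp))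
    simp only [RAM.Expr.eval, h.count, h.mem.static.reg6]
    rw [if_neg (by omega)]
  | succ d ih =>
    have hj : j < S := by omega
    have htest : (RAM.Expr.lt (.reg 14) (.reg 6)).eval w s₀ ≠ 0 := by
      simp only [RAM.Expr.eval, h.count, h.mem.static.reg6, hS.word.one_mod]
      rw [if_pos hj]; norm_num
    have hpos := hS.pos
    have hN : (RAM.Expr.reg 3).eval w s₀ = fs.length := h.mem.static.reg3
    by_cases hB : bud ≤ B
    · refine (RAM.Ensures.loop_true htest (RAM.Ensures.seq (RAM.Ensures.rand_gain (N := fs.length)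
        (t := T + 20 * (15012 * es.length - bud) + d * 116 + 1 + 113)
        (X := fun i => a + (readyCount χ α β (fanSet fs l) + 1 -
          loss χ α β ((fanSet fs l).biUnion UFan.verts) (fs.get i)) * p -
          (bud + expense χ α β (fs.get i)) * b + d * (A * p - C * b)) hN hpos hq0 hq1 ?_ ?_))).mono
        (by ring_nf; omega) le_rfl
      · rw [hS.sum_get fun f => a + (readyCount χ α β (fanSet fs l) + 1 -
          loss χ α β ((fanSet fs l).biUnion UFan.verts) f) * p -
          (bud + expense χ α β f) * b + d * (A * p - C * b)]
        have hcard : (U.card : ℝ) = fs.length := by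
          have := hS.sum_get fun _ => 1
          simpa using this.symm
        have h1 : (∑ f ∈ U, (loss χ α β ((fanSet fs l).biUnion UFan.verts) f : ℝ)) ≤
            fs.length - fs.length * A := by
          have := h.sum_loss_le hS.sep hj
          have : ((∑ f ∈ U, loss χ α β ((fanSet fs l).biUnion UFan.verts) f : ℕ) : ℝ) ≤
            (d₀ + 12 * (S - 1) + badCount U α β + 63 * k * (S - 1) : ℕ) := by exact_mod_cast this
          rw [Nat.cast_sum] at this
          linarith
        have h2 : (∑ f ∈ U, (expense χ α β f : ℝ)) ≤ fs.length * C := by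
          have := h.sum_expense_le hS hj
          have : ((∑ f ∈ U, expense χ α β f : ℕ) : ℝ) ≤
            (6 * es.length + 2 * k * (D + 12 * S) : ℕ) := by exact_mod_cast this
          rw [Nat.cast_sum] at this
          linarith
        simp only [Finset.sum_add_distrib, Finset.sum_sub_distrib, ← Finset.sum_mul,
          Finset.sum_const, nsmul_eq_mul, hcard]
        push_cast
        nlinarith [mul_le_mul_of_nonneg_right h1 hp, mul_le_mul_of_nonneg_right h2 hb]
      · intro i
        obtain ⟨s, χ', l', bud', hs, hb1, hb2, hready, e⟩ := h.step hS hr hαβ hj hB i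
        refine (e.ensures (ih (by omega) hs)).mono ?_ (gain_mono hq1 ?_)
        · have := hs.bud_le
          omega
        · have h1 : (readyCount χ α β (fanSet fs l) : ℝ) + 1 ≤ readyCount χ' α β (fanSet fs l') +
            loss χ α β ((fanSet fs l).biUnion UFan.verts) (fs.get i) := by exact_mod_cast hready
          have h2 : (bud' : ℝ) ≤ bud + expense χ α β (fs.get i) := by exact_mod_cast hb2
          nlinarith [mul_le_mul_of_nonneg_right h1 hp, mul_le_mul_of_nonneg_right h2 hb]
    -- Over budget, `bud * b ≥ 1`, while `ha` bounds the other terms by `1`. So only `q` is claimed,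
    -- and the remaining draws may be idle.
    · have hneg : a + readyCount χ α β (fanSet fs l) * p - bud * b + ↑(d + 1) * (A * p - C * b) ≤
          0 := by
        have h1 : (readyCount χ α β (fanSet fs l) : ℝ) ≤ j := by
          exact_mod_cast (readyCount_le l).trans h.length_le
        have h2 : (B : ℝ) * b ≤ bud * b :=
          mul_le_mul_of_nonneg_right (by exact_mod_cast (not_le.1 hB).le) hb
        have h3 : (j : ℝ) + ((d + 1 : ℕ) : ℝ) = S := by exact_mod_cast hd
        have h4 : (0 : ℝ) ≤ ((d + 1 : ℕ) : ℝ) := Nat.cast_nonneg _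
        have h5 := mul_le_mul_of_nonneg_right h1 hp
        have h6 := mul_le_mul_of_nonneg_left (mul_le_mul_of_nonneg_right hA hp) h4
        have h7 := mul_nonneg h4 (mul_nonneg hC hb)
        rw [← h3] at ha
        nlinarith
      refine (RAM.Ensures.loop_true htest (RAM.Ensures.seq (RAM.Ensures.rand_gain (N := fs.length)
        (t := T + 20 * (15012 * es.length - bud) + d * 116 + 1 + 4)
        (X := fun _ => a + readyCount χ α β (fanSet fs l) * p - bud * b +
          ↑(d + 1) * (A * p - C * b)) hN hpos hq0 hq1 ?_ ?_))).mono
        (by ring_nf; omega) le_rfl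
      · rw [Finset.sum_const, Finset.card_univ, Fintype.card_fin, nsmul_eq_mul]
      · intro i
        rw [gain_of_nonpos q hneg]
        set s₁ := s₀.setReg 17 i with hs₁
        have hm : (j + 1) % 2 ^ w = j + 1 :=
          Nat.mod_eq_of_lt (hS.lt_word (by have := hS.S_le_length; omega))
        have g14 : s₁.reg 14 = j := by rw [hs₁, RAM.State.reg_setReg, if_neg (by norm_num), h.count]
        have e : RAM.ExecLe w (.seq (.ite (.lt (.reg 8) (.reg 10)) .skip RAM.sample)
            (.assign 14 (.add (.reg 14) (.const 1)))) s₁ (s₁.setReg 14 (j + 1)) 4 := by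
          refine (RAM.ExecLe.ite_true ?_ ⟨1, le_rfl, .skip _⟩).seq ⟨1, le_rfl, ?_⟩
          · simp only [RAM.Expr.eval, hs₁, RAM.State.reg_setReg, Nat.reduceEqDiff, if_false,
              h.mem.static.reg8, h.mem.bud, hS.word.one_mod]
            rw [if_pos (by omega)]; norm_num
          · have := RAM.Exec.assign (w := w) 14 (.add (.reg 14) (.const 1)) s₁
            simpa only [RAM.Expr.eval, g14, hS.word.one_mod, hm] using this
        have hs : Sampling χ₀ U es fs S R B r α β cnt d₀ D χ l bud (j + 1)
            (s₁.setReg 14 (j + 1)) := by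
          refine ⟨(h.mem.setReg (by norm_num) (by norm_num)).setReg (by norm_num) (by norm_num), ?_,
            h.progress, h.disj, h.length_le.trans (by omega), h.dead.trans (by omega),
            h.deg.trans (by omega), h.bud_le⟩
          rw [RAM.State.reg_setReg, if_pos rfl]
        exact (e.ensures (ih (by omega) hs)).mono (by omega) (le_gain hq1 _)

end

/-! ### Rounds and attempts. -/

section

open PartialEdgeColoring

namespace RAM

/-- Choose the two colors of a round. -/
def choose : Prog := .block
  [.assign 12 (.add (.reg 12) (.const 1)),
    .assign 13 (.add (.mul (.reg 12) (.lt (.reg 12) (.reg 4))) (.const 1)),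
    .assign 11 (.add (.reg 11) (.const 1)), .assign 15 (.const 0), .assign 14 (.const 0)]

/-- One round, with a random color and the next one. -/
def round : Prog := .seq (.rand 12 (.reg 4)) <| .seq choose <| .seq sampleLoop <|
  .ite (.lt (.reg 8) (.reg 10)) .skip (.seq (.assign 16 (.const 0)) finishLoop)

end RAM

/-- The cyclically next color. -/
def nextColor {k : ℕ} (α : Fin k) : Fin k :=
  ⟨if (α : ℕ) + 1 < k then (α : ℕ) + 1 else 0, by have := α.isLt; split <;> omega⟩

theorem nextColor_val {k : ℕ} (α : Fin k) :
    (nextColor α).val = if (α : ℕ) + 1 < k then (α : ℕ) + 1 else 0 := rfl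

theorem nextColor_ne {k : ℕ} (hk : 2 ≤ k) (α : Fin k) : α ≠ nextColor α := by
  intro h
  have := congrArg Fin.val h
  rw [nextColor_val] at this
  split at this <;> omega

theorem nextColor_injective {k : ℕ} : Function.Injective (nextColor (k := k)) := by
  intro a b h
  have h1 := congrArg Fin.val h
  rw [nextColor_val, nextColor_val] at h1
  have := a.isLt
  have := b.isLt
  ext
  split at h1 <;> split at h1 <;> omega

variable {n k : ℕ} {G : SimpleGraph (Fin n)} {es : List (Fin n × Fin n)}
  {χ₀ χ : PartialEdgeColoring G k} {fs : List (UFan (Fin n) k)}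
  {S R B w : ℕ} {s₀ : RAM.State} {U : Finset (UFan (Fin n) k)} {r : ℕ} {cnt bud : ℕ}

/-- The number of pairs of a vertex and one of the two colors of a round that it does not miss. -/
noncomputable def pairDeg (χ : PartialEdgeColoring G k) (α : Fin k) : ℕ :=
  χ.colorDeg α + χ.colorDeg (nextColor α)

/-- The successor is a bijection on the colors, so `β` is as uniformly distributed as `α`. -/
theorem Setup.sum_pairDeg_le (hS : Setup χ₀ U es fs S R B w) (χ : PartialEdgeColoring G k) :
    ∑ α, pairDeg χ α ≤ 4 * es.length := by
  have h1 : ∑ α, χ.colorDeg (nextColor α) = ∑ α, χ.colorDeg α :=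
    (Finite.injective_iff_bijective.1 nextColor_injective).sum_comp fun c => χ.colorDeg c
  have := hS.deg χ
  simp only [pairDeg, Finset.sum_add_distrib, h1]
  omega

/-- A member is excluded for at most two values of `α`: the predecessor of its `α` and its own `β`.
-/
theorem sum_badCount_le (U : Finset (UFan (Fin n) k)) :
    ∑ α, badCount U α (nextColor α) ≤ 2 * U.card := by
  simp only [badCount, Finset.card_filter]
  rw [Finset.sum_comm, mul_comm, ← smul_eq_mul]
  refine Finset.sum_le_card_nsmul _ _ _ fun f _ => ?_
  rw [← Finset.card_filter]
  have h : (Finset.univ.filter fun α => f.α = nextColor α ∨ f.β = α) ⊆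
      (Finset.univ.filter fun α => f.α = nextColor α) ∪ {f.β} := by
    intro α hα
    simp only [Finset.mem_filter, Finset.mem_union, Finset.mem_singleton, Finset.mem_univ,
      true_and] at hα ⊢
    rcases hα with h | h
    · exact Or.inl h
    · exact Or.inr h.symm
  refine (Finset.card_le_card h).trans ((Finset.card_union_le _ _).trans ?_)
  have : (Finset.univ.filter fun α => f.α = nextColor α).card ≤ 1 := by
    refine Finset.card_le_one.2 fun a ha b hb => nextColor_injective ?_
    rw [← (Finset.mem_filter.1 ha).2, ← (Finset.mem_filter.1 hb).2]
  simp; omega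

/-- A lower bound for the expected relative increase of the number of ready u-fans. -/
noncomputable def readyRate (U : Finset (UFan (Fin n) k)) (lam : ℕ) (α : Fin k) : ℝ :=
  1397 / 1500 - badCount U α (nextColor α) / lam

/-- An upper bound for the expected total length of the paths that are flipped for a u-fan. -/
noncomputable def expenseRate (χ : PartialEdgeColoring G k) (m S lam : ℕ) (α : Fin k) : ℝ :=
  (6 * m + 2 * k * (pairDeg χ α + 12 * S)) / lam

/-- Summed over all `α`, the bad members cost at most `2`, so the readiness term is at least `(1397
/ 1500 * k - 2) / (4 * R)`; here `3 ≤ k` is essential. The lengths, including those of the second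
part, amount to at most `83 * m * k / R`, which is small against `B = 15000 * m`. What remains
covers the bonus `3 / (64 * R)` that the potential loses per round. -/
theorem Setup.drift (hS : Setup χ₀ U es fs S R B w) (χ : PartialEdgeColoring G k) :
    k * (3 / (64 * R) : ℝ) ≤ ∑ α : Fin k, (S * (readyRate U fs.length α * (4 * (R * S) : ℝ)⁻¹ -
      expenseRate χ es.length S fs.length α * (B : ℝ)⁻¹) -
      2 * (pairDeg χ α + 12 * S) * (B : ℝ)⁻¹) := by
  have hU : U.card = fs.length := by
    have := hS.sum_get fun _ => 1
    have : (fs.length : ℝ) = U.card := by simpa using this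
    exact_mod_cast this.symm
  have hl : (0 : ℝ) < fs.length := by exact_mod_cast hS.pos
  have hm : (0 : ℝ) < es.length := by exact_mod_cast hS.length_pos
  have hRp : (0 : ℝ) < R := by exact_mod_cast hS.R_pos
  have hSp : (0 : ℝ) < S := by exact_mod_cast hS.S_pos
  have hk : (3 : ℝ) ≤ k := by exact_mod_cast hS.three_le
  have hlm : 2 * (fs.length : ℝ) ≤ es.length := by exact_mod_cast hS.fans_le
  have hkm : (k : ℝ) ≤ 2 * es.length := by exact_mod_cast hS.colors_le
  have hRk : (R : ℝ) ≤ k := by exact_mod_cast hS.R_le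
  have hN : (R : ℝ) * S ≤ fs.length := by exact_mod_cast hS.mul_le_length
  -- `k * (S - 1) ≤ λ / 1500 ≤ m / 3000`, and the rounding up of `S` adds `k ≤ 2 * m`.
  have hSk : (k : ℝ) * S ≤ 2.01 * es.length := by
    have h1 := hS.S_le
    have h2 := hS.S_pos
    obtain ⟨S', rfl⟩ : ∃ S', S = S' + 1 := ⟨S - 1, by omega⟩
    rw [Nat.add_sub_cancel] at h1
    have h3 : (1500 : ℝ) * k * S' ≤ fs.length := by exact_mod_cast h1
    push_cast
    nlinarith
  have hbad : (∑ α : Fin k, (badCount U α (nextColor α) : ℝ)) ≤ 2 * fs.length := by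
    rw [← hU]
    exact_mod_cast sum_badCount_le U
  have hdeg : (∑ α : Fin k, (pairDeg χ α : ℝ)) ≤ 4 * es.length := by
    exact_mod_cast hS.sum_pairDeg_le χ
  set sb := ∑ α : Fin k, (badCount U α (nextColor α) : ℝ) with hsb
  set sd := ∑ α : Fin k, (pairDeg χ α : ℝ) with hsd
  have hBe : (B : ℝ) = 15000 * es.length := by exact_mod_cast hS.B_eq
  have hsum : ∑ α : Fin k, (S * (readyRate U fs.length α * (4 * (R * S) : ℝ)⁻¹ -
      expenseRate χ es.length S fs.length α * (B : ℝ)⁻¹) -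
      2 * (pairDeg χ α + 12 * S) * (B : ℝ)⁻¹) =
      S * ((k * (1397 / 1500) - sb / fs.length) * (4 * (R * S) : ℝ)⁻¹ -
        (6 * es.length * k + 2 * k * (sd + 12 * S * k)) / fs.length * (B : ℝ)⁻¹) -
      2 * (sd + 12 * S * k) * (B : ℝ)⁻¹ := by
    simp only [readyRate, expenseRate, Finset.sum_sub_distrib, ← Finset.mul_sum, ← Finset.sum_mul,
      ← Finset.sum_div, Finset.sum_add_distrib, Finset.sum_const, Finset.card_univ,
      Fintype.card_fin, nsmul_eq_mul, ← hsb, ← hsd]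
    ring
  rw [hsum]
  have hready : (k * (1397 / 1500) - 2 : ℝ) ≤ k * (1397 / 1500) - sb / fs.length := by
    have : sb / fs.length ≤ 2 := (div_le_iff₀ hl).2 hbad
    linarith
  -- The coefficient collects `6 + 56.24` from the conversions (`2 * (4 + 12 * 2.01) = 56.24`) and
  -- `8 + 12` from the second part.
  have hX : R * (S * ((6 * es.length * k + 2 * k * (sd + 12 * S * k)) / fs.length) +
      2 * (sd + 12 * S * k)) ≤ 83 * es.length * k := by
    have h1 : R * (S * ((6 * es.length * k + 2 * k * (sd + 12 * S * k)) / fs.length)) ≤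
        6 * es.length * k + 2 * k * (sd + 12 * S * k) := by
      have hnn : (0 : ℝ) ≤ 6 * es.length * k + 2 * k * (sd + 12 * S * k) := by positivity
      rw [← mul_assoc, mul_div_assoc', div_le_iff₀ hl, mul_comm _ (fs.length : ℝ)]
      exact mul_le_mul_of_nonneg_right hN hnn
    have h2 : 2 * k * (sd + 12 * S * k) ≤ k * (56.24 * es.length) := by nlinarith
    have h3 : R * sd ≤ k * (4 * es.length) := by gcongr
    have h4 : (R : ℝ) * (24 * S * k) ≤ k * (12 * es.length) := by
      calc (R : ℝ) * (24 * S * k) = k * (24 * (R * S)) := by ring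
        _ ≤ k * (12 * es.length) := mul_le_mul_of_nonneg_left (by linarith) (by linarith)
    nlinarith
  have hSR : (S : ℝ) * (4 * (R * S) : ℝ)⁻¹ = (4 * R : ℝ)⁻¹ := by field_simp
  have hfin : k * (3 / (64 * R) : ℝ) ≤ (k * (1397 / 1500) - 2) * (4 * R : ℝ)⁻¹ -
      (S * ((6 * es.length * k + 2 * k * (sd + 12 * S * k)) / fs.length) +
        2 * (sd + 12 * S * k)) * (B : ℝ)⁻¹ := by
    have h1 : (S * ((6 * es.length * k + 2 * k * (sd + 12 * S * k)) / fs.length) +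
        2 * (sd + 12 * S * k)) * (B : ℝ)⁻¹ ≤ 83 * k / (15000 * R) := by
      rw [hBe, ← div_eq_mul_inv, div_le_div_iff₀ (by positivity) (by positivity)]
      nlinarith
    -- Over the common denominator `4 * R` this says `k * (3 / 16 + 332 / 15000) ≤ 1397 / 1500 * k -
    -- 2`, which holds from `k = 3` on.
    have h2 : k * (3 / (64 * R) : ℝ) + 83 * k / (15000 * R) ≤
        (k * (1397 / 1500) - 2) * (4 * R : ℝ)⁻¹ := by
      have : k * (3 / (64 * R) : ℝ) + 83 * k / (15000 * R) =
        (k * (3 / 16) + 83 * k * 4 / 15000) * (4 * R : ℝ)⁻¹ := by field_simp; ring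
      rw [this]
      gcongr
      linarith
    linarith
  have := mul_le_mul_of_nonneg_right hready (show 0 ≤ (4 * R : ℝ)⁻¹ by positivity)
  rw [← hSR] at this hfin
  linarith

/-- The state after `r` rounds of an attempt. -/
structure Attempt (χ₀ : PartialEdgeColoring G k) (U : Finset (UFan (Fin n) k))
    (es : List (Fin n × Fin n)) (fs : List (UFan (Fin n) k)) (S R B : ℕ) (r : ℕ)
    (χ : PartialEdgeColoring G k) (cnt bud : ℕ) (s : RAM.State) : Prop where
  mem : Between χ₀ es fs S R B χ r cnt bud s
  progress : Progress χ₀ U χ cnt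
  dead : deadCount U χ ≤ 19 * (S * r)
  cnt_le : cnt ≤ S * r
  bud_le : bud ≤ 15012 * es.length

theorem choose_spec (hS : Setup χ₀ U es fs S R B w) (h : Attempt χ₀ U es fs S R B r χ cnt bud s₀)
    (hr : r < R) (α : Fin k) :
    ∃ s, Sampling χ₀ U es fs S R B (r + 1) α (nextColor α) cnt (19 * (S * r)) (pairDeg χ α)
      χ [] bud 0 s ∧ RAM.ExecLe w RAM.choose (s₀.setReg 12 α) s 9 := by
  set s := RAM.choose.sem w (s₀.setReg 12 α) with hs
  have hk := α.isLt
  have hw := hS.word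
  have hwk : ∀ v ≤ k, v % 2 ^ w = v := fun v hv =>
    Nat.mod_eq_of_lt (hw.small_lt (by have := hw.colors; omega))
  have m1 : ((α : ℕ) + 1) % 2 ^ w = α + 1 := hwk _ (by omega)
  have m2 : (((α : ℕ) + 1) * (if (α : ℕ) + 1 < k then 1 else 0) % 2 ^ w + 1) % 2 ^ w =
      nextColor α + 1 := by
    rw [nextColor_val]
    split
    · rw [mul_one, m1, hwk _ (by omega)]
    · rw [mul_zero, Nat.zero_mod, hwk _ (by omega)]
  have m3 : (r + 1) % 2 ^ w = r + 1 := hwk _ (by have := hS.R_le; omega)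
  have g : ∀ y, s.reg y = if y = 14 then 0 else if y = 15 then 0 else if y = 11 then r + 1 else
      if y = 13 then (nextColor α + 1 : ℕ) else if y = 12 then (α + 1 : ℕ) else s₀.reg y := by
    intro y
    simp only [hs, RAM.choose, RAM.Prog.block, RAM.Prog.sem, RAM.State.reg_setReg, RAM.Expr.eval,
      Nat.reduceEqDiff, if_true, if_false, hw.one_mod, m1, h.mem.static.reg4, m2, h.mem.round, m3,
      Nat.zero_mod]
    split_ifs <;> simp_all
  have k1 : s.mem = s₀.mem := rfl
  refine ⟨s, ⟨⟨⟨?_, ⟨h.mem.rep.col, h.mem.rep.tab⟩, ?_, ?_, ?_, ?_, ?_, ?_, by simp⟩, ?_, ?_, ?_⟩, ?_,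
    h.progress, ?_, by simp, h.dead.trans (by omega), by rw [pairDeg]; omega, h.bud_le⟩,
    RAM.ExecLe.straight w (by simp [RAM.choose, RAM.Prog.block, RAM.Prog.Straight]) _⟩
  · refine h.mem.static.of_eq (fun y hy => ?_) fun _ _ _ => rfl
    rw [g, if_neg, if_neg, if_neg, if_neg, if_neg] <;> omega
  · rw [g]; exact h.mem.cnt
  · rw [g]; exact h.mem.bud
  · rw [g]; rfl
  · rw [g]; rfl
  · rw [g]; rfl
  · rw [g]; rfl
  · intro z hz
    exact Nat.lt_succ_of_le (h.mem.stamp_le z hz)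
  · intro z hz
    exact (h.mem.mark_le z hz).trans (by omega)
  · intro z hz
    have := h.mem.mark_le z hz
    rw [k1]
    simp only [fanSet, List.map_nil, List.toFinset_nil, Finset.biUnion_empty,
      Finset.notMem_empty, iff_false]
    omega
  · rw [g]; rfl
  · intro f hf; simp [fanSet] at hf

/-- A lower bound for the probability that an attempt is successful after `r` rounds, if it is
positive. -/
noncomputable def potential (S R B r cnt bud : ℕ) : ℝ :=
  cnt * (R * S : ℝ)⁻¹ - 1 / 32 - bud * (B : ℝ)⁻¹ + (R - r) * (3 / (64 * R))

/-- A ready u-fan is valued at `p = 1 / (4 * R * S)`, a quarter of a colored edge, which the second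
part delivers. The maximal length of the second part, after up to `S` conversions, is deducted
beforehand in `a`. `Setup.drift` shows that the random choice of `α` makes up for the decrease of
the bonus. -/
theorem round_ensures (hS : Setup χ₀ U es fs S R B w) {q : ℝ} (hq0 : 0 ≤ q) (hq1 : q ≤ 1)
    {Good : RAM.State → Prop} {T N : ℕ} {K : List RAM.Prog} (hr : r < R)
    (hK : ∀ s χ cnt bud, Attempt χ₀ U es fs S R B (r + 1) χ cnt bud s →
      RAM.Ensures w Good (T + 20 * (15012 * es.length - bud)) N (K, s)
        (gain q (potential S R B (r + 1) cnt bud)))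
    (h : Attempt χ₀ U es fs S R B r χ cnt bud s₀) :
    RAM.Ensures w Good (T + 20 * (15012 * es.length - bud) + S * 230 + 20) N (RAM.round :: K, s₀)
      (gain q (potential S R B r cnt bud)) := by
  have hl : (0 : ℝ) < fs.length := by exact_mod_cast hS.pos
  have hRp : (0 : ℝ) < R := by exact_mod_cast hS.R_pos
  have hSp : (0 : ℝ) < S := by exact_mod_cast hS.S_pos
  have hBp : (0 : ℝ) < B := by
    have := hS.B_eq; have := hS.length_pos
    exact_mod_cast (show 0 < B by omega)
  have hb : (0 : ℝ) ≤ (B : ℝ)⁻¹ := by positivity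
  have hp : (0 : ℝ) ≤ (4 * (R * S) : ℝ)⁻¹ := by positivity
  have hk := hS.three_le
  have hrR : ((r + 1 : ℕ) : ℝ) ≤ R := by exact_mod_cast hr
  have hrS : ∀ j < S, S * r + j + 1 ≤ R * S := by
    intro j hj
    calc S * r + j + 1 ≤ S * r + S := by omega
      _ = S * (r + 1) := by ring
      _ ≤ S * R := Nat.mul_le_mul le_rfl hr
      _ = R * S := mul_comm _ _
  refine ((RAM.Ensures.rand_gain (N := k) (t := T + 20 * (15012 * es.length - bud) + S * 230 + 18)
    (X := fun α => cnt * (R * S : ℝ)⁻¹ - 1 / 32 - bud * (B : ℝ)⁻¹ +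
      (R - (r + 1 : ℕ)) * (3 / (64 * R)) +
      (S * (readyRate U fs.length α * (4 * (R * S) : ℝ)⁻¹ -
        expenseRate χ es.length S fs.length α * (B : ℝ)⁻¹) -
      2 * (pairDeg χ α + 12 * S) * (B : ℝ)⁻¹))
      (show (RAM.Expr.reg 4).eval w s₀ = k from h.mem.static.reg4) (by omega) hq0 hq1 ?_ ?_).seq).mono
      (by omega) le_rfl
  · have := hS.drift χ
    rw [Finset.sum_add_distrib, Finset.sum_const, Finset.card_univ, Fintype.card_fin, nsmul_eq_mul,
      potential]
    push_cast
    linarith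
  intro α
  obtain ⟨s₁, h1, e1⟩ := choose_spec hS h hr α
  have hαβ := nextColor_ne (by omega) α
  set a : ℝ := cnt * (R * S : ℝ)⁻¹ - 1 / 32 + (R - (r + 1 : ℕ)) * (3 / (64 * R)) -
    2 * (pairDeg χ α + 12 * S) * (B : ℝ)⁻¹ with ha
  -- The edges colored so far contribute at most `r / R`, this round `1 / (4 * R)`, and the bonus
  -- for the rounds to come at most `(R - (r + 1)) / R`.
  have ha' : a + S * (4 * (R * S) : ℝ)⁻¹ ≤ 1 := by
    have h2 : (cnt : ℝ) ≤ S * r := by exact_mod_cast h.cnt_le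
    have h3 : (cnt : ℝ) * (R * S : ℝ)⁻¹ ≤ r / R := by
      calc (cnt : ℝ) * (R * S : ℝ)⁻¹ ≤ S * r * (R * S : ℝ)⁻¹ := by gcongr
        _ = r / R := by field_simp
    have h4 : (S : ℝ) * (4 * (R * S) : ℝ)⁻¹ = 1 / 4 / R := by field_simp
    have h5 : (R - (r + 1 : ℕ)) * (3 / (64 * R)) ≤ (R - (r + 1 : ℕ) : ℝ) / R := by
      rw [div_eq_mul_inv _ (R : ℝ)]
      refine mul_le_mul_of_nonneg_left ?_ (by linarith)
      rw [div_le_iff₀ (by positivity)]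
      field_simp
      norm_num
    have h6 : (0 : ℝ) ≤ 2 * (pairDeg χ α + 12 * S) * (B : ℝ)⁻¹ := by positivity
    have h7 : (r : ℝ) / R + 1 / 4 / R + (R - (r + 1 : ℕ) : ℝ) / R ≤ 1 := by
      rw [← add_div, ← add_div, div_le_one hRp]
      push_cast
      linarith
    rw [ha, h4]
    linarith
  have hA : readyRate U fs.length α ≤ 1 := by
    have : (0 : ℝ) ≤ badCount U α (nextColor α) / fs.length := by positivity
    rw [readyRate]; linarith
  have hloss : fs.length * readyRate U fs.length α +
      (19 * (S * r) + 12 * (S - 1) + badCount U α (nextColor α) + 63 * k * (S - 1) : ℕ) ≤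
      (fs.length : ℝ) := by
    have h2 := hS.S_le
    have h3 := hS.mul_le
    have h4 := hrS (S - 1) (by have := hS.S_pos; omega)
    -- The conflicts give `63 * λ` by `Setup.S_le`. The damage is at most `19 * (R * S - 1)`, as a
    -- round damages `12 + 7` members per draw, and gives `38 * λ` by `Setup.mul_le`.
    have h5 : 1500 * (19 * (S * r) + 12 * (S - 1) + 63 * k * (S - 1)) ≤ 103 * fs.length := by
      nlinarith
    have h6 : (1500 : ℝ) * ((19 * (S * r) + 12 * (S - 1) + 63 * k * (S - 1) : ℕ) : ℝ) ≤
      103 * fs.length := by exact_mod_cast h5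
    have h7 : (fs.length : ℝ) * (badCount U α (nextColor α) / fs.length) =
      badCount U α (nextColor α) := by field_simp
    rw [readyRate, mul_sub, h7]
    push_cast at h6 ⊢
    linarith
  have hcost : ((6 * es.length + 2 * k * (pairDeg χ α + 12 * S) : ℕ) : ℝ) ≤
      fs.length * expenseRate χ es.length S fs.length α := by
    rw [expenseRate, mul_div_cancel₀ _ hl.ne']
    push_cast
    exact le_rfl
  have hC : 0 ≤ expenseRate χ es.length S fs.length α := by rw [expenseRate]; positivity
  have hloop := sampleLoop_ensures (T := T + S * 114 + 5)
    (K := .ite (.lt (.reg 8) (.reg 10)) .skip (.seq (.assign 16 (.const 0)) RAM.finishLoop) :: K)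
    (Good := Good) (N := N) hS (Nat.succ_pos r) hαβ hq0 hq1 hp hb
    (le_of_eq (mul_inv_cancel₀ hBp.ne').symm) hA hC ha' hloss hcost ?_ S (zero_add S) h1
  · refine (e1.ensures hloop.seq).seq.mono (by omega) (gain_mono hq1 ?_)
    have h0 : readyCount χ α (nextColor α) (fanSet fs []) = 0 := Nat.le_zero.1 (readyCount_le _)
    rw [h0, ha]
    push_cast
    linarith
  intro s₂ χ₂ l bud₂ h2
  have hV : (readyCount χ₂ α (nextColor α) (fanSet fs l) : ℝ) ≤ S := by
    exact_mod_cast (readyCount_le l).trans h2.length_le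
  by_cases hB : bud₂ ≤ B
  · have hd1 := hS.colorDeg_le χ₂ α
    have hd2 := hS.colorDeg_le χ₂ (nextColor α)
    have hB' := hS.B_eq
    have hlen := h2.length_le
    have hcnt := h2.progress
    have hSl := hS.mul_le_length
    have hfl := hS.fans_le
    have h4 := hrS (S - 1) (by have := hS.S_pos; omega)
    have hc := h.cnt_le
    obtain ⟨s₃, χ₃, cnt₃, bud₃, h3, hP3, hb1, hb2, hc3, hd3, hV3, e3⟩ := finishAll_spec hS.word hS.inj
      hS.edge hS.sep hS.mem_U hαβ h2.disj h2.mem h2.progress (hS.lt_word (by omega))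
      (hS.lt_word (by omega))
    have htest : (RAM.Expr.lt (.reg 8) (.reg 10)).eval w s₂ = 0 := by
      simp only [RAM.Expr.eval, h2.mem.static.reg8, h2.mem.bud]
      rw [if_neg (by omega)]
    have hdeg := h2.deg
    have hatt : Attempt χ₀ U es fs S R B (r + 1) χ₃ cnt₃ bud₃ s₃ := by
      refine ⟨h3, hP3, ?_, ?_, by omega⟩
      · have := h2.dead
        rw [mul_add, mul_one]
        omega
      · rw [mul_add, mul_one]; omega
    refine ((RAM.ExecLe.ite_false htest e3).ensures (hK _ _ _ _ hatt)).mono ?_ (gain_mono hq1 ?_)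
    · have := hatt.bud_le
      omega
    · have hb3 : (bud₃ : ℝ) ≤ bud₂ + 2 * (pairDeg χ α + 12 * S) := by
        exact_mod_cast (show bud₃ ≤ bud₂ + 2 * (pairDeg χ α + 12 * S) by omega)
      have hV4 : (readyCount χ₂ α (nextColor α) (fanSet fs l) : ℝ) + 4 * cnt ≤ 4 * cnt₃ := by
        exact_mod_cast hV3
      have h5 : (4 * (R * S) : ℝ)⁻¹ = (R * S : ℝ)⁻¹ / 4 := by field_simp
      have h6 : (0 : ℝ) ≤ (R * S : ℝ)⁻¹ := by positivity
      rw [ha, potential, h5]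
      nlinarith [mul_le_mul_of_nonneg_right hb3 hb, mul_le_mul_of_nonneg_right hV4 h6]
  · have htest : (RAM.Expr.lt (.reg 8) (.reg 10)).eval w s₂ ≠ 0 := by
      simp only [RAM.Expr.eval, h2.mem.static.reg8, h2.mem.bud, hS.word.one_mod]
      rw [if_pos (by omega)]; norm_num
    have hatt : Attempt χ₀ U es fs S R B (r + 1) χ₂ cnt bud₂ s₂ := by
      refine ⟨h2.mem.inFinal.between, h2.progress, ?_, ?_, h2.bud_le⟩
      · have := h2.dead
        rw [mul_add, mul_one]
        omega
      · have := h.cnt_le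
        rw [mul_add, mul_one]; omega
    refine ((RAM.ExecLe.ite_true htest ⟨1, le_rfl, .skip _⟩).ensures (hK _ _ _ _ hatt)).mono
      (by omega) ?_
    -- Over budget the second part is skipped; the potential is not positive, so any attempt state
    -- will do.
    rw [gain_of_nonpos]
    · exact le_gain hq1 _
    · have h5 : (B : ℝ) * (B : ℝ)⁻¹ ≤ bud₂ * (B : ℝ)⁻¹ :=
        mul_le_mul_of_nonneg_right (by exact_mod_cast (not_le.1 hB).le) hb
      rw [mul_inv_cancel₀ hBp.ne'] at h5
      have := mul_le_mul_of_nonneg_right hV hp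
      linarith

theorem attempt_ensures (hS : Setup χ₀ U es fs S R B w) {q : ℝ} (hq0 : 0 ≤ q) (hq1 : q ≤ 1)
    {Good : RAM.State → Prop} {T N : ℕ} {K : List RAM.Prog}
    (hK : ∀ s χ cnt bud, Attempt χ₀ U es fs S R B R χ cnt bud s →
      RAM.Ensures w Good T N (K, s) (gain q (potential S R B R cnt bud)))
    (d : ℕ) (hd : r + d = R) (h : Attempt χ₀ U es fs S R B r χ cnt bud s₀) :
    RAM.Ensures w Good (T + 20 * (15012 * es.length - bud) + d * (S * 230 + 21) + 1) N
      (.loop (.lt (.reg 11) (.reg 7)) RAM.round :: K, s₀)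
      (gain q (potential S R B r cnt bud)) := by
  induction d generalizing r χ cnt bud s₀ with
  | zero =>
    obtain rfl : r = R := by omega
    refine (RAM.Ensures.loop_false ?_ (hK _ _ _ _ h)).mono (by omega) le_rfl
    simp only [RAM.Expr.eval, h.mem.round, h.mem.static.reg7]
    rw [if_neg (by omega)]
  | succ d ih =>
    have htest : (RAM.Expr.lt (.reg 11) (.reg 7)).eval w s₀ ≠ 0 := by
      simp only [RAM.Expr.eval, h.mem.round, h.mem.static.reg7, hS.word.one_mod]
      rw [if_pos (by omega)]; norm_num
    refine (RAM.Ensures.loop_true htest (round_ensures (T := T + d * (S * 230 + 21) + 1) hS hq0 hq1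
      (by omega) (fun s χ cnt bud h' => ?_) h)).mono (by ring_nf; omega) le_rfl
    exact (ih (by omega) h').mono (by omega) le_rfl

end

/-! ### Restoring the original coloring. -/

section

open PartialEdgeColoring

/-! ### Initialization -/

namespace RAM

/-- Load the endpoints of the edge with the index in register 16. -/
def loadEdge : List Prog := [.assign 18 (.read 0 (.reg 16)), .assign 19 (.read 1 (.reg 16))]

def nextEdge : Prog := .assign 16 (.add (.reg 16) (.const 1))

/-- Execute the statements for all edges. -/
def forEdges (l : List Prog) : Prog := .seq (.assign 16 (.const 0))
  (.loop (.lt (.reg 16) (.reg 1)) (.block (loadEdge ++ l ++ [nextEdge])))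

/-- Remove the current edge from the tables. -/
def clearEdge : List Prog :=
  [.assign 21 (.read 2 (.reg 16)), .write 10 (tabIdx 18 21) (.const 0),
    .write 10 (tabIdx 19 21) (.const 0), .write 11 (.reg 18) (.const 0),
    .write 11 (.reg 19) (.const 0), .write 12 (.reg 18) (.const 0), .write 12 (.reg 19) (.const 0)]

/-- Give the current edge its original color. -/
def restoreEdge : List Prog :=
  [.assign 21 (.read 8 (.reg 16)), .write 2 (.reg 16) (.reg 21),
    .write 10 (tabIdx 18 21) (.add (.reg 16) (.const 1)),
    .write 10 (tabIdx 19 21) (.add (.reg 16) (.const 1))]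

/-- Restore the original coloring. -/
def reset : Prog := .seq (forEdges clearEdge) <| .seq (forEdges restoreEdge) <|
  .block [.assign 9 (.const 0), .assign 10 (.const 0), .assign 11 (.const 0)]

/-- Save the color of the current edge, and enter it into the adjacency table. -/
def enterEdge : List Prog :=
  [.write 8 (.reg 16) (.read 2 (.reg 16)), .write 9 (adjIdx 18 19) (.add (.reg 16) (.const 1)),
    .write 9 (adjIdx 19 18) (.add (.reg 16) (.const 1))]

/-- Compute the parameters. -/
def parameters : Prog := .block
  [.assign 4 (.add (.reg 2) (.const 1)), .assign 5 (.add (.reg 4) (.const 1)),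
    .assign 6 (.add (.div (.reg 3) (.mul (.const 1500) (.reg 4))) (.const 1)),
    .assign 7 (.sub (.reg 4) (.sub (.reg 4) (.add (.div (.reg 3) (.const 1500)) (.const 1)))),
    .assign 8 (.mul (.const 15000) (.reg 1))]

end RAM

variable {n k : ℕ} {G : SimpleGraph (Fin n)} {es : List (Fin n × Fin n)}
  {χ₀ χ : PartialEdgeColoring G k} {fs : List (UFan (Fin n) k)}
  {S R B w : ℕ} {s₀ : RAM.State} {U : Finset (UFan (Fin n) k)}

theorem forEdges_spec (hw : WordBounds n k es.length w) {l : List RAM.Prog} {T : ℕ}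
    {I : ℕ → RAM.State → Prop} (h1 : ∀ i s, I i s → s.reg 1 = es.length ∧ s.reg 16 = i)
    (h0 : I 0 (s₀.setReg 16 0))
    (hI : ∀ (i : Fin es.length) s, I i s → ∃ s', I (i + 1) s' ∧
      RAM.ExecLe w (.block (RAM.loadEdge ++ l ++ [RAM.nextEdge])) s s' T) :
    ∃ s, I es.length s ∧ RAM.ExecLe w (RAM.forEdges l) s₀ s (es.length * (T + 1) + 3) := by
  have e1 : RAM.ExecLe w (.assign 16 (.const 0)) s₀ (s₀.setReg 16 0) 1 := by
    refine ⟨1, le_rfl, ?_⟩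
    have := RAM.Exec.assign (w := w) 16 (.const 0) s₀
    rwa [RAM.Expr.eval, Nat.zero_mod] at this
  have ht : ∀ i < es.length, ∀ s, I i s → (RAM.Expr.lt (.reg 16) (.reg 1)).eval w s ≠ 0 := by
    intro i hi s h
    simp only [RAM.Expr.eval, (h1 i s h).1, (h1 i s h).2, hw.one_mod]
    rw [if_pos hi]; norm_num
  have ht' : ∀ s, I es.length s → (RAM.Expr.lt (.reg 16) (.reg 1)).eval w s = 0 := by
    intro s h
    simp only [RAM.Expr.eval, (h1 _ s h).1, (h1 _ s h).2]
    rw [if_neg (lt_irrefl _)]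
  obtain ⟨s, hs, e2⟩ := RAM.ExecLe.loop_count es.length I
    (fun i hi s h => ⟨ht i hi s h, hI ⟨i, hi⟩ s h⟩) ht' h0
  exact ⟨s, hs, (e1.seq e2).mono (by omega)⟩

theorem colorCode_le (c : Option (Fin k)) : colorCode c ≤ k := by
  cases c with
  | none => exact Nat.zero_le _
  | some c => exact c.isLt

theorem colorCode_eq_succ {o : Option (Fin k)} {c : Fin k} : colorCode o = c + 1 ↔ o = some c := by
  cases o with
  | none => simp [colorCode]
  | some d => simp [colorCode, Fin.ext_iff]

theorem tab_index_code_inj {x y : Fin n} {c : Fin k} {o : Option (Fin k)}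
    (h : (x : ℕ) * (k + 1) + (c + 1) = y * (k + 1) + colorCode o) : x = y ∧ o = some c := by
  have h1 := congrArg (· / (k + 1)) h
  have h2 := congrArg (· % (k + 1)) h
  have hc := c.isLt
  have ho := colorCode_le o
  simp only [mul_comm _ (k + 1), Nat.mul_add_mod, Nat.mul_add_div (Nat.succ_pos k)] at h1 h2
  rw [Nat.mod_eq_of_lt (by omega), Nat.mod_eq_of_lt (by omega)] at h2
  rw [Nat.div_eq_of_lt (by omega), Nat.div_eq_of_lt (by omega)] at h1
  exact ⟨Fin.ext (by omega), colorCode_eq_succ.1 h2.symm⟩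

/-- The state before edge `i` is removed from the tables. -/
structure Clearing (χ₀ : PartialEdgeColoring G k) (es : List (Fin n × Fin n))
    (fs : List (UFan (Fin n) k)) (S R B : ℕ) (χ : PartialEdgeColoring G k) (i : ℕ)
    (s : RAM.State) : Prop where
  static : Static χ₀ es fs S R B s
  index : s.reg 16 = i
  col : ∀ i : Fin es.length, s.mem 2 i = colorCode (χ.color (edgeAt es i))
  tab : ∀ (x : Fin n) (c : Fin k), s.mem 10 (x * (k + 1) + (c + 1)) ≠ 0 →
    ∃ j : Fin es.length, i ≤ j ∧ x ∈ edgeAt es j ∧ χ.color (edgeAt es j) = some c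
  stamp : ∀ (j : Fin es.length) (z : Fin n), (j : ℕ) < i → z ∈ edgeAt es j → s.mem 11 z = 0
  mark : ∀ (j : Fin es.length) (z : Fin n), (j : ℕ) < i → z ∈ edgeAt es j → s.mem 12 z = 0

/-- The table has about `n * k` cells, too many to be cleared one by one. Every nonzero entry
belongs to an edge and its present color, so it suffices to go through the edges. -/
theorem clearEdge_spec (hw : WordBounds n k es.length w) (i : Fin es.length)
    (h : Clearing χ₀ es fs S R B χ i s₀) :
    ∃ s, Clearing χ₀ es fs S R B χ (i + 1) s ∧
      RAM.ExecLe w (.block (RAM.loadEdge ++ RAM.clearEdge ++ [RAM.nextEdge])) s₀ s 19 := by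
  set p : RAM.Prog := .block (RAM.loadEdge ++ RAM.clearEdge ++ [RAM.nextEdge]) with hp
  set s := p.sem w s₀ with hs
  obtain ⟨u, hu⟩ : ∃ u, u = (es.get i).1 := ⟨_, rfl⟩
  obtain ⟨v, hv⟩ : ∃ v, v = (es.get i).2 := ⟨_, rfl⟩
  obtain ⟨o, ho⟩ : ∃ o, o = χ.color (edgeAt es i) := ⟨_, rfl⟩
  have h0 : s₀.mem 0 i = u := by rw [h.static.src, hu]
  have h1 : s₀.mem 1 i = v := by rw [h.static.dst, hv]
  have h2 : s₀.mem 2 i = colorCode o := by rw [h.col, ho]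
  have hi : ((i : ℕ) + 1) % 2 ^ w = i + 1 :=
    Nat.mod_eq_of_lt (hw.lt_of_le (by have := hw.edges; have := i.isLt; nlinarith))
  have hlt : ∀ x : Fin n, (x : ℕ) * (k + 1) + colorCode o < 2 ^ w := fun x =>
    hw.index_lt x.isLt (colorCode_le o)
  have m3 : ∀ x : Fin n, (x : ℕ) * (k + 1) % 2 ^ w = x * (k + 1) := fun x =>
    Nat.mod_eq_of_lt (by have := hlt x; omega)
  have m4 : ∀ x : Fin n, ((x : ℕ) * (k + 1) + colorCode o) % 2 ^ w = x * (k + 1) + colorCode o :=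
    fun x => Nat.mod_eq_of_lt (hlt x)
  have g : ∀ y, s.reg y = if y = 16 then (i + 1 : ℕ) else if y = 21 then colorCode o else
      if y = 19 then (v : ℕ) else if y = 18 then (u : ℕ) else s₀.reg y := by
    intro y
    simp only [hs, hp, RAM.loadEdge, RAM.clearEdge, RAM.nextEdge, List.cons_append, List.nil_append,
      RAM.Prog.block, RAM.Prog.sem, RAM.State.reg_setReg, RAM.State.reg_setMem,
      RAM.State.mem_setReg, RAM.Expr.eval, h.index, h0, h1, h2, hw.one_mod, hi, Nat.reduceEqDiff,
      if_false]
  have km : s.mem = fun y => if y = 12 then Function.update (Function.update (s₀.mem 12) u 0) v 0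
      else if y = 11 then Function.update (Function.update (s₀.mem 11) u 0) v 0
      else if y = 10 then Function.update (Function.update (s₀.mem 10) (u * (k + 1) + colorCode o) 0)
        (v * (k + 1) + colorCode o) 0 else s₀.mem y := by
    funext y
    simp only [hs, hp, RAM.loadEdge, RAM.clearEdge, RAM.nextEdge, List.cons_append, List.nil_append,
      RAM.Prog.block, RAM.Prog.sem, RAM.State.reg_setReg, RAM.State.reg_setMem, RAM.tabIdx,
      RAM.State.mem_setReg, RAM.State.mem_setMem, RAM.Expr.eval, h.index, h0, h1, h2,
      h.static.reg5, m3, m4, Nat.zero_mod, Nat.reduceEqDiff, if_false, if_true]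
    split_ifs <;> rfl
  have hmem : ∀ z, z ∈ edgeAt es i ↔ z = u ∨ z = v := fun z => by
    rw [edgeAt, Sym2.mem_iff, hu, hv]
  refine ⟨s, ⟨?_, ?_, ?_, ?_, ?_, ?_⟩,
    RAM.ExecLe.straight w (by simp [hp, RAM.loadEdge, RAM.clearEdge, RAM.nextEdge, RAM.Prog.block,
      RAM.Prog.Straight]) s₀⟩
  · refine h.static.of_eq (fun y hy => ?_) fun a ha _ => ?_
    · rw [g, if_neg, if_neg, if_neg, if_neg] <;> omega
    · rw [km]; simp only []; rw [if_neg, if_neg, if_neg] <;> omega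
  · rw [g]; rfl
  · rw [km]; exact h.col
  · intro x c hx
    rw [km] at hx
    simp only [Nat.reduceEqDiff, if_false, if_true] at hx
    have hxv : (x : ℕ) * (k + 1) + (c + 1) ≠ v * (k + 1) + colorCode o := by
      intro h; rw [h, Function.update_self] at hx; exact hx rfl
    rw [Function.update_of_ne hxv] at hx
    have hxu : (x : ℕ) * (k + 1) + (c + 1) ≠ u * (k + 1) + colorCode o := by
      intro h; rw [h, Function.update_self] at hx; exact hx rfl
    rw [Function.update_of_ne hxu] at hx
    obtain ⟨j, hj, h3, h4⟩ := h.tab x c hx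
    refine ⟨j, Nat.succ_le_of_lt (lt_of_le_of_ne hj fun hij => ?_), h3, h4⟩
    have hij : i = j := Fin.ext hij
    subst hij
    rw [← ho] at h4
    rw [h4] at hxu hxv
    rcases (hmem x).1 h3 with rfl | rfl
    · exact hxu rfl
    · exact hxv rfl
  · intro j z hj hz
    rw [km]
    simp only [Nat.reduceEqDiff, if_false, if_true, Function.update_apply, Fin.val_inj]
    split_ifs with h3 h4
    · rfl
    · rfl
    · refine h.stamp j z (lt_of_le_of_ne (Nat.lt_succ_iff.1 hj) fun hij => ?_) hz
      rw [Fin.ext hij, hmem] at hz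
      tauto
  · intro j z hj hz
    rw [km]
    simp only [if_true, Function.update_apply, Fin.val_inj]
    split_ifs with h3 h4
    · rfl
    · rfl
    · refine h.mark j z (lt_of_le_of_ne (Nat.lt_succ_iff.1 hj) fun hij => ?_) hz
      rw [Fin.ext hij, hmem] at hz
      tauto

/-- The state before edge `i` gets its original color. -/
structure Restoring (χ₀ : PartialEdgeColoring G k) (es : List (Fin n × Fin n))
    (fs : List (UFan (Fin n) k)) (S R B : ℕ) (i : ℕ) (s : RAM.State) : Prop where
  static : Static χ₀ es fs S R B s
  index : s.reg 16 = i
  col : ∀ j : Fin es.length, (j : ℕ) < i → s.mem 2 j = colorCode (χ₀.color (edgeAt es j))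
  tab : ∀ (x : Fin n) (c : Fin k), (s.mem 10 (x * (k + 1) + (c + 1)) = 0 ∧
      ∀ j : Fin es.length, (j : ℕ) < i → x ∈ edgeAt es j → χ₀.color (edgeAt es j) ≠ some c) ∨
    ∃ j : Fin es.length, s.mem 10 (x * (k + 1) + (c + 1)) = j + 1 ∧ x ∈ edgeAt es j ∧
      χ₀.color (edgeAt es j) = some c
  stamp : ∀ z : Fin n, (∃ j, z ∈ edgeAt es j) → s.mem 11 z = 0
  mark : ∀ z : Fin n, (∃ j, z ∈ edgeAt es j) → s.mem 12 z = 0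

theorem restoreEdge_spec (hw : WordBounds n k es.length w) (i : Fin es.length)
    (h : Restoring χ₀ es fs S R B i s₀) :
    ∃ s, Restoring χ₀ es fs S R B (i + 1) s ∧
      RAM.ExecLe w (.block (RAM.loadEdge ++ RAM.restoreEdge ++ [RAM.nextEdge])) s₀ s 13 := by
  set p : RAM.Prog := .block (RAM.loadEdge ++ RAM.restoreEdge ++ [RAM.nextEdge]) with hp
  set s := p.sem w s₀ with hs
  obtain ⟨u, hu⟩ : ∃ u, u = (es.get i).1 := ⟨_, rfl⟩
  obtain ⟨v, hv⟩ : ∃ v, v = (es.get i).2 := ⟨_, rfl⟩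
  obtain ⟨o, ho⟩ : ∃ o, o = χ₀.color (edgeAt es i) := ⟨_, rfl⟩
  have h0 : s₀.mem 0 i = u := by rw [h.static.src, hu]
  have h1 : s₀.mem 1 i = v := by rw [h.static.dst, hv]
  have h2 : s₀.mem 8 i = colorCode o := by rw [h.static.orig, ho]
  have hi : ((i : ℕ) + 1) % 2 ^ w = i + 1 :=
    Nat.mod_eq_of_lt (hw.lt_of_le (by have := hw.edges; have := i.isLt; nlinarith))
  have hlt : ∀ x : Fin n, (x : ℕ) * (k + 1) + colorCode o < 2 ^ w := fun x =>
    hw.index_lt x.isLt (colorCode_le o)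
  have m3 : ∀ x : Fin n, (x : ℕ) * (k + 1) % 2 ^ w = x * (k + 1) := fun x =>
    Nat.mod_eq_of_lt (by have := hlt x; omega)
  have m4 : ∀ x : Fin n, ((x : ℕ) * (k + 1) + colorCode o) % 2 ^ w = x * (k + 1) + colorCode o :=
    fun x => Nat.mod_eq_of_lt (hlt x)
  have g : ∀ y, s.reg y = if y = 16 then (i + 1 : ℕ) else if y = 21 then colorCode o else
      if y = 19 then (v : ℕ) else if y = 18 then (u : ℕ) else s₀.reg y := by
    intro y
    simp only [hs, hp, RAM.loadEdge, RAM.restoreEdge, RAM.nextEdge, List.cons_append,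
      List.nil_append, RAM.Prog.block, RAM.Prog.sem, RAM.State.reg_setReg, RAM.State.reg_setMem,
      RAM.State.mem_setReg, RAM.Expr.eval, h.index, h0, h1, h2, hw.one_mod, hi, Nat.reduceEqDiff,
      if_false]
  have km : s.mem = fun y => if y = 10 then
      Function.update (Function.update (s₀.mem 10) (u * (k + 1) + colorCode o) (i + 1))
        (v * (k + 1) + colorCode o) (i + 1) else
      if y = 2 then Function.update (s₀.mem 2) i (colorCode o) else s₀.mem y := by
    funext y
    simp only [hs, hp, RAM.loadEdge, RAM.restoreEdge, RAM.nextEdge, List.cons_append,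
      List.nil_append, RAM.Prog.block, RAM.Prog.sem, RAM.State.reg_setReg, RAM.State.reg_setMem,
      RAM.tabIdx, RAM.State.mem_setReg, RAM.State.mem_setMem, RAM.Expr.eval, h.index, h0, h1, h2,
      h.static.reg5, hw.one_mod, hi, m3, m4, Nat.reduceEqDiff, if_false, if_true]
    split_ifs <;> rfl
  have hmem : ∀ z, z ∈ edgeAt es i ↔ z = u ∨ z = v := fun z => by
    rw [edgeAt, Sym2.mem_iff, hu, hv]
  refine ⟨s, ⟨?_, ?_, ?_, ?_, ?_, ?_⟩,
    RAM.ExecLe.straight w (by simp [hp, RAM.loadEdge, RAM.restoreEdge, RAM.nextEdge, RAM.Prog.block,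
      RAM.Prog.Straight]) s₀⟩
  · refine h.static.of_eq (fun y hy => ?_) fun a ha ha' => ?_
    · rw [g, if_neg, if_neg, if_neg, if_neg] <;> omega
    · rw [km]; simp only []; rw [if_neg, if_neg] <;> omega
  · rw [g]; rfl
  · intro j hj
    rw [km]
    simp only [Nat.reduceEqDiff, if_false, if_true]
    by_cases hij : j = i
    · rw [hij, Function.update_self, ho]
    · have hne : (j : ℕ) ≠ i := by rwa [ne_eq, Fin.val_inj]
      rw [Function.update_of_ne hne]
      exact h.col j (by omega)
  · intro x c
    rw [km]
    simp only [if_true]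
    by_cases hx : o = some c ∧ (x = u ∨ x = v)
    · refine Or.inr ⟨i, ?_, (hmem x).2 hx.2, ho ▸ hx.1⟩
      have hc : colorCode o = c + 1 := colorCode_eq_succ.2 hx.1
      rw [hc, Function.update_apply, Function.update_apply]
      rcases hx.2 with rfl | rfl
      · rw [if_pos (c := _ = (x : ℕ) * (k + 1) + _) rfl, ite_self]
      · rw [if_pos rfl]
    · rw [Function.update_of_ne, Function.update_of_ne]
      · rcases h.tab x c with ⟨h3, h4⟩ | ⟨j, h3, h4, h5⟩
        · refine Or.inl ⟨h3, fun j hj hxj hc => ?_⟩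
          by_cases hij : j = i
          · subst hij
            exact hx ⟨ho.trans hc, (hmem x).1 hxj⟩
          · have hne : (j : ℕ) ≠ i := by rwa [ne_eq, Fin.val_inj]
            exact h4 j (by omega) hxj hc
        · exact Or.inr ⟨j, h3, h4, h5⟩
      · intro h3
        obtain ⟨h4, h5⟩ := tab_index_code_inj h3
        exact hx ⟨h5, Or.inl h4⟩
      · intro h3
        obtain ⟨h4, h5⟩ := tab_index_code_inj h3
        exact hx ⟨h5, Or.inr h4⟩
  · intro z hz; rw [km]; exact h.stamp z hz
  · intro z hz; rw [km]; exact h.mark z hz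

/-- Less than `ColRep` is assumed about the table, so that the first attempt can start from the zero
table, in which the edges colored by `χ₀` have not been entered. All edges are cleared before any is
restored, because restored entries could otherwise be erased again. -/
theorem reset_spec (hw : WordBounds n k es.length w)
    (hG : ∀ e ∈ G.edgeSet, ∃ i, edgeAt es i = e) (h : Static χ₀ es fs S R B s₀)
    (hcol : ∀ i : Fin es.length, s₀.mem 2 i = colorCode (χ.color (edgeAt es i)))
    (htab : ∀ (x : Fin n) (c : Fin k), s₀.mem 10 (x * (k + 1) + (c + 1)) ≠ 0 →
      ∃ j : Fin es.length, x ∈ edgeAt es j ∧ χ.color (edgeAt es j) = some c) :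
    ∃ s, Between χ₀ es fs S R B χ₀ 0 0 0 s ∧
      RAM.ExecLe w RAM.reset s₀ s (es.length * 34 + 13) := by
  have g16 : ∀ s : RAM.State, (s.setReg 16 0).reg 16 = 0 := fun s => by
    rw [RAM.State.reg_setReg, if_pos rfl]
  have gst : ∀ s : RAM.State, Static χ₀ es fs S R B s → Static χ₀ es fs S R B (s.setReg 16 0) :=
    fun s hs => hs.of_eq (fun y hy => by rw [RAM.State.reg_setReg, if_neg (by omega)])
      fun _ _ _ => rfl
  obtain ⟨s₁, h1, e1⟩ := forEdges_spec (s₀ := s₀) (es := es) hw (l := RAM.clearEdge)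
    (I := Clearing χ₀ es fs S R B χ) (fun i s hs => ⟨hs.static.reg1, hs.index⟩)
    ⟨gst _ h, g16 _, hcol, fun x c hx => by
      obtain ⟨j, hj⟩ := htab x c hx
      exact ⟨j, Nat.zero_le _, hj⟩, fun _ _ hj => absurd hj (Nat.not_lt_zero _),
      fun _ _ hj => absurd hj (Nat.not_lt_zero _)⟩ fun i s hs => clearEdge_spec hw i hs
  obtain ⟨s₂, h2, e2⟩ := forEdges_spec (s₀ := s₁) (es := es) hw (l := RAM.restoreEdge)
    (I := Restoring χ₀ es fs S R B) (fun i s hs => ⟨hs.static.reg1, hs.index⟩)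
    ⟨gst _ h1.static, g16 _, fun _ hj => absurd hj (Nat.not_lt_zero _), fun x c => by
      refine Or.inl ⟨?_, fun _ hj => absurd hj (Nat.not_lt_zero _)⟩
      by_contra hx
      obtain ⟨j, hj, -⟩ := h1.tab x c hx
      exact absurd j.isLt (not_lt.2 hj), fun z ⟨j, hj⟩ => h1.stamp j z j.isLt hj,
      fun z ⟨j, hj⟩ => h1.mark j z j.isLt hj⟩ fun i s hs => restoreEdge_spec hw i hs
  set p : RAM.Prog := .block [.assign 9 (.const 0), .assign 10 (.const 0), .assign 11 (.const 0)]
    with hp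
  have g : ∀ y, (p.sem w s₂).reg y = if y = 11 then 0 else if y = 10 then 0 else
      if y = 9 then 0 else s₂.reg y := fun y => by
    simp only [hp, RAM.Prog.block, RAM.Prog.sem, RAM.State.reg_setReg, RAM.Expr.eval, Nat.zero_mod]
  have hmem : (p.sem w s₂).mem = s₂.mem := rfl
  refine ⟨p.sem w s₂, ⟨?_, ⟨?_, ?_⟩, ?_, ?_, ?_, ?_, ?_⟩, (e1.seq (e2.seq (RAM.ExecLe.straight w
    (by simp [RAM.Prog.block, RAM.Prog.Straight]) s₂))).mono ?_⟩
  · refine h2.static.of_eq (fun y hy => ?_) fun _ _ _ => rfl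
    rw [g, if_neg, if_neg, if_neg] <;> omega
  · exact fun i => h2.col i i.isLt
  · intro x c
    rw [hmem]
    rcases h2.tab x c with ⟨h3, h4⟩ | h3
    · refine Or.inl ⟨h3, fun e hxe hc => ?_⟩
      obtain ⟨j, rfl⟩ := hG e (χ₀.mem_edgeSet_of_color e c hc)
      exact h4 j j.isLt hxe hc
    · exact Or.inr h3
  · rw [g]; rfl
  · rw [g]; rfl
  · rw [g]; rfl
  · intro z hz; rw [hmem, h2.stamp z hz]
  · intro z hz; rw [hmem, h2.mark z hz]
  · simp only [RAM.Prog.block, RAM.Prog.len]; omega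

end

/-! ### Repeated attempts. -/

section

open PartialEdgeColoring

variable {n k : ℕ} {G : SimpleGraph (Fin n)} {es : List (Fin n × Fin n)}
  {χ₀ χ : PartialEdgeColoring G k} {fs : List (UFan (Fin n) k)}
  {S R B w : ℕ} {s₀ : RAM.State} {U : Finset (UFan (Fin n) k)} {cnt : ℕ}

/-! ### Repeated attempts -/

namespace RAM

/-- The main loop. -/
def mainLoop : Prog := .loop (.lt (.mul (.reg 9) (.const 48000)) (.reg 3)) <|
  .seq reset (.loop (.lt (.reg 11) (.reg 7)) round)

end RAM

/-- The state between two attempts. -/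
structure Waiting (χ₀ : PartialEdgeColoring G k) (U : Finset (UFan (Fin n) k))
    (es : List (Fin n × Fin n)) (fs : List (UFan (Fin n) k)) (S R B : ℕ)
    (χ : PartialEdgeColoring G k) (cnt : ℕ) (s : RAM.State) : Prop where
  static : Static χ₀ es fs S R B s
  col : ∀ i : Fin es.length, s.mem 2 i = colorCode (χ.color (edgeAt es i))
  tab : ∀ (x : Fin n) (c : Fin k), s.mem 10 (x * (k + 1) + (c + 1)) ≠ 0 →
    ∃ j : Fin es.length, x ∈ edgeAt es j ∧ χ.color (edgeAt es j) = some c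
  count : s.reg 9 = cnt
  progress : Progress χ₀ U χ cnt
  cnt_le : cnt ≤ es.length

theorem Attempt.waiting (hS : Setup χ₀ U es fs S R B w) {bud : ℕ}
    (h : Attempt χ₀ U es fs S R B R χ cnt bud s₀) : Waiting χ₀ U es fs S R B χ cnt s₀ := by
  refine ⟨h.mem.static, h.mem.rep.col, fun x c hx => ?_, h.mem.cnt, h.progress, ?_⟩
  · rcases h.mem.rep.tab x c with ⟨h1, -⟩ | ⟨j, -, h2⟩
    · exact absurd h1 hx
    · exact ⟨j, h2⟩
  · have := h.cnt_le
    have := hS.mul_le_length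
    have := hS.fans_le
    rw [mul_comm] at this
    nlinarith

theorem Waiting.test (hw : WordBounds n k es.length w) (h : Waiting χ₀ U es fs S R B χ cnt s₀) :
    (RAM.Expr.lt (.mul (.reg 9) (.const 48000)) (.reg 3)).eval w s₀ =
      if cnt * 48000 < fs.length then 1 else 0 := by
  have h1 := h.cnt_le
  have h2 := hw.edges
  have m1 : 48000 % 2 ^ w = 48000 := Nat.mod_eq_of_lt (hw.lt_of_le (by nlinarith))
  have m2 : cnt * 48000 % 2 ^ w = cnt * 48000 := Nat.mod_eq_of_lt (hw.lt_of_le (by nlinarith))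
  simp only [RAM.Expr.eval, h.count, h.static.reg3, m1, m2, hw.one_mod]

/-- The output is correct. -/
def Correct (χ₀ : PartialEdgeColoring G k) (U : Finset (UFan (Fin n) k)) (es : List (Fin n × Fin n))
    (s : RAM.State) : Prop :=
  ∃ (χ' : PartialEdgeColoring G k) (F : Finset (Sym2 (Fin n))),
    Represents s es χ' ∧ F ⊆ U.biUnion UFan.edges ∧ (1 / 48000 : ℝ) * (U.card : ℝ) ≤ (F.card : ℝ) ∧
      χ₀.ExtendsTo χ' F

theorem Waiting.correct (h : Waiting χ₀ U es fs S R B χ cnt s₀) (hU : U.card = fs.length)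
    (hc : fs.length ≤ cnt * 48000) : Correct χ₀ U es s₀ := by
  obtain ⟨F, h1, h2, h3⟩ := h.progress.colored
  refine ⟨χ, F, fun i => h.col i, h1, ?_, h3, h.progress.keep⟩
  have : (fs.length : ℝ) ≤ cnt * 48000 := by exact_mod_cast hc
  rw [hU, h2]
  linarith

theorem Waiting.ensures_of_le (hw : WordBounds n k es.length w)
    (h : Waiting χ₀ U es fs S R B χ cnt s₀) (hU : U.card = fs.length)
    (hc : fs.length ≤ cnt * 48000) (N : ℕ) :
    RAM.Ensures w (Correct χ₀ U es) 1 N ([RAM.mainLoop], s₀) 1 := by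
  refine RAM.Ensures.loop_false (t := 0) ?_ (RAM.Ensures.nil (h.correct hU hc))
  rw [h.test hw, if_neg (by omega)]

theorem Setup.card_eq (hS : Setup χ₀ U es fs S R B w) : U.card = fs.length := by
  have : (fs.length : ℝ) = U.card := by simpa using hS.sum_get fun _ => 1
  exact_mod_cast this.symm

/-- The initial potential `-1 / 32 + 3 / 64 = 1 / 64` is the success probability of one attempt: at
the end it is at most `1`, since `cnt ≤ R * S`, and after a failure `cnt * 48000 < λ ≤ 1500 * (R *
S)` makes it at most `0`, where `48000 = 1500 * 32`. -/
theorem Waiting.ensures_of_lt (hS : Setup χ₀ U es fs S R B w)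
    (h : Waiting χ₀ U es fs S R B χ cnt s₀) (hc : cnt * 48000 < fs.length) {q : ℝ} (hq0 : 0 ≤ q)
    (hq1 : q ≤ 1) {T N : ℕ} (hT : 1 ≤ T)
    (hq : ∀ s χ cnt, Waiting χ₀ U es fs S R B χ cnt s →
      RAM.Ensures w (Correct χ₀ U es) T N ([RAM.mainLoop], s) q) :
    RAM.Ensures w (Correct χ₀ U es) (T + 310000 * es.length) (N + 1) ([RAM.mainLoop], s₀)
      (1 - 63 / 64 * (1 - q)) := by
  have hm := hS.length_pos
  have hRp : (0 : ℝ) < R := by exact_mod_cast hS.R_pos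
  have hSp : (0 : ℝ) < S := by exact_mod_cast hS.S_pos
  obtain ⟨s₁, h1, e1⟩ := reset_spec hS.word hS.edge h.static h.col h.tab
  have hatt : Attempt χ₀ U es fs S R B 0 χ₀ 0 0 s₁ :=
    ⟨h1, Progress.zero, by rw [deadCount_eq_zero hS.sep]; omega, Nat.zero_le _, Nat.zero_le _⟩
  have hend : ∀ s χ cnt bud, Attempt χ₀ U es fs S R B R χ cnt bud s →
      RAM.Ensures w (Correct χ₀ U es) T N ([RAM.mainLoop], s)
        (gain q (potential S R B R cnt bud)) := by
    intro s χ cnt bud h2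
    have hw2 := h2.waiting hS
    have hbud : (0 : ℝ) ≤ bud * (B : ℝ)⁻¹ := by positivity
    by_cases hc : fs.length ≤ cnt * 48000
    · refine (hw2.ensures_of_le hS.word hS.card_eq hc N).mono hT ?_
      have h3 : (cnt : ℝ) ≤ R * S := by
        have := h2.cnt_le
        rw [mul_comm]
        exact_mod_cast this
      have h4 : (cnt : ℝ) * (R * S : ℝ)⁻¹ ≤ 1 := by
        rw [← div_eq_mul_inv, div_le_one (by positivity)]; exact h3
      have h5 : potential S R B R cnt bud ≤ 1 := by rw [potential]; linarith
      have h6 : max 0 (potential S R B R cnt bud) ≤ 1 := max_le zero_le_one h5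
      rw [gain]
      nlinarith
    · rw [gain_of_nonpos]
      · exact hq _ _ _ hw2
      · have h3 : (cnt : ℝ) * 48000 ≤ 1500 * (R * S) := by
          have := hS.le_mul
          exact_mod_cast (show cnt * 48000 ≤ 1500 * (R * S) by omega)
        have h4 : (cnt : ℝ) * (R * S : ℝ)⁻¹ ≤ 1 / 32 := by
          rw [← div_eq_mul_inv, div_le_iff₀ (by positivity)]
          linarith
        rw [potential]
        linarith
  have hloop := attempt_ensures hS hq0 hq1 hend R (zero_add R) hatt
  have htest : (RAM.Expr.lt (.mul (.reg 9) (.const 48000)) (.reg 3)).eval w s₀ ≠ 0 := by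
    rw [h.test hS.word, if_pos hc]; norm_num
  refine (RAM.Ensures.of_step_succ (t := T + 300240 * es.length + R * (S * 230 + 21) + 1 +
    (es.length * 34 + 13) + 1) ?_ ((e1.ensures (hloop.mono ?_ ?_)).seq)).mono ?_ le_rfl
  · simp only [RAM.mainLoop, RAM.step, if_pos htest]
  · omega
  · have : potential S R B 0 0 0 = 1 / 64 := by
      rw [potential]
      push_cast
      field_simp
      ring
    rw [this, gain, max_eq_right (by norm_num)]
    linarith
  -- `300240 = 20 * 15012` steps per edge of `G` pay for the flipped paths; the draws and the reset
  -- take few steps in comparison, since `R * S ≤ λ ≤ m / 2`.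
  · have h2 := hS.mul_le_length
    have h3 := hS.fans_le
    have h4 : R * (S * 230 + 21) ≤ 251 * (R * S) := by
      have := hS.S_pos
      nlinarith [Nat.zero_le R]
    omega

theorem Waiting.ensures (hS : Setup χ₀ U es fs S R B w) (j N : ℕ)
    (h : Waiting χ₀ U es fs S R B χ cnt s₀) :
    RAM.Ensures w (Correct χ₀ U es) (j * (310000 * es.length) + 1) N ([RAM.mainLoop], s₀)
      (1 - (63 / 64) ^ j) := by
  have hpow : ∀ j : ℕ, (0 : ℝ) ≤ (63 / 64) ^ j ∧ ((63 : ℝ) / 64) ^ j ≤ 1 := fun j =>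
    ⟨by positivity, pow_le_one₀ (by norm_num) (by norm_num)⟩
  have hdone : ∀ {s χ cnt}, Waiting χ₀ U es fs S R B χ cnt s → fs.length ≤ cnt * 48000 → ∀ j N,
      RAM.Ensures w (Correct χ₀ U es) (j * (310000 * es.length) + 1) N ([RAM.mainLoop], s)
        (1 - (63 / 64) ^ j) := fun h hc j N =>
    (h.ensures_of_le hS.word hS.card_eq hc N).mono (by omega) (by linarith [(hpow j).1])
  induction j generalizing N χ cnt s₀ with
  | zero =>
    -- For `j = 0` nothing is claimed about halting. The safety part follows by induction on `N`,
    -- since a pass of the main loop takes at least one step.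
    induction N generalizing χ cnt s₀ with
    | zero =>
      refine ⟨by simp, fun s hs => ?_⟩
      rw [RAM.runFrom, PMF.mem_support_pure_iff] at hs
      simp at hs
    | succ N ih =>
      by_cases hc : fs.length ≤ cnt * 48000
      · exact hdone h hc 0 _
      · refine ⟨by simp, (h.ensures_of_lt hS (by omega) le_rfl zero_le_one le_rfl
          fun s χ cnt h' => ?_).safe⟩
        simpa using ih h'
  | succ j ih =>
    by_cases hc : fs.length ≤ cnt * 48000
    · exact hdone h hc (j + 1) N
    · refine (h.ensures_of_lt hS (by omega) (sub_nonneg.2 (hpow j).2)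
        (sub_le_self 1 (hpow j).1) (by omega) fun s χ cnt h' => ih N h').of_succ.mono
        (by ring_nf; omega) (le_of_eq ?_)
      rw [pow_succ]; ring

end

/-! ### Initialization and the complete algorithm. -/

open PartialEdgeColoring

namespace RAM

/-- The algorithm: attempts are repeated until one is successful. -/
def algorithm : Prog := .seq parameters (.seq (forEdges enterEdge) mainLoop)

end RAM

section

variable {n k : ℕ} {G : SimpleGraph (Fin n)} {es : List (Fin n × Fin n)}
  {χ₀ χ : PartialEdgeColoring G k} {fs : List (UFan (Fin n) k)}
  {S R B w : ℕ} {s₀ s₁ : RAM.State} {U : Finset (UFan (Fin n) k)}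

/-- The state before edge `i` is entered into the adjacency table; `s₁` is the state before the
first edge. -/
structure Entering (es : List (Fin n × Fin n)) (s₁ : RAM.State) (i : ℕ) (s : RAM.State) :
    Prop where
  reg : ∀ y < 16, s.reg y = s₁.reg y
  index : s.reg 16 = i
  mem : ∀ a, a ≠ 8 → a ≠ 9 → s.mem a = s₁.mem a
  orig : ∀ j : Fin es.length, (j : ℕ) < i → s.mem 8 j = s₁.mem 2 j
  adj : ∀ j : Fin es.length, (j : ℕ) < i →
    s.mem 9 ((es.get j).1 * n + (es.get j).2) = j + 1 ∧
    s.mem 9 ((es.get j).2 * n + (es.get j).1) = j + 1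

theorem adj_index_inj {u v u' v' : Fin n} (h : (u : ℕ) * n + v = u' * n + v') : u = u' ∧ v = v' := by
  have hn : 0 < n := u.pos
  have h1 := congrArg (· / n) h
  have h2 := congrArg (· % n) h
  simp only [mul_comm _ n, Nat.mul_add_mod, Nat.mul_add_div hn] at h1 h2
  rw [Nat.mod_eq_of_lt v.isLt, Nat.mod_eq_of_lt v'.isLt] at h2
  rw [Nat.div_eq_of_lt v.isLt, Nat.div_eq_of_lt v'.isLt] at h1
  exact ⟨Fin.ext (by omega), Fin.ext h2⟩

/-- Different edges use different cells, whichever way they are oriented, so earlier entries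
survive. -/
theorem enterEdge_spec (hw : WordBounds n k es.length w) (hes : Function.Injective (edgeAt es))
    (hn : s₁.reg 0 = n) (hsrc : ∀ i : Fin es.length, s₁.mem 0 i = (es.get i).1)
    (hdst : ∀ i : Fin es.length, s₁.mem 1 i = (es.get i).2) (i : Fin es.length)
    (h : Entering es s₁ i s₀) :
    ∃ s, Entering es s₁ (i + 1) s ∧
      RAM.ExecLe w (.block (RAM.loadEdge ++ RAM.enterEdge ++ [RAM.nextEdge])) s₀ s 11 := by
  set p : RAM.Prog := .block (RAM.loadEdge ++ RAM.enterEdge ++ [RAM.nextEdge]) with hp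
  set s := p.sem w s₀ with hs
  obtain ⟨u, hu⟩ : ∃ u, u = (es.get i).1 := ⟨_, rfl⟩
  obtain ⟨v, hv⟩ : ∃ v, v = (es.get i).2 := ⟨_, rfl⟩
  have h0 : s₀.mem 0 i = u := by rw [h.mem _ (by norm_num) (by norm_num), hsrc, hu]
  have h1 : s₀.mem 1 i = v := by rw [h.mem _ (by norm_num) (by norm_num), hdst, hv]
  have hn' : s₀.reg 0 = n := by rw [h.reg _ (by norm_num), hn]
  have hi : ((i : ℕ) + 1) % 2 ^ w = i + 1 :=
    Nat.mod_eq_of_lt (hw.lt_of_le (by have := hw.edges; have := i.isLt; nlinarith))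
  have huv := hw.adj_index_lt u.isLt v.isLt
  have hvu := hw.adj_index_lt v.isLt u.isLt
  have m1 : (u : ℕ) * n % 2 ^ w = u * n := Nat.mod_eq_of_lt (by omega)
  have m2 : (v : ℕ) * n % 2 ^ w = v * n := Nat.mod_eq_of_lt (by omega)
  have m3 : ((u : ℕ) * n + v) % 2 ^ w = u * n + v := Nat.mod_eq_of_lt huv
  have m4 : ((v : ℕ) * n + u) % 2 ^ w = v * n + u := Nat.mod_eq_of_lt hvu
  have g : ∀ y, s.reg y = if y = 16 then (i + 1 : ℕ) else
      if y = 19 then (v : ℕ) else if y = 18 then (u : ℕ) else s₀.reg y := by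
    intro y
    simp only [hs, hp, RAM.loadEdge, RAM.enterEdge, RAM.nextEdge, List.cons_append,
      List.nil_append, RAM.Prog.block, RAM.Prog.sem, RAM.State.reg_setReg, RAM.State.reg_setMem,
      RAM.State.mem_setReg, RAM.Expr.eval, h.index, h0, h1, hw.one_mod, hi, Nat.reduceEqDiff,
      if_false]
  have km : s.mem = fun y => if y = 9 then
      Function.update (Function.update (s₀.mem 9) (u * n + v) (i + 1)) (v * n + u) (i + 1) else
      if y = 8 then Function.update (s₀.mem 8) i (s₀.mem 2 i) else s₀.mem y := by
    funext y
    simp only [hs, hp, RAM.loadEdge, RAM.enterEdge, RAM.nextEdge, List.cons_append,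
      List.nil_append, RAM.Prog.block, RAM.Prog.sem, RAM.State.reg_setReg, RAM.State.reg_setMem,
      RAM.adjIdx, RAM.State.mem_setReg, RAM.State.mem_setMem, RAM.Expr.eval, h.index, h0, h1,
      hn', hw.one_mod, hi, Nat.reduceEqDiff, if_false]
    split_ifs
    · rw [m1, m2, m3, m4]
    · rfl
    · rfl
  refine ⟨s, ⟨?_, ?_, ?_, ?_, ?_⟩,
    RAM.ExecLe.straight w (by simp [hp, RAM.loadEdge, RAM.enterEdge, RAM.nextEdge, RAM.Prog.block,
      RAM.Prog.Straight]) s₀⟩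
  · intro y hy
    rw [g, if_neg (by omega), if_neg (by omega), if_neg (by omega), h.reg y hy]
  · rw [g]; rfl
  · intro a h8 h9
    rw [km]
    simp only [if_neg h8, if_neg h9]
    exact h.mem a h8 h9
  · intro j hj
    rw [km]
    simp only [Nat.reduceEqDiff, if_false, if_true, Function.update_apply, Fin.val_inj]
    split_ifs with hij
    · rw [hij, h.mem _ (by norm_num) (by norm_num)]
    · have hne : (j : ℕ) ≠ i := by rwa [ne_eq, Fin.val_inj]
      exact h.orig j (by omega)
  · intro j hj
    rw [km]
    simp only [if_true, Function.update_apply]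
    by_cases hij : j = i
    · subst hij
      rw [← hu, ← hv]
      simp
    · have hne : (j : ℕ) ≠ i := by rwa [ne_eq, Fin.val_inj]
      have h2 : edgeAt es j ≠ edgeAt es i := fun h' => hij (hes h')
      rw [edgeAt, edgeAt, ← hu, ← hv] at h2
      obtain ⟨h3, h4⟩ := h.adj j (by omega)
      constructor
      · rw [if_neg, if_neg, h3]
        · intro h5
          obtain ⟨h6, h7⟩ := adj_index_inj h5
          exact h2 (by rw [h6, h7])
        · intro h5
          obtain ⟨h6, h7⟩ := adj_index_inj h5
          exact h2 (by rw [h6, h7, Sym2.eq_swap])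
      · rw [if_neg, if_neg, h4]
        · intro h5
          obtain ⟨h6, h7⟩ := adj_index_inj h5
          exact h2 (by rw [h6, h7, Sym2.eq_swap])
        · intro h5
          obtain ⟨h6, h7⟩ := adj_index_inj h5
          exact h2 (by rw [h6, h7])

theorem parameters_spec (hw : WordBounds n k es.length w) (hl : fs.length ≤ es.length) {Δ : ℕ}
    (hΔ : Δ + 1 = k) (hk : k * 1500 ≤ 2 ^ 30 * ((n + 1) * (n + 1))) (χ₀ : PartialEdgeColoring G k) :
    ∃ s, (∀ y, s.reg y = if y = 8 then 15000 * es.length else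
        if y = 7 then min k (fs.length / 1500 + 1) else
        if y = 6 then fs.length / (1500 * k) + 1 else if y = 5 then k + 1 else
        if y = 4 then k else (inputState Δ χ₀ es fs).reg y) ∧
      s.mem = (inputState Δ χ₀ es fs).mem ∧
      RAM.ExecLe w RAM.parameters (inputState Δ χ₀ es fs) s 9 := by
  obtain ⟨s₀, hs₀⟩ : ∃ s₀, s₀ = inputState Δ χ₀ es fs := ⟨_, rfl⟩
  rw [← hs₀]
  have r1 : s₀.reg 1 = es.length := by rw [hs₀]; rfl
  have r2 : s₀.reg 2 = Δ := by rw [hs₀]; rfl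
  have r3 : s₀.reg 3 = fs.length := by rw [hs₀]; rfl
  have hm := hw.edges
  have hkn := hw.colors
  have key : ∀ v, v ≤ 2 ^ 30 * ((n + 1) * (n + 1)) → v % 2 ^ w = v := fun v hv =>
    Nat.mod_eq_of_lt (hw.lt_of_le hv)
  have hd1 : fs.length / 1500 ≤ fs.length := Nat.div_le_self _ _
  have hd2 : fs.length / (1500 * k) ≤ fs.length := Nat.div_le_self _ _
  have m1 : (Δ + 1) % 2 ^ w = k := by rw [hΔ]; exact key _ (by nlinarith)
  have m2 : (k + 1) % 2 ^ w = k + 1 := key _ (by nlinarith)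
  have m3 : 1500 % 2 ^ w = 1500 := key _ (by nlinarith)
  have m4 : 15000 % 2 ^ w = 15000 := key _ (by nlinarith)
  have m5 : 1500 * k % 2 ^ w = 1500 * k := key _ (by omega)
  have m6 : 15000 * es.length % 2 ^ w = 15000 * es.length := key _ (by nlinarith)
  have m7 : (fs.length / (1500 * k) + 1) % 2 ^ w = fs.length / (1500 * k) + 1 :=
    key _ (by nlinarith)
  have m8 : (fs.length / 1500 + 1) % 2 ^ w = fs.length / 1500 + 1 := key _ (by nlinarith)
  -- Truncated subtraction computes the minimum.
  have m9 : k - (k - (fs.length / 1500 + 1)) = min k (fs.length / 1500 + 1) := by omega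
  refine ⟨RAM.parameters.sem w s₀, fun y => ?_, rfl, RAM.ExecLe.straight w
    (by simp [RAM.parameters, RAM.Prog.block, RAM.Prog.Straight]) _⟩
  simp only [RAM.parameters, RAM.Prog.block, RAM.Prog.sem, RAM.State.reg_setReg, RAM.Expr.eval,
    Nat.reduceEqDiff, if_false, if_true, r1, r2, r3, hw.one_mod, m1, m2, m3, m4, m5, m6, m7, m8, m9]

theorem initialize_spec (hw : WordBounds n k es.length w) (hes : Function.Injective (edgeAt es))
    (hl : fs.length ≤ es.length) {Δ : ℕ} (hΔ : Δ + 1 = k) (χ₀ : PartialEdgeColoring G k)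
    (U : Finset (UFan (Fin n) k)) :
    ∃ s s', Waiting χ₀ U es fs (fs.length / (1500 * k) + 1) (min k (fs.length / 1500 + 1))
        (15000 * es.length) χ₀ 0 s' ∧
      RAM.ExecLe w RAM.parameters (inputState Δ χ₀ es fs) s 9 ∧
      RAM.ExecLe w (RAM.forEdges RAM.enterEdge) s s' (es.length * 12 + 3) := by
  obtain ⟨s, h1, h2, e1⟩ := parameters_spec hw hl hΔ (by have := hw.colors; nlinarith) χ₀
  have hsrc : ∀ i : Fin es.length, s.mem 0 i = (es.get i).1 := fun i => by
    rw [h2]; simp [inputState]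
  have hdst : ∀ i : Fin es.length, s.mem 1 i = (es.get i).2 := fun i => by
    rw [h2]; simp [inputState]
  have hcol : ∀ i : Fin es.length, s.mem 2 i = colorCode (χ₀.color (edgeAt es i)) := fun i => by
    rw [h2]; simp [inputState, edgeAt]
  have hg : ∀ y, y ≠ 16 → (s.setReg 16 0).reg y = s.reg y := fun y hy => by
    rw [RAM.State.reg_setReg, if_neg hy]
  obtain ⟨s', h3, e2⟩ := forEdges_spec (s₀ := s) (es := es) hw (l := RAM.enterEdge)
    (I := Entering es s) (fun i t ht => ⟨by rw [ht.reg _ (by norm_num), h1]; rfl, ht.index⟩)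
    ⟨fun y hy => hg y (by omega), by rw [RAM.State.reg_setReg, if_pos rfl], fun _ _ _ => rfl,
      fun _ hj => absurd hj (Nat.not_lt_zero _), fun _ hj => absurd hj (Nat.not_lt_zero _)⟩
    fun i t ht => enterEdge_spec hw hes (by rw [h1]; rfl) hsrc hdst i ht
  refine ⟨s, s', ⟨⟨?_, ?_, ?_, ?_, ?_, ?_, ?_, ?_, ?_, ?_, ?_, ?_, ?_, ?_, ?_, ?_, ?_⟩, ?_, ?_, ?_,
    Progress.zero, Nat.zero_le _⟩, e1, e2⟩
  iterate 8 (rw [h3.reg _ (by norm_num), h1]; rfl)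
  · intro i; rw [h3.mem _ (by norm_num) (by norm_num), hsrc]
  · intro i; rw [h3.mem _ (by norm_num) (by norm_num), hdst]
  iterate 5 (intro i; rw [h3.mem _ (by norm_num) (by norm_num), h2]; simp [inputState])
  · intro i; rw [h3.orig i i.isLt, hcol]
  · exact fun i => h3.adj i i.isLt
  · intro i; rw [h3.mem _ (by norm_num) (by norm_num), hcol]
  -- The table is still zero, so there is nothing to show.
  · intro x c hx
    rw [h3.mem _ (by norm_num) (by norm_num), h2] at hx
    exact absurd rfl hx
  · rw [h3.reg _ (by norm_num), h1]; rfl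

theorem algorithm_ensures (hw : WordBounds n k es.length w) (hes : Function.Injective (edgeAt es))
    (hU : U.card = fs.length) (hl : fs.length ≤ es.length) (hm : 0 < es.length) {Δ : ℕ}
    (hΔ : Δ + 1 = k) (χ₀ : PartialEdgeColoring G k)
    (hS : 0 < fs.length → Setup χ₀ U es fs (fs.length / (1500 * k) + 1)
      (min k (fs.length / 1500 + 1)) (15000 * es.length) w) (j N : ℕ) :
    RAM.Ensures w (Correct χ₀ U es) ((j + 1) * (310000 * es.length)) N
      ([RAM.algorithm], inputState Δ χ₀ es fs) (1 - (63 / 64) ^ j) := by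
  obtain ⟨s, s', h, e1, e2⟩ := initialize_spec hw hes hl hΔ χ₀ U
  have hloop : RAM.Ensures w (Correct χ₀ U es) (j * (310000 * es.length) + 1) N
      ([RAM.mainLoop], s') (1 - (63 / 64) ^ j) := by
    rcases Nat.eq_zero_or_pos fs.length with h0 | h0
    · exact (h.ensures_of_le hw hU (by rw [h0]) N).mono (Nat.le_add_left _ _)
        (sub_le_self 1 (by positivity))
    · exact h.ensures (hS h0) j N
  exact ((e1.ensures (e2.ensures hloop).seq).seq).mono (by rw [add_mul]; omega) le_rfl

end

theorem RAM.haltFrom_le_one (w t : ℕ) (c : RAM.Config) : RAM.haltFrom w t c ≤ 1 := by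
  rw [RAM.haltFrom, PMF.toOuterMeasure_apply]
  calc ∑' x, Set.indicator {c : RAM.Config | c.1 = []} (RAM.runFrom w t c) x
      ≤ ∑' x, RAM.runFrom w t c x := ENNReal.tsum_le_tsum fun x => Set.indicator_le_self _ _ x
    _ = 1 := PMF.tsum_coe _

/-- `63 / 64 ≤ exp (-1 / 64)`, so `64 * c * log n` attempts fail with probability at most `exp (-c *
log n)`. -/
theorem pow_le_one_div_pow {n c j : ℕ} (hn : 0 < n) (h : 64 * c * Real.log n ≤ j) :
    (63 / 64 : ℝ) ^ j ≤ 1 / (n : ℝ) ^ c := by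
  have hn' : (0 : ℝ) < n := by exact_mod_cast hn
  have h1 : (63 / 64 : ℝ) ≤ Real.exp (-(1 / 64)) := by
    have := Real.add_one_le_exp (-(1 / 64 : ℝ))
    linarith
  calc (63 / 64 : ℝ) ^ j ≤ Real.exp (-(1 / 64)) ^ j := by gcongr
    _ = Real.exp (j * -(1 / 64)) := by rw [← Real.exp_nat_mul]
    _ ≤ Real.exp (-(c * Real.log n)) := Real.exp_le_exp.2 (by linarith)
    _ = 1 / (n : ℝ) ^ c := by
      rw [Real.exp_neg, Real.exp_nat_mul, Real.exp_log hn', one_div]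

/-- `2 ^ n.size` exceeds `n` and is at least `4`, so four factors cover `(n + 1) ^ 4` and sixteen
cover `2 ^ 32`; this is the origin of the `20`. -/
theorem WordBounds.of_size {n k m w : ℕ} (hn : 2 ≤ n) (hk : k ≤ n) (hm : m ≤ n * n)
    (hw : 20 * n.size ≤ w) : WordBounds n k m w := by
  refine ⟨?_, hk, hm⟩
  have h1 : n + 1 ≤ 2 ^ n.size := Nat.lt_size_self n
  have h2 : 2 ^ 2 ≤ 2 ^ n.size := by
    refine Nat.pow_le_pow_right (by norm_num) ?_
    by_contra h
    have : 2 ^ n.size ≤ 2 ^ 1 := Nat.pow_le_pow_right (by norm_num) (by omega)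
    omega
  calc 2 ^ 32 * (n + 1) ^ 4 = (2 ^ 2) ^ 16 * (n + 1) ^ 4 := by norm_num
    _ ≤ (2 ^ n.size) ^ 16 * (2 ^ n.size) ^ 4 := by gcongr
    _ = 2 ^ (20 * n.size) := by rw [← pow_add, ← pow_mul, mul_comm]
    _ ≤ 2 ^ w := Nat.pow_le_pow_right (by norm_num) hw

/-- There is a randomized word RAM program `P` such that, for every graph `G` with `n` vertices,
`m ≥ 1` edges and maximum degree `Δ`, every partial `(Δ + 1)`-edge coloring `χ` and every separable
collection `U` of u-fans, whenever `P` halts it has extended `χ` to at least `ε * |U|` edges of the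
u-fans in `U`, and `P` halts within `C c * m * log n` steps with probability at least
`1 - 1 / n ^ c`, for each exponent `c`.  Words have `Ω(log n)` bits. -/
theorem lemma6p3 :
    ∃ (P : RAM.Prog) (K : ℕ) (ε : ℝ) (C : ℕ → ℝ), 0 < ε ∧
      ∀ (n : ℕ) (G : SimpleGraph (Fin n)) [DecidableRel G.Adj]
        (χ : PartialEdgeColoring G (G.maxDegree + 1))
        (U : Finset (UFan (Fin n) (G.maxDegree + 1)))
        (es : List (Fin n × Fin n)) (fs : List (UFan (Fin n) (G.maxDegree + 1))) (w : ℕ),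
        G.edgeFinset.Nonempty → IsSeparableCollection χ U → IsEdgeList G es → IsFanList U fs →
        K * Nat.size n ≤ w →
        (∀ (t : ℕ) (s : RAM.State),
          ([], s) ∈ (RAM.run w P (inputState G.maxDegree χ es fs) t).support →
          ∃ (χ' : PartialEdgeColoring G (G.maxDegree + 1)) (F : Finset (Sym2 (Fin n))),
            Represents s es χ' ∧ F ⊆ U.biUnion UFan.edges ∧ ε * (U.card : ℝ) ≤ (F.card : ℝ) ∧
              χ.ExtendsTo χ' F) ∧
        ∀ (c t : ℕ), C c * (G.edgeFinset.card : ℝ) * Real.log (n : ℝ) ≤ (t : ℝ) →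
          1 - 1 / (n : ℝ) ^ c ≤ RAM.haltProb w P (inputState G.maxDegree χ es fs) t := by
  -- The number of attempts plus one is at most `64 * c * log n + 2`, and `2 ≤ 3 * log n` because
  -- `log 2 > 2 / 3`; each takes at most `310000 * m` steps.
  refine ⟨RAM.algorithm, 20, 1 / 48000, fun c => 310000 * (64 * c + 3), by norm_num, ?_⟩
  intro n G _ χ U es fs w hne hsep hes hfs hw
  have hcard : G.edgeFinset.card = es.length := by
    have h1 : (es.map fun p => s(p.1, p.2)).toFinset = G.edgeFinset := by
      ext e; rw [List.mem_toFinset, hes.2, SimpleGraph.mem_edgeFinset]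
    rw [← h1, List.toFinset_card_of_nodup hes.1, List.length_map]
  have hm : 0 < es.length := by rw [← hcard]; exact hne.card_pos
  have hn : 2 ≤ n := by
    obtain ⟨e, he⟩ := hne
    rw [SimpleGraph.mem_edgeFinset] at he
    induction e with
    | h u v =>
      have h1 : (u : ℕ) ≠ v := fun h => G.ne_of_adj he (Fin.ext h)
      have := u.isLt
      have := v.isLt
      omega
  have hk : G.maxDegree + 1 ≤ n := by
    have : Nonempty (Fin n) := ⟨⟨0, by omega⟩⟩
    have := G.maxDegree_lt_card_verts
    rwa [Fintype.card_fin] at this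
  have hmn : es.length ≤ n * n := by
    rw [← hcard]
    have := G.card_edgeFinset_le_card_choose_two
    rw [Fintype.card_fin] at this
    rw [Nat.choose_two_right] at this
    exact this.trans ((Nat.div_le_self _ _).trans (Nat.mul_le_mul le_rfl (Nat.sub_le _ _)))
  have hwb : WordBounds n (G.maxDegree + 1) es.length w := WordBounds.of_size hn hk hmn hw
  have hinj : Function.Injective (edgeAt es) := by
    intro i j h
    have := hes.1
    rw [List.nodup_iff_injective_get] at this
    have h2 := @this ⟨i, by simp⟩ ⟨j, by simp⟩ (by simpa [edgeAt] using h)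
    simpa [Fin.ext_iff] using h2
  have hG : ∀ e ∈ G.edgeSet, ∃ i, edgeAt es i = e := by
    intro e he
    obtain ⟨p, hp, rfl⟩ := List.mem_map.1 ((hes.2 e).2 he)
    obtain ⟨i, rfl⟩ := List.mem_iff_get.1 hp
    exact ⟨i, rfl⟩
  have hUc : U.card = fs.length := by
    have h1 : fs.toFinset = U := by ext f; rw [List.mem_toFinset, hfs.2]
    rw [← h1, List.toFinset_card_of_nodup hfs.1]
  have hl : 2 * fs.length ≤ es.length := by rw [← hUc, ← hcard]; exact hsep.card_edges
  have hmain := algorithm_ensures hwb hinj hUc (by omega) hm rfl χ fun h0 =>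
    { word := hwb
      inj := hinj
      edge := hG
      sep := hsep
      fans := hfs
      deg := fun χ' => by rw [← hcard]; exact sum_colorDeg_le
      three_le := by
        have := hsep.three_le_colors (Finset.card_pos.1 (by omega))
        omega
      colors_le := by
        have : G.maxDegree ≤ G.edgeFinset.card :=
          G.maxDegree_le_of_forall_degree_le _ fun v => G.degree_le_card_edgeFinset v
        omega
      pos := h0
      fans_le := hl
      S_eq := rfl
      R_eq := rfl
      B_eq := rfl }
  -- Correctness is the safety part of `hmain`, for which the number of attempts is irrelevant; the
  -- running time is its halting part, for which the safety index is irrelevant.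
  refine ⟨fun t s hs => ?_, fun c t ht => ?_⟩
  · rw [RAM.run_eq_runFrom] at hs
    exact (hmain 0 t).safe s hs
  · have hlog : (2 / 3 : ℝ) ≤ Real.log n := by
      have h1 := Real.log_two_gt_d9
      have h2 : Real.log 2 ≤ Real.log n :=
        Real.log_le_log (by norm_num) (by exact_mod_cast hn)
      linarith
    have hx : (0 : ℝ) ≤ 64 * c * Real.log n := by positivity
    set j := ⌈64 * c * Real.log n⌉₊ with hj
    have hj1 : 64 * c * Real.log n ≤ j := Nat.le_ceil _
    have hj2 : (j : ℝ) < 64 * c * Real.log n + 1 := Nat.ceil_lt_add_one hx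
    have hjt : (j + 1) * (310000 * es.length) ≤ t := by
      have : ((j : ℝ) + 1) * (310000 * es.length) ≤ t := by
        refine le_trans ?_ ht
        rw [hcard]
        have h3 : (j : ℝ) + 1 ≤ (64 * c + 3) * Real.log n := by linarith
        calc ((j : ℝ) + 1) * (310000 * es.length)
            ≤ (64 * c + 3) * Real.log n * (310000 * es.length) := by gcongr
          _ = 310000 * (64 * c + 3) * es.length * Real.log n := by ring
      exact_mod_cast this
    have h := (hmain j 0).mono hjt (x' := 1 - 1 / (n : ℝ) ^ c)
      (by linarith [pow_le_one_div_pow (c := c) (by omega) hj1])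
    rw [RAM.haltProb, RAM.run_eq_runFrom]
    exact (ENNReal.ofReal_le_iff_le_toReal
      ((RAM.haltFrom_le_one _ _ _).trans_lt ENNReal.one_lt_top).ne).1 h.halts
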